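/- Let $d,k\in\mathbb N$, let $f:\mathbb R^d\times\mathbb R^k\to\mathbb R^d$, $(x,\theta)\mapsto f(x,\theta)$, and $g,y:\mathbb R^d\to\mathbb R$ be $C^2$ functions, and let $\mu$ be a Borel probability measure on $\mathbb R^d$. Let $\mathcal P^2=\mathcal P^2(\mathbb R^k)$ be the set of Borel probability measures on $\mathbb R^k$ with finite second moment, with the Wasserstein distance $W_2$. Assume the following. 1. There is a constant $C_1$ such that $|\partial_x^i\partial_\theta^j f(x,\theta)|\le C_1|\theta|^i(|x|+1)^j$ for all $x\in\mathbb R^d$, $\theta\in\mathbb R^k$ and all integers $i,j\ge 0$ with $0<i+j\le 2$. 2. For every $R>0$ the set of functions $x\mapsto\int_{\mathbb R^k} f(x,\theta)\,d\rho(\theta)$, $\rho\in\mathcal P^2$, is dense in $C(\{|x|<R\};\mathbb R^d)$ with the topology of locally uniform convergence. 3. $g$ and $\nabla g$ are Lipschitz continuous, and $\inf_{x}|\nabla g(x)|>0$. 4. $\mu$ has a density in $L^\infty$ with respect to Lebesgue measure, and $\mu(\{|x|\ge R\})=0$ for some $R>0$. 5. $y$ is locally bounded. Let $C([0,1];\mathcal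 P^2)$ be the set of $W_2$-continuous curves $t\mapsto\rho(\cdot,t)\in\mathcal P^2$, $t\in[0,1]$, with the metric $d_1(\rho_1,\rho_2)=\sup_{t}W_2(\rho_1(\cdot,t),\rho_2(\cdot,t))$, and let $C([0,\infty);C([0,1];\mathcal P^2))$ be the set of $d_1$-continuous curves $s\mapsto\rho(\cdot,\cdot,s)\in C([0,1];\mathcal P^2)$, $s\in[0,\infty)$. A curve $\rho\in C([0,1];\mathcal P^2)$ is called *admissible* if there is an $\mathbb R^k$-valued stochastic process $(\theta(t))_{t\in[0,1]}$ with continuous paths such that $\theta(t)\sim\rho(\cdot,t)$ for every $t$ and $\lim_{t\to t_0}\mathbb E|\theta(t)-\theta(t_0)|^2=0$ for every $t_0\in[0,1]$. For $\rho\in C([0,1];\mathcal P^2)$ and $x\in\mathbb R^d$ let $Z_\rho(\cdot;x)$ and $p_\rho(\cdot;x)$ be the solutions on $[0,1]$ of $$\frac{dZ_\rho}{dt}=\int_{\mathbb R^k} f(Z_\rho,\theta)\,d\rho(\theta,t),\quad Z_\rho(0;x)=x,$$ $$\frac{dp_\rho^\top}{dt}=-p_\rho^\top\int_{\mathbb R^k}\partial_x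 f(Z_\rho,\theta)\,d\rho(\theta,t),\quad p_\rho(1;x)=\bigl(g(Z_\rho(1;x))-y(x)\bigr)\nabla g(Z_\rho(1;x)).$$ For $s\ge 0$ put $$E_s(\rho)=\mathbb E_{x\sim\mu}\Bigl[\tfrac12\bigl(g(Z_\rho(1;x))-y(x)\bigr)^2\Bigr]+e^{-s}\int_0^1\!\int_{\mathbb R^k}|\theta|^2\,d\rho(\theta,t)\,dt,$$ $$\frac{\delta E_s(\rho)}{\delta\rho}(\theta,t)=\mathbb E_{x\sim\mu}\bigl[p_\rho(t;x)^\top f(Z_\rho(t;x),\theta)\bigr]+e^{-s}|\theta|^2 .$$ Let $\rho_{\rm ini}\in C([0,1];\mathcal P^2)$ be admissible. Then the equation $$\partial_s\rho(\theta,t,s)=\nabla_\theta\cdot\Bigl(\rho(\theta,t,s)\,\nabla_\theta\frac{\delta E_s(\rho(s))}{\delta\rho}(\theta,t)\Bigr)\quad(s>0,\ t\in[0,1]),\qquad \rho(\cdot,\cdot,0)=\rho_{\rm ini},$$ has a unique solution $\rho\in C([0,\infty);C([0,1];\mathcal P^2))$. Here a solution is understood weakly: for every $t\in[0,1]$, every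 $h\in C_c^\infty(\mathbb R^k)$ and every $s>0$, $$\frac{d}{ds}\int_{\mathbb R^k} h\,d\rho(\theta,t,s)=-\int_{\mathbb R^k}\nabla h\cdot\nabla_\theta\frac{\delta E_s(\rho(s))}{\delta\rho}(\theta,t)\,d\rho(\theta,t,s).$$ Moreover, $\rho(\cdot,\cdot,s)$ is admissible for every $s\ge 0$, the function $s\mapsto E_s(\rho(\cdot,\cdot,s))$ is differentiable on $(0,\infty)$ with $$\frac{d}{ds}E_s(\rho(\cdot,\cdot,s))\le 0\quad\text{for every } s>0,$$ and it is nonincreasing on $[0,\infty)$. -/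

import Mathlib

open MeasureTheory Filter Topology Set
open scoped NNReal ENNReal

namespace MeanFieldResNet

/-- Euclidean space `ℝⁿ`. -/
abbrev Vec (n : ℕ) : Type := EuclideanSpace ℝ (Fin n)

/-- The interval `[0,1]` of layer times `t`. -/
abbrev I01 : Type := Set.Icc (0 : ℝ) 1

/-! ### Spaces of probability measures -/

/-- `𝒫²(ℝᵏ)`: Borel probability measures with finite second moment. -/
@[ext]
structure P2 (k : ℕ) : Type where
  law : Measure (Vec k)
  isProbabilityMeasure : IsProbabilityMeasure law
  second_moment : ∫⁻ θ, ‖θ‖ₑ ^ 2 ∂law < ∞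

/-- Couplings (transport plans) of two measures. -/
def Couplings {k : ℕ} (μ ν : Measure (Vec k)) : Set (Measure (Vec k × Vec k)) :=
  {π | π.map Prod.fst = μ ∧ π.map Prod.snd = ν}

/-- The Wasserstein-2 distance (with values in `[0,∞]`). -/
noncomputable def W2 {k : ℕ} (μ ν : P2 k) : ℝ≥0∞ :=
  (⨅ π ∈ Couplings μ.law ν.law, ∫⁻ q, ‖q.1 - q.2‖ₑ ^ 2 ∂π) ^ (1 / 2 : ℝ)

/-- `C([0,1]; 𝒫²)`: curves `t ↦ ρ(·,t)` in `𝒫²` that are continuous for `W₂`. -/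
@[ext]
structure PathP2 (k : ℕ) : Type where
  at_time : I01 → P2 k
  continuous_W2 : ∀ t₀, Tendsto (fun t => W2 (at_time t) (at_time t₀)) (𝓝 t₀) (𝓝 0)

/-- `ρ t` denotes the probability measure `ρ(·,t)` on `ℝᵏ`. -/
instance (k : ℕ) : CoeFun (PathP2 k) (fun _ => I01 → Measure (Vec k)) :=
  ⟨fun ρ t => (ρ.at_time t).law⟩

/-- `d₁(ρ₁,ρ₂) = sup_t W₂(ρ₁(·,t), ρ₂(·,t))`. -/
noncomputable def d1 {k : ℕ} (ρ₁ ρ₂ : PathP2 k) : ℝ≥0∞ :=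
  ⨆ t : I01, W2 (ρ₁.at_time t) (ρ₂.at_time t)

/-- `C([0,∞); C([0,1]; 𝒫²))`: curves `s ↦ ρ(·,·,s)` in `C([0,1]; 𝒫²)` that are
continuous for `d₁`. -/
@[ext]
structure FlowP2 (k : ℕ) : Type where
  at_pseudotime : ℝ≥0 → PathP2 k
  continuous_d1 : ∀ s₀, Tendsto (fun s => d1 (at_pseudotime s) (at_pseudotime s₀)) (𝓝 s₀) (𝓝 0)

/-- `ρ s` denotes the curve `ρ(·,·,s)`, and `ρ s t` the probability measure `ρ(·,t,s)`. -/
instance (k : ℕ) : CoeFun (FlowP2 k) (fun _ => ℝ≥0 → PathP2 k) :=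
  ⟨fun ρ => ρ.at_pseudotime⟩

/-- `ρ` is admissible: there is a stochastic process `θ` on `[0,1]` with continuous paths,
continuous in mean square, such that `θ(t) ∼ ρ(·,t)` for every `t`. -/
def Admissible {k : ℕ} (ρ : PathP2 k) : Prop :=
  ∃ (Ω : Type) (_ : MeasurableSpace Ω) (P : Measure Ω) (_ : IsProbabilityMeasure P)
    (θ : I01 → Ω → Vec k),
    (∀ t, Measurable (θ t)) ∧
    (∀ ω, Continuous fun t => θ t ω) ∧
    (∀ t, P.map (θ t) = ρ t) ∧
    ∀ t₀, Tendsto (fun t => ∫⁻ ω, ‖θ t ω - θ t₀ ω‖ₑ ^ 2 ∂P) (𝓝 t₀) (𝓝 0)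

/-! ### Standing assumption on the data -/

/-- Assumptions on the activation function `f(x,θ)`, the measuring function `g`, the label `y`
and the input distribution `μ`. -/
structure Regular {d k : ℕ} (f : Vec d → Vec k → Vec d) (g y : Vec d → ℝ)
    (μ : Measure (Vec d)) : Prop where
  contDiff_f : ContDiff ℝ 2 (fun q : Vec d × Vec k => f q.1 q.2)
  contDiff_g : ContDiff ℝ 2 g
  contDiff_y : ContDiff ℝ 2 y
  /-- `|∂ₓⁱ ∂_θʲ f(x,θ)| ≤ C₁ |θ|ⁱ (|x|+1)ʲ` for `0 < i + j ≤ 2`. (The norm is the operator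
  norm; as `C₁` is arbitrary, any other norm on these finite-dimensional spaces, such as the
  Frobenius norm, gives the same condition.) -/
  deriv_bound : ∃ C₁ : ℝ, ∀ i j : ℕ, 0 < i + j → i + j ≤ 2 → ∀ (x : Vec d) (θ : Vec k),
    ‖iteratedFDeriv ℝ i (fun x' => iteratedFDeriv ℝ j (fun θ' => f x' θ') θ) x‖
      ≤ C₁ * ‖θ‖ ^ i * (‖x‖ + 1) ^ j
  /-- The functions `x ↦ ∫ f(x,θ) dρ(θ)`, `ρ ∈ 𝒫²`, are dense in `C({|x| < R}; ℝᵈ)` (topology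
  of locally uniform convergence) for every `R > 0`. -/
  dense_range : ∀ R : ℝ, 0 < R →
    Dense {h : C(Metric.ball (0 : Vec d) R, Vec d) |
      ∃ ρ : P2 k, ∀ x, h x = ∫ θ, f x θ ∂ρ.law}
  lipschitz_g : ∃ K : ℝ≥0, LipschitzWith K g
  lipschitz_grad_g : ∃ K : ℝ≥0, LipschitzWith K (gradient g)
  grad_g_lower : ∃ c : ℝ, 0 < c ∧ ∀ x, c ≤ ‖gradient g x‖
  /-- `μ` has a bounded density. -/
  abs_cont : μ ≪ volume
  density_bounded : essSup (μ.rnDeriv volume) volume < ∞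
  compact_support : ∃ R : ℝ, 0 < R ∧ μ {x | R ≤ ‖x‖} = 0
  locally_bounded_y : ∀ R : ℝ, ∃ C : ℝ, ∀ x, ‖x‖ ≤ R → |y x| ≤ C

section Dynamics

variable {d k : ℕ} (f : Vec d → Vec k → Vec d) (g y : Vec d → ℝ) (μ : Measure (Vec d))

/-! ### Forward and adjoint equations -/

/-- `z` solves `dz/dt = ∫ f(z(t),θ) dρ(θ,t)` on `[0,1]` with `z(0) = x`. -/
def IsForward (ρ : PathP2 k) (x : Vec d) (z : ℝ → Vec d) : Prop :=
  z 0 = x ∧ ∀ t : I01,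
    HasDerivWithinAt z (∫ θ, f (z t) θ ∂(ρ t)) (Set.Icc 0 1) t

/-- `Z_ρ(·;x)`: the solution of the forward equation (only its values on `[0,1]` matter). -/
noncomputable def Z (ρ : PathP2 k) (x : Vec d) : ℝ → Vec d :=
  Classical.epsilon (IsForward f ρ x)

/-- `p` solves `dpᵀ/dt = - pᵀ ∫ ∂_z f(Z_ρ(t;x),θ) dρ(θ,t)` on `[0,1]` with
`p(1) = (g(Z_ρ(1;x)) - y(x)) ∇g(Z_ρ(1;x))`. -/
def IsAdjoint (ρ : PathP2 k) (x : Vec d) (p : ℝ → Vec d) : Prop :=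
  p 1 = (g (Z f ρ x 1) - y x) • gradient g (Z f ρ x 1) ∧ ∀ t : I01,
    HasDerivWithinAt p
      (-(ContinuousLinearMap.adjoint
          (∫ θ, fderiv ℝ (fun z => f z θ) (Z f ρ x t) ∂(ρ t)) (p t)))
      (Set.Icc 0 1) t

/-- `p_ρ(·;x)`: the solution of the adjoint equation (only its values on `[0,1]` matter). -/
noncomputable def adj (ρ : PathP2 k) (x : Vec d) : ℝ → Vec d :=
  Classical.epsilon (IsAdjoint f g y ρ x)

/-! ### Regularized energy and gradient flow -/

/-- `E_s(ρ) = 𝔼_{x∼μ}[½ (g(Z_ρ(1;x)) - y(x))²] + e^{-s} ∫₀¹ ∫ |θ|² dρ(θ,t) dt`. -/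
noncomputable def energy (s : ℝ) (ρ : PathP2 k) : ℝ :=
  ∫ x, 1 / 2 * (g (Z f ρ x 1) - y x) ^ 2 ∂μ
    + Real.exp (-s) * ∫ t : I01, ∫ θ, ‖θ‖ ^ 2 ∂(ρ t)

/-- `(δE/δρ)|_ρ(θ,t) = 𝔼_{x∼μ}[p_ρ(t;x)ᵀ f(Z_ρ(t;x),θ)]`. -/
noncomputable def costDeriv (ρ : PathP2 k) (t : I01) (θ : Vec k) : ℝ :=
  ∫ x, inner ℝ (adj f g y ρ x t) (f (Z f ρ x t) θ) ∂μ

/-- `(δE_s/δρ)|_ρ(θ,t) = (δE/δρ)|_ρ(θ,t) + e^{-s} |θ|²`. -/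
noncomputable def energyDeriv (s : ℝ) (ρ : PathP2 k) (t : I01) (θ : Vec k) : ℝ :=
  costDeriv f g y μ ρ t θ + Real.exp (-s) * ‖θ‖ ^ 2

/-- `ρ` is a (weak) solution of `∂_s ρ = ∇_θ · (ρ ∇_θ δE_s(ρ(s))/δρ)`, `s > 0`, `t ∈ [0,1]`, with
`ρ(·,·,0) = ρ_ini`: for every `t` and every test function `h ∈ C_c^∞(ℝᵏ)`,
`d/ds ∫ h dρ(·,t,s) = - ∫ ∇h · ∇_θ (δE_s(ρ(s))/δρ)(·,t) dρ(·,t,s)`. -/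
def IsSolution (ρini : PathP2 k) (ρ : FlowP2 k) : Prop :=
  ρ 0 = ρini ∧
  ∀ (t : I01) (h : Vec k → ℝ), ContDiff ℝ ((⊤ : ℕ∞) : WithTop ℕ∞) h → HasCompactSupport h →
    ∀ s : ℝ, 0 < s →
      HasDerivAt (fun u : ℝ => ∫ θ, h θ ∂(ρ u.toNNReal t))
        (-∫ θ, inner ℝ (gradient h θ)
            (gradient (energyDeriv f g y μ s (ρ s.toNNReal) t) θ) ∂(ρ s.toNNReal t)) s

end Dynamics

end MeanFieldResNet

namespace MeanFieldResNet

/-! ### Global solutions of ordinary differential equations -/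

section ODE

variable {E : Type*} [NormedAddCommGroup E] [NormedSpace ℝ E]

/-! The argument is Lagrangian. The solution is sought as the image of `ρini` under maps θ ↦ θ + (1
+ |θ|) ψ(t,θ), with ψ bounded and continuous on [0,1] × ℝᵏ. The gradient of the energy's first
variation grows at most linearly in θ, because of the regularizer, so the weight 1 + |θ| turns the
particle dynamics into an ordinary differential equation ψ' = V(s,ψ) in one Banach space `Disp k`.
Admissibility of `ρini` is what makes such images W₂-continuous in t: ψ is only continuous in θ, so
the images are coupled along the continuous paths of the process and dominated convergence is
applied. The transported process shows at the same time that the images are admissible.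

Local Lipschitz continuity of V. Measures are compared by testing against functions with Lipschitz
constant of linear growth (`CloseMeas`). Grönwall estimates make Z and p Lipschitz in the curve of
measures (`exists_stability`), and the bounds on f carry this over to V on balls
(`exists_lipschitzOn_vecField_pushPath`).

Energy dissipation. The adjoint equation cancels the linearized drift in the derivative of ⟨p, Z' -
Z⟩, where Z' is the perturbed trajectory, so the cost has a first-order expansion in ψ with
quadratic remainder (`exists_inputCost_taylor`, `exists_cost_taylor`). The chain rule along ψ' = V
then gives dE/ds as minus the averaged squared norm of the gradient, minus the nonnegative
contribution of the decaying factor e^{-s} (`hasDerivWithinAt_energy`).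

Global existence. Decay of E bounds e^{-s} times the second moment averaged over t, and nothing
more. This suffices: the Grönwall rates of Z and p are controlled by the second moment at layer t,
and only their integral over t enters. Hence the gradient of the cost is bounded on bounded
pseudo-time intervals, ‖V‖ grows linearly in ‖ψ‖, and ψ cannot blow up
(`exists_norm_le_of_solution`).

Uniqueness among all weak solutions. Freezing a weak solution ρ in the gradient field gives a linear
continuity equation with Lipschitz velocity. Transport by displacements χ driven by this frozen
field solves the same equation, and the linear equation has one solution (`IsTransported.law_eq`):
test functions are pulled back along Euler steps of the mollified velocity, with summed error as
small as desired. So ρ is the image of `ρini` under χ; then χ solves the nonlinear equation for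
displacements and equals ψ. -/

/-- The radial retraction onto the closed ball of radius `R`. -/
noncomputable def radialRetraction (R : ℝ) (x : E) : E := (R / max R ‖x‖) • x

lemma radialRetraction_of_norm_le {R : ℝ} (hR : 0 < R) {x : E} (hx : ‖x‖ ≤ R) :
    radialRetraction R x = x := by
  simp [radialRetraction, max_eq_left hx, hR.ne']

lemma norm_radialRetraction_le {R : ℝ} (hR : 0 < R) (x : E) : ‖radialRetraction R x‖ ≤ R := by
  have hM : 0 < max R ‖x‖ := lt_max_of_lt_left hR
  rw [radialRetraction, norm_smul, Real.norm_of_nonneg (by positivity), div_mul_eq_mul_div,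
    div_le_iff₀ hM]
  exact mul_le_mul_of_nonneg_left (le_max_right _ _) hR.le

/-- The difference splits into x - y scaled by a factor at most 1, and the change of the factor
applied to y. Each part is at most ‖x - y‖, which gives the constant 2 in every normed space. -/
lemma lipschitzWith_radialRetraction {R : ℝ} (hR : 0 < R) :
    LipschitzWith 2 (radialRetraction R : E → E) := by
  refine LipschitzWith.of_dist_le_mul fun x y => ?_
  have hMx : 0 < max R ‖x‖ := lt_max_of_lt_left hR
  have hMy : 0 < max R ‖y‖ := lt_max_of_lt_left hR
  have h1 : R / max R ‖x‖ ≤ 1 := (div_le_one hMx).2 (le_max_left _ _)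
  have h2 : |R / max R ‖x‖ - R / max R ‖y‖| * ‖y‖ ≤ ‖x - y‖ := by
    have e : R / max R ‖x‖ - R / max R ‖y‖
        = R / max R ‖x‖ * ((max R ‖y‖ - max R ‖x‖) / max R ‖y‖) := by
      field_simp
    rw [e, abs_mul, abs_of_nonneg (by positivity), abs_div, abs_of_pos hMy]
    have h3 : |max R ‖y‖ - max R ‖x‖| ≤ ‖x - y‖ := by
      rw [max_comm R ‖y‖, max_comm R ‖x‖]
      refine (abs_max_sub_max_le_abs ‖y‖ ‖x‖ R).trans ?_
      rw [← norm_neg (x - y), neg_sub]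
      exact abs_norm_sub_norm_le y x
    calc R / max R ‖x‖ * (|max R ‖y‖ - max R ‖x‖| / max R ‖y‖) * ‖y‖
        = R / max R ‖x‖ * (|max R ‖y‖ - max R ‖x‖| * (‖y‖ / max R ‖y‖)) := by ring
      _ ≤ 1 * (‖x - y‖ * 1) := by
          gcongr
          exact (div_le_one hMy).2 (le_max_right _ _)
      _ = ‖x - y‖ := by ring
  have e : radialRetraction R x - radialRetraction R y
      = (R / max R ‖x‖) • (x - y) + (R / max R ‖x‖ - R / max R ‖y‖) • y := by
    simp only [radialRetraction, smul_sub, sub_smul]; abel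
  rw [dist_eq_norm, dist_eq_norm, e]
  refine (norm_add_le _ _).trans ?_
  rw [norm_smul, norm_smul, Real.norm_of_nonneg (by positivity), Real.norm_eq_abs]
  have : R / max R ‖x‖ * ‖x - y‖ ≤ 1 * ‖x - y‖ := by gcongr
  simp only [NNReal.coe_ofNat]
  linarith

/-- A continuous function starting strictly below the level `R` stays below it, if it is strictly
below it at each time up to which it stayed below. -/
lemma le_of_forall_le_imp_lt {n : ℝ → ℝ} {R T : ℝ} (hn : ContinuousOn n (Icc 0 T))
    (h : ∀ S ∈ Icc 0 T, (∀ s ∈ Ico 0 S, n s ≤ R) → n S < R) : ∀ s ∈ Icc 0 T, n s ≤ R := by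
  intro s hs
  have hT : 0 ≤ T := hs.1.trans hs.2
  have hcl : IsClosed ({s | ∀ r ∈ Icc 0 s, n r ≤ R} ∩ Icc 0 T) := by
    refine isClosed_of_closure_subset fun a ha => ?_
    have haT : a ∈ Icc 0 T := closure_minimal inter_subset_right isClosed_Icc ha
    have hlt : ∀ r ∈ Ico 0 a, n r ≤ R := by
      intro r hr
      obtain ⟨b, hb, hrb⟩ := mem_closure_iff.1 ha (Ioi r) isOpen_Ioi hr.2
      exact hrb.1 r ⟨hr.1, (mem_Ioi.1 hb).le⟩
    refine ⟨fun r hr => ?_, haT⟩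
    rcases hr.2.eq_or_lt with rfl | hlt'
    · exact (h r haT hlt).le
    · exact hlt r ⟨hr.1, hlt'⟩
  have h0 : (0 : ℝ) ∈ {s | ∀ r ∈ Icc 0 s, n r ≤ R} := by
    intro r hr
    have : r = 0 := le_antisymm hr.2 hr.1
    subst this
    exact (h 0 ⟨le_rfl, hT⟩ (by simp)).le
  -- Real induction on the closed set of times up to which the bound holds. The strict inequality at
  -- the right end leaves room to continue.
  have key := hcl.Icc_subset_of_forall_exists_gt h0 (fun a ha b hb => ?_)
  · exact key hs s ⟨hs.1, le_rfl⟩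
  · have haT : a ∈ Icc 0 T := ⟨ha.2.1, ha.2.2.le⟩
    have hlt : n a < R := h a haT fun r hr => ha.1 r ⟨hr.1, hr.2.le⟩
    have hev : ∀ᶠ r in 𝓝[Icc 0 T] a, n r < R := (hn a haT).eventually (gt_mem_nhds hlt)
    have hev2 : ∀ᶠ r in 𝓝[≥] a, r ∈ Icc 0 T → n r < R := by
      rw [eventually_nhdsWithin_iff] at hev ⊢
      filter_upwards [hev] with r hr _ using hr
    obtain ⟨c, hac, hc⟩ := (mem_nhdsGE_iff_exists_Icc_subset).1 hev2
    refine ⟨min c (min b T), ?_, lt_min hac (lt_min hb ha.2.2), by simp⟩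
    intro r hr
    rcases le_total r a with hra | hra
    · exact ha.1 r ⟨hr.1, hra⟩
    · have hr2 := hr.2
      simp only [le_min_iff] at hr2
      exact (hc ⟨hra, hr2.1⟩ ⟨hr.1, hr2.2.2⟩).le

/-- On a compact interval both solutions stay in one ball, and a single Lipschitz constant is valid
there. -/
lemma ode_unique_of_lipschitzOn_ball {v : ℝ → E → E} {T : ℝ}
    (hLip : ∀ r, ∃ K : ℝ≥0, ∀ s ∈ Icc 0 T, LipschitzOnWith K (v s) (Metric.closedBall 0 r))
    {x y : ℝ → E} (h0 : x 0 = y 0)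
    (hx : ∀ s ∈ Icc 0 T, HasDerivWithinAt x (v s (x s)) (Icc 0 T) s)
    (hy : ∀ s ∈ Icc 0 T, HasDerivWithinAt y (v s (y s)) (Icc 0 T) s) :
    EqOn x y (Icc 0 T) := by
  have hxc : ContinuousOn x (Icc 0 T) := fun s hs => (hx s hs).continuousWithinAt
  have hyc : ContinuousOn y (Icc 0 T) := fun s hs => (hy s hs).continuousWithinAt
  obtain ⟨bx, hbx⟩ := isCompact_Icc.exists_bound_of_continuousOn hxc
  obtain ⟨bY, hbY⟩ := isCompact_Icc.exists_bound_of_continuousOn hyc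
  obtain ⟨K, hK⟩ := hLip (max bx bY)
  have right : ∀ {z : ℝ → E} {z' : E} {s : ℝ}, s ∈ Ico 0 T → HasDerivWithinAt z z' (Icc 0 T) s →
      HasDerivWithinAt z z' (Ici s) s := fun {z z' s} hs h =>
    (h.mono (Icc_subset_Icc_left hs.1)).mono_of_mem_nhdsWithin (Icc_mem_nhdsGE hs.2)
  refine ODE_solution_unique_of_mem_Icc_right (s := fun _ => Metric.closedBall 0 (max bx bY))
    (fun s hs => hK s (Ico_subset_Icc_self hs)) hxc
    (fun s hs => right hs (hx s (Ico_subset_Icc_self hs))) (fun s hs => ?_) hyc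
    (fun s hs => right hs (hy s (Ico_subset_Icc_self hs))) (fun s hs => ?_) h0
  · simpa using Or.inl (hbx s (Ico_subset_Icc_self hs))
  · simpa using Or.inr (hbY s (Ico_subset_Icc_self hs))

/-- A solution on `[0,T]` exists as soon as solutions satisfy an a-priori bound. -/
lemma exists_solution_Icc_of_bound [CompleteSpace E] {v : ℝ → E → E} {x₀ : E} {T : ℝ} (hT : 0 ≤ T)
    (hcont : ∀ x, ContinuousOn (fun s => v s x) (Icc 0 T))
    (hLip : ∀ r, ∃ K : ℝ≥0, ∀ s ∈ Icc 0 T, LipschitzOnWith K (v s) (Metric.closedBall 0 r))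
    {B : ℝ} (hB : ∀ S ∈ Icc 0 T, ∀ x : ℝ → E, x 0 = x₀ →
      (∀ s ∈ Icc 0 S, HasDerivWithinAt x (v s (x s)) (Icc 0 S) s) → ‖x S‖ ≤ B) :
    ∃ x : ℝ → E, x 0 = x₀ ∧ ∀ s ∈ Icc 0 T, HasDerivWithinAt x (v s (x s)) (Icc 0 T) s := by
  set R : ℝ := max B 0 + 1 with hRdef
  have hR : 0 < R := by positivity
  have hBR : B < R := (le_max_left B 0).trans_lt (lt_add_one _)
  obtain ⟨K, hK⟩ := hLip R
  obtain ⟨M, hM⟩ := isCompact_Icc.exists_bound_of_continuousOn (hcont 0)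
  have hM0 : 0 ≤ M := (norm_nonneg _).trans (hM 0 ⟨le_rfl, hT⟩)
  have hmem : ∀ x : E, radialRetraction R x ∈ Metric.closedBall (0 : E) R := fun x => by
    simpa using norm_radialRetraction_le hR x
  set L : ℝ≥0 := ⟨M + K * R, by positivity⟩
  -- Composed with the retraction, the field is globally Lipschitz and bounded by L, so
  -- Picard–Lindelöf with radius L·T covers all of [0,T] at once. The a priori bound B < R then
  -- keeps the solution where the retraction is the identity.
  have hPL : IsPicardLindelof (fun s x => v s (radialRetraction R x))
      ⟨0, mem_Icc.2 ⟨le_rfl, hT⟩⟩ x₀ (L * T.toNNReal) 0 L (K * 2) := by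
    refine ⟨fun s hs => ?_, fun x _ => hcont _, fun s hs x _ => ?_, ?_⟩
    · exact (hK s hs).comp ((lipschitzWith_radialRetraction hR).lipschitzOnWith)
        fun x _ => hmem x
    · have h1 := (hK s hs).dist_le_mul _ (hmem x) 0 (by simpa using hR.le)
      rw [dist_eq_norm, dist_zero_right] at h1
      calc ‖v s (radialRetraction R x)‖
          ≤ ‖v s 0‖ + ‖v s (radialRetraction R x) - v s 0‖ := by
            simpa using norm_add_le (v s 0) (v s (radialRetraction R x) - v s 0)
        _ ≤ M + K * R := by
            gcongr
            · exact hM s hs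
            · exact h1.trans (by gcongr; exact norm_radialRetraction_le hR x)
    · rw [NNReal.coe_mul]
      simp [hT]
  obtain ⟨x, hx0, hx⟩ := hPL.exists_eq_forall_mem_Icc_hasDerivWithinAt₀
  refine ⟨x, hx0, ?_⟩
  have hxc : ContinuousOn x (Icc 0 T) := fun s hs => (hx s hs).continuousWithinAt
  have hle : ∀ s ∈ Icc 0 T, ‖x s‖ ≤ R := by
    refine le_of_forall_le_imp_lt hxc.norm fun S hS h => ?_
    refine lt_of_le_of_lt ?_ hBR
    -- The bound passes to the endpoint S by continuity. For S = 0 the interval `Ico 0 S` is empty,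
    -- but then the derivative within a singleton imposes no condition.
    have hlim : ∀ s ∈ Icc 0 S, ‖x s‖ ≤ R ∨ S = 0 := by
      intro s hs
      rcases hS.1.eq_or_lt with h0 | h0
      · exact Or.inr h0.symm
      left
      have hcS : ContinuousOn (fun r => ‖x r‖) (Icc 0 S) :=
        hxc.norm.mono (Icc_subset_Icc_right hS.2)
      exact le_on_closure (s := Ico 0 S) (g := fun _ => R) h
        (by rwa [closure_Ico h0.ne]) continuousOn_const (by rwa [closure_Ico h0.ne])
    refine hB S hS x hx0 fun s hs => ?_
    have hsT : s ∈ Icc 0 T := ⟨hs.1, hs.2.trans hS.2⟩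
    rcases hlim s hs with h1 | h1
    · have := (hx s hsT).mono (Icc_subset_Icc_right hS.2)
      rwa [radialRetraction_of_norm_le hR h1] at this
    · subst h1
      simp only [Icc_self, mem_singleton_iff] at hs
      subst hs
      rw [Icc_self]
      exact HasFDerivWithinAt.of_finite (finite_singleton _)
  intro s hs
  have := hx s hs
  rwa [radialRetraction_of_norm_le hR (hle s hs)] at this

/-- Global solutions exist under a local Lipschitz condition and an a-priori bound. -/
theorem exists_solution_Ici_of_bound [CompleteSpace E] {v : ℝ → E → E} {x₀ : E}
    (hcont : ∀ x, ContinuousOn (fun s => v s x) (Ici 0))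
    (hLip : ∀ T r, ∃ K : ℝ≥0, ∀ s ∈ Icc 0 T, LipschitzOnWith K (v s) (Metric.closedBall 0 r))
    (hB : ∀ T, 0 ≤ T → ∃ B, ∀ S ∈ Icc 0 T, ∀ x : ℝ → E, x 0 = x₀ →
      (∀ s ∈ Icc 0 S, HasDerivWithinAt x (v s (x s)) (Icc 0 S) s) → ‖x S‖ ≤ B) :
    ∃ x : ℝ → E, x 0 = x₀ ∧ ∀ s ∈ Ici (0 : ℝ), HasDerivWithinAt x (v s (x s)) (Ici 0) s := by
  have hex : ∀ n : ℕ, ∃ x : ℝ → E, x 0 = x₀ ∧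
      ∀ s ∈ Icc (0 : ℝ) n, HasDerivWithinAt x (v s (x s)) (Icc (0 : ℝ) n) s := fun n => by
    obtain ⟨B, hB⟩ := hB n n.cast_nonneg
    exact exists_solution_Icc_of_bound n.cast_nonneg
      (fun x => (hcont x).mono Icc_subset_Ici_self) (hLip n) hB
  choose X hX0 hX using hex
  have hEq : ∀ m n : ℕ, m ≤ n → EqOn (X m) (X n) (Icc (0 : ℝ) m) := fun m n hmn => by
    have hsub : Icc (0 : ℝ) m ⊆ Icc (0 : ℝ) n := Icc_subset_Icc_right (by exact_mod_cast hmn)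
    exact ode_unique_of_lipschitzOn_ball (hLip m) ((hX0 m).trans (hX0 n).symm) (hX m)
      fun s hs => (hX n s (hsub hs)).mono hsub
  have hEq' : ∀ (m n : ℕ) (s : ℝ), 0 ≤ s → s ≤ m → s ≤ n → X m s = X n s := by
    intro m n s h0 hm hn
    rcases le_total m n with h | h
    · exact hEq m n h ⟨h0, hm⟩
    · exact (hEq n m h ⟨h0, hn⟩).symm
  -- The extra 1 puts s strictly below the end of the interval on which the chosen solution lives,
  -- so that interval is a neighbourhood of s within [0,∞).
  refine ⟨fun s => X (⌈s⌉₊ + 1) s, by simpa using hX0 1, fun s hs => ?_⟩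
  set N : ℕ := ⌈s⌉₊ + 1
  have hsN : s < N := by
    have := Nat.le_ceil s
    push_cast [N]
    linarith
  have hnhds : Icc (0 : ℝ) N ∈ 𝓝[Ici 0] s := by
    have : Iio (N : ℝ) ∈ 𝓝[Ici 0] s := mem_nhdsWithin_of_mem_nhds (Iio_mem_nhds hsN)
    filter_upwards [this, self_mem_nhdsWithin] with r hr1 hr2 using ⟨hr2, (mem_Iio.1 hr1).le⟩
  refine ((hX N s ⟨hs, hsN.le⟩).mono_of_mem_nhdsWithin hnhds).congr_of_eventuallyEq ?_ rfl
  filter_upwards [hnhds] with r hr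
  refine hEq' _ _ r hr.1 ?_ hr.2
  have := Nat.le_ceil r
  push_cast
  linarith

/-- Global solutions exist under a global Lipschitz condition. -/
theorem exists_solution_Ici_of_lipschitz [CompleteSpace E] {v : ℝ → E → E} (x₀ : E)
    (hcont : ∀ x, ContinuousOn (fun s => v s x) (Ici 0))
    (hLip : ∀ T, ∃ K : ℝ≥0, ∀ s ∈ Icc 0 T, LipschitzWith K (v s)) :
    ∃ x : ℝ → E, x 0 = x₀ ∧ ∀ s ∈ Ici (0 : ℝ), HasDerivWithinAt x (v s (x s)) (Ici 0) s := by
  refine exists_solution_Ici_of_bound hcont (fun T r => ?_) fun T hT => ?_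
  · obtain ⟨K, hK⟩ := hLip T
    exact ⟨K, fun s hs => (hK s hs).lipschitzOnWith⟩
  obtain ⟨K, hK⟩ := hLip T
  obtain ⟨M, hM⟩ := isCompact_Icc.exists_bound_of_continuousOn
    ((hcont 0).mono (Icc_subset_Ici_self (a := T) (b := 0)))
  -- Along a solution ‖x'‖ ≤ K‖x‖ + M, where M bounds the field at the origin.
  refine ⟨gronwallBound ‖x₀‖ K M T, fun S hS x hx0 hx => ?_⟩
  have hM0 : 0 ≤ M := (norm_nonneg _).trans (hM 0 ⟨le_rfl, hT⟩)
  have h := norm_le_gronwallBound_of_norm_deriv_right_le (f := x) (f' := fun s => v s (x s))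
    (δ := ‖x₀‖) (K := K) (ε := M) (a := 0) (b := S)
    (fun s hs => (hx s hs).continuousWithinAt)
    (fun s hs => ((hx s (Ico_subset_Icc_self hs)).mono
      (Icc_subset_Icc_left hs.1)).mono_of_mem_nhdsWithin (Icc_mem_nhdsGE hs.2))
    (by rw [hx0]) (fun s hs => ?_) S ⟨hS.1, le_rfl⟩
  · refine h.trans ?_
    rw [sub_zero]
    exact gronwallBound_mono (norm_nonneg _) hM0 K.2 hS.2
  · have hsT : s ∈ Icc 0 T := ⟨hs.1, hs.2.le.trans hS.2⟩
    have h1 := (hK s hsT).dist_le_mul (x s) 0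
    rw [dist_eq_norm, dist_zero_right] at h1
    have h2 := hM s hsT
    have h3 := norm_add_le (v s (x s) - v s 0) (v s 0)
    rw [sub_add_cancel] at h3
    linarith

end ODE

/-- A two-sided Grönwall inequality on `[0,1]` with a time-dependent rate. -/
lemma gronwall_two_sided {F : Type*} [NormedAddCommGroup F] [InnerProductSpace ℝ F]
    {u u' : ℝ → F} {a : ℝ → ℝ} {ε : ℝ} (ha : Continuous a) (ha0 : ∀ t, 0 ≤ a t)
    (hu : ∀ t ∈ Icc (0 : ℝ) 1, HasDerivWithinAt u (u' t) (Icc 0 1) t)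
    (hle : ∀ t ∈ Icc (0 : ℝ) 1, ‖u' t‖ ≤ a t * (ε + ‖u t‖)) {t τ : ℝ} (ht : t ∈ Icc (0 : ℝ) 1)
    (hτ : τ ∈ Icc (0 : ℝ) 1) :
    ε ^ 2 + ‖u t‖ ^ 2 ≤ (ε ^ 2 + ‖u τ‖ ^ 2) * Real.exp (3 * ∫ r in (0 : ℝ)..1, a r) := by
  set A : ℝ → ℝ := fun t => ∫ r in (0 : ℝ)..t, a r with hA
  have hAd : ∀ t, HasDerivAt A (a t) t := fun t => ha.integral_hasStrictDerivAt 0 t |>.hasDerivAt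
  have hAmono : Monotone A := monotone_of_deriv_nonneg (fun t => (hAd t).differentiableAt)
    fun t => by rw [(hAd t).deriv]; exact ha0 t
  have hA0 : A 0 = 0 := by simp [hA]
  have hd : ∀ c : ℝ, ∀ t ∈ Icc (0 : ℝ) 1, HasDerivWithinAt
      (fun t => (ε ^ 2 + ‖u t‖ ^ 2) * Real.exp (c * A t))
      ((2 * inner ℝ (u t) (u' t) + c * a t * (ε ^ 2 + ‖u t‖ ^ 2)) * Real.exp (c * A t))
      (Icc 0 1) t := by
    intro c t ht
    have h1 := ((hu t ht).norm_sq).const_add (ε ^ 2)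
    have h2 := (((hAd t).const_mul c).exp).hasDerivWithinAt (s := Icc (0 : ℝ) 1)
    refine (h1.mul h2).congr_deriv ?_
    ring
  -- The 3 comes from 2‖u‖(ε + ‖u‖) ≤ ε² + 3‖u‖². With the absolute value, the same bound serves
  -- both directions of time.
  have hin : ∀ t ∈ Icc (0 : ℝ) 1,
      |2 * inner ℝ (u t) (u' t)| ≤ 3 * a t * (ε ^ 2 + ‖u t‖ ^ 2) := by
    intro t ht
    have h1 := abs_real_inner_le_norm (u t) (u' t)
    have h2 : ‖u t‖ * ‖u' t‖ ≤ ‖u t‖ * (a t * (ε + ‖u t‖)) := by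
      gcongr; exact hle t ht
    have h3 : 0 ≤ a t * (ε - ‖u t‖) ^ 2 := mul_nonneg (ha0 t) (sq_nonneg _)
    have h4 : 0 ≤ a t * ε ^ 2 := mul_nonneg (ha0 t) (sq_nonneg _)
    rw [abs_mul, abs_two]
    nlinarith
  have hint : ∀ t ∈ interior (Icc (0 : ℝ) 1), Icc (0 : ℝ) 1 ∈ 𝓝 t := fun t ht =>
    mem_interior_iff_mem_nhds.1 ht
  have hanti : AntitoneOn (fun t => (ε ^ 2 + ‖u t‖ ^ 2) * Real.exp (-3 * A t)) (Icc 0 1) := by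
    refine antitoneOn_of_deriv_nonpos (convex_Icc _ _)
      (fun t ht => (hd _ t ht).continuousWithinAt)
      (fun t ht => ((hd _ t (interior_subset ht)).mono interior_subset).differentiableWithinAt)
      fun t ht => ?_
    rw [((hd _ t (interior_subset ht)).hasDerivAt (hint t ht)).deriv]
    refine mul_nonpos_of_nonpos_of_nonneg ?_ (Real.exp_pos _).le
    have := (abs_le.1 (hin t (interior_subset ht))).2
    linarith
  have hmono : MonotoneOn (fun t => (ε ^ 2 + ‖u t‖ ^ 2) * Real.exp (3 * A t)) (Icc 0 1) := by
    refine monotoneOn_of_deriv_nonneg (convex_Icc _ _)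
      (fun t ht => (hd _ t ht).continuousWithinAt)
      (fun t ht => ((hd _ t (interior_subset ht)).mono interior_subset).differentiableWithinAt)
      fun t ht => ?_
    rw [((hd _ t (interior_subset ht)).hasDerivAt (hint t ht)).deriv]
    refine mul_nonneg ?_ (Real.exp_pos _).le
    have := (abs_le.1 (hin t (interior_subset ht))).1
    linarith
  have hA1 : ∀ t ∈ Icc (0 : ℝ) 1, 0 ≤ A t ∧ A t ≤ A 1 := fun t ht =>
    ⟨hA0 ▸ hAmono ht.1, hAmono ht.2⟩
  have step : ∀ c x z : ℝ, x * Real.exp c ≤ z → x ≤ z * Real.exp (-c) := fun c x z h => by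
    rw [Real.exp_neg, ← div_eq_mul_inv, le_div_iff₀ (Real.exp_pos _)]
    exact h
  rcases le_total τ t with h | h
  · have h1 := step _ _ _ (hanti hτ ht h)
    refine h1.trans ?_
    rw [mul_assoc, ← Real.exp_add]
    gcongr
    have := hA1 t ht
    have := hA1 τ hτ
    change _ ≤ 3 * A 1
    linarith
  · have h1 := step _ _ _ (hmono ht hτ h)
    refine h1.trans ?_
    rw [mul_assoc, ← Real.exp_add]
    gcongr
    have := hA1 t ht
    have := hA1 τ hτ
    change _ ≤ 3 * A 1
    linarith

/-- The rate a enters through its integral only. This is what later allows the layer-averaged second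
moment, the quantity controlled by the energy, to bound the forward and adjoint variables. -/
lemma norm_le_of_gronwall {F : Type*} [NormedAddCommGroup F] [InnerProductSpace ℝ F]
    {u u' : ℝ → F} {a : ℝ → ℝ} {ε : ℝ} (ha : Continuous a) (ha0 : ∀ t, 0 ≤ a t) (hε : 0 ≤ ε)
    (hu : ∀ t ∈ Icc (0 : ℝ) 1, HasDerivWithinAt u (u' t) (Icc 0 1) t)
    (hle : ∀ t ∈ Icc (0 : ℝ) 1, ‖u' t‖ ≤ a t * (ε + ‖u t‖)) {t τ : ℝ} (ht : t ∈ Icc (0 : ℝ) 1)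
    (hτ : τ ∈ Icc (0 : ℝ) 1) :
    ‖u t‖ ≤ (ε + ‖u τ‖) * Real.exp (3 * ∫ r in (0 : ℝ)..1, a r) := by
  have h := gronwall_two_sided ha ha0 hu hle ht hτ
  have h0 : 0 ≤ ∫ r in (0 : ℝ)..1, a r :=
    intervalIntegral.integral_nonneg zero_le_one fun t _ => ha0 t
  set A := ∫ r in (0 : ℝ)..1, a r
  have h1 : 1 ≤ Real.exp (3 * A) := Real.one_le_exp (by positivity)
  refine le_of_sq_le_sq ?_ (by positivity)
  have h2 : (ε ^ 2 + ‖u τ‖ ^ 2) * Real.exp (3 * A) ≤ (ε + ‖u τ‖) ^ 2 * (Real.exp (3 * A)) ^ 2 := by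
    gcongr
    · nlinarith [mul_nonneg hε (norm_nonneg (u τ))]
    · nlinarith
  nlinarith [sq_nonneg ε]

/-- The two-sided Grönwall inequality with a constant rate. -/
lemma norm_le_of_gronwall_const {F : Type*} [NormedAddCommGroup F] [InnerProductSpace ℝ F]
    {u u' : ℝ → F} {a ε : ℝ} (ha : 0 ≤ a) (hε : 0 ≤ ε)
    (hu : ∀ t ∈ Icc (0 : ℝ) 1, HasDerivWithinAt u (u' t) (Icc 0 1) t)
    (hle : ∀ t ∈ Icc (0 : ℝ) 1, ‖u' t‖ ≤ a * (ε + ‖u t‖)) {t τ : ℝ} (ht : t ∈ Icc (0 : ℝ) 1)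
    (hτ : τ ∈ Icc (0 : ℝ) 1) : ‖u t‖ ≤ (ε + ‖u τ‖) * Real.exp (3 * a) := by
  simpa using norm_le_of_gronwall (continuous_const (y := a)) (fun _ => ha) hε hu hle ht hτ

end MeanFieldResNet

namespace MeanFieldResNet

/-! ### Measures with finite second moment -/

section Moments

variable {k : ℕ}

instance (ρ : P2 k) : IsProbabilityMeasure ρ.law := ρ.isProbabilityMeasure

lemma integrable_norm_sq_of_lintegral_lt_top {Ω : Type*} {mΩ : MeasurableSpace Ω} {P : Measure Ω}
    {u : Ω → Vec k} (hu : AEStronglyMeasurable u P) (h : ∫⁻ ω, ‖u ω‖ₑ ^ 2 ∂P < ∞) :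
    Integrable (fun ω => ‖u ω‖ ^ 2) P := by
  refine ⟨(hu.norm.pow 2), ?_⟩
  simpa [HasFiniteIntegral, enorm_pow] using h

lemma ofReal_integral_norm_sq {Ω : Type*} {mΩ : MeasurableSpace Ω} {P : Measure Ω}
    {u : Ω → Vec k} (h : Integrable (fun ω => ‖u ω‖ ^ 2) P) :
    ENNReal.ofReal (∫ ω, ‖u ω‖ ^ 2 ∂P) = ∫⁻ ω, ‖u ω‖ₑ ^ 2 ∂P := by
  rw [ofReal_integral_eq_lintegral_ofReal h (ae_of_all _ fun _ => by positivity)]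
  refine lintegral_congr fun ω => ?_
  rw [ENNReal.ofReal_pow (norm_nonneg _), ofReal_norm]

lemma P2.integrable_norm_sq (ρ : P2 k) : Integrable (fun θ => ‖θ‖ ^ 2) ρ.law :=
  integrable_norm_sq_of_lintegral_lt_top aestronglyMeasurable_id ρ.second_moment

lemma P2.integrable_one_add_sq (ρ : P2 k) : Integrable (fun θ => (1 + ‖θ‖) ^ 2) ρ.law := by
  refine Integrable.mono' (((integrable_const (1 : ℝ)).add ρ.integrable_norm_sq).const_mul 2)
    (by fun_prop) (ae_of_all _ fun θ => ?_)
  rw [Real.norm_of_nonneg (by positivity)]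
  simp only [Pi.add_apply]
  nlinarith [sq_nonneg (1 - ‖θ‖)]

lemma P2.integrable_of_growth {G : Type*} [NormedAddCommGroup G] (ρ : P2 k) {F : Vec k → G}
    {C : ℝ} (hF : AEStronglyMeasurable F ρ.law) (h : ∀ θ, ‖F θ‖ ≤ C * (1 + ‖θ‖) ^ 2) :
    Integrable F ρ.law :=
  (ρ.integrable_one_add_sq.const_mul C).mono' hF (ae_of_all _ h)

lemma P2.integrable_of_linear_growth {G : Type*} [NormedAddCommGroup G] (ρ : P2 k)
    {F : Vec k → G} {C : ℝ} (hF : AEStronglyMeasurable F ρ.law)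
    (h : ∀ θ, ‖F θ‖ ≤ C * (1 + ‖θ‖)) : Integrable F ρ.law := by
  have hC : 0 ≤ C := by
    have := (norm_nonneg _).trans (h 0)
    simpa using this
  refine ρ.integrable_of_growth (C := C) hF fun θ => (h θ).trans ?_
  have := norm_nonneg θ
  gcongr
  nlinarith

lemma P2.integrable_norm (ρ : P2 k) : Integrable (fun θ => ‖θ‖) ρ.law :=
  ρ.integrable_of_linear_growth (C := 1) (by fun_prop) fun θ => by simp

lemma P2.integral_norm_le (ρ : P2 k) : ∫ θ, ‖θ‖ ∂ρ.law ≤ 1 + ∫ θ, ‖θ‖ ^ 2 ∂ρ.law := by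
  have : ∫ θ, ‖θ‖ ∂ρ.law ≤ ∫ θ, (1 + ‖θ‖ ^ 2) ∂ρ.law := by
    refine integral_mono ρ.integrable_norm ((integrable_const _).add ρ.integrable_norm_sq)
      fun θ => ?_
    simp only
    nlinarith [sq_nonneg (‖θ‖ - 1), norm_nonneg θ]
  rwa [integral_add (integrable_const _) ρ.integrable_norm_sq, integral_const,
    probReal_univ, one_smul] at this

lemma P2.integral_one_add_sq_le (ρ : P2 k) :
    ∫ θ, (1 + ‖θ‖) ^ 2 ∂ρ.law ≤ 2 * (1 + ∫ θ, ‖θ‖ ^ 2 ∂ρ.law) := by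
  have : ∫ θ, (1 + ‖θ‖) ^ 2 ∂ρ.law ≤ ∫ θ, 2 * (1 + ‖θ‖ ^ 2) ∂ρ.law := by
    refine integral_mono ρ.integrable_one_add_sq
      (((integrable_const _).add ρ.integrable_norm_sq).const_mul 2) fun θ => ?_
    simp only
    nlinarith [sq_nonneg (‖θ‖ - 1), norm_nonneg θ]
  rwa [integral_const_mul, integral_add (integrable_const _) ρ.integrable_norm_sq, integral_const,
    probReal_univ, one_smul] at this

/-- `F` is locally Lipschitz with a constant of linear growth. -/
def WLip {G : Type*} [NormedAddCommGroup G] (c : ℝ) (F : Vec k → G) : Prop :=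
  ∀ x y, ‖F x - F y‖ ≤ c * (1 + ‖x‖ + ‖y‖) * ‖x - y‖

lemma WLip.continuous {G : Type*} [NormedAddCommGroup G] {c : ℝ} {F : Vec k → G}
    (h : WLip c F) : Continuous F := by
  rw [continuous_iff_continuousAt]
  intro y
  rw [ContinuousAt, tendsto_iff_norm_sub_tendsto_zero]
  have h1 : Tendsto (fun x => c * (1 + ‖x‖ + ‖y‖) * ‖x - y‖) (𝓝 y)
      (𝓝 (c * (1 + ‖y‖ + ‖y‖) * ‖y - y‖)) := Continuous.tendsto (by fun_prop) y
  rw [sub_self, norm_zero, mul_zero] at h1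
  exact squeeze_zero (fun _ => norm_nonneg _) (fun x => h x y) h1

lemma WLip.growth {G : Type*} [NormedAddCommGroup G] {c : ℝ} (hc : 0 ≤ c) {F : Vec k → G}
    (h : WLip c F) (θ : Vec k) : ‖F θ‖ ≤ (‖F 0‖ + c) * (1 + ‖θ‖) ^ 2 := by
  have h1 := h θ 0
  simp only [norm_zero, sub_zero, add_zero] at h1
  have h2 : ‖F θ‖ ≤ ‖F θ - F 0‖ + ‖F 0‖ := by simpa using norm_add_le (F θ - F 0) (F 0)
  have h3 := norm_nonneg θ
  have h4 : c * (1 + ‖θ‖) * ‖θ‖ ≤ c * (1 + ‖θ‖) ^ 2 := by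
    rw [mul_assoc]; gcongr; nlinarith
  have h5 : ‖F 0‖ ≤ ‖F 0‖ * (1 + ‖θ‖) ^ 2 :=
    le_mul_of_one_le_right (norm_nonneg _) (by nlinarith)
  linarith

lemma WLip.integrable {G : Type*} [NormedAddCommGroup G] {c : ℝ} (hc : 0 ≤ c) {F : Vec k → G}
    (h : WLip c F) (ρ : P2 k) : Integrable F ρ.law :=
  ρ.integrable_of_growth h.continuous.aestronglyMeasurable (h.growth hc)

lemma wLip_norm_sq : WLip 1 (fun θ : Vec k => ‖θ‖ ^ 2) := fun x y => by
  have h1 : |‖x‖ - ‖y‖| ≤ ‖x - y‖ := abs_norm_sub_norm_le x y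
  have e : ‖x‖ ^ 2 - ‖y‖ ^ 2 = (‖x‖ + ‖y‖) * (‖x‖ - ‖y‖) := by ring
  rw [e, norm_mul, Real.norm_of_nonneg (by positivity), Real.norm_eq_abs]
  gcongr
  linarith

/-- Two measures are `η`-close when tested against weighted Lipschitz functions. -/
def CloseMeas (η : ℝ) (μ ν : Measure (Vec k)) : Prop :=
  ∀ F : Vec k → ℝ, WLip 1 F → |∫ θ, F θ ∂μ - ∫ θ, F θ ∂ν| ≤ η

lemma CloseMeas.symm {η : ℝ} {μ ν : Measure (Vec k)} (h : CloseMeas η μ ν) :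
    CloseMeas η ν μ := fun F hF => by rw [abs_sub_comm]; exact h F hF

lemma CloseMeas.nonneg {η : ℝ} {μ ν : Measure (Vec k)} (h : CloseMeas η μ ν) : 0 ≤ η :=
  (abs_nonneg _).trans (h (fun _ => 0) fun x y => by simp; positivity)

lemma closeMeas_self (μ : Measure (Vec k)) : CloseMeas 0 μ μ := fun F _ => by simp

/-- The scalar definition is applied to F composed with a norming functional of the difference and
divided by c. -/
lemma CloseMeas.norm_integral_sub_le {G : Type*} [NormedAddCommGroup G] [NormedSpace ℝ G]
    [CompleteSpace G] {η c : ℝ} (hc : 0 < c) {ρ σ : P2 k} (h : CloseMeas η ρ.law σ.law)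
    {F : Vec k → G} (hF : WLip c F) : ‖∫ θ, F θ ∂ρ.law - ∫ θ, F θ ∂σ.law‖ ≤ c * η := by
  obtain ⟨φ, hφ, hφv⟩ := exists_dual_vector'' ℝ (∫ θ, F θ ∂ρ.law - ∫ θ, F θ ∂σ.law)
  have h1 : WLip 1 (fun θ => c⁻¹ * φ (F θ)) := fun x y => by
    rw [← mul_sub, ← map_sub, norm_mul, norm_inv, Real.norm_of_nonneg hc.le, one_mul,
      inv_mul_le_iff₀ hc, ← mul_assoc]
    refine (φ.le_opNorm _).trans ((mul_le_of_le_one_left (norm_nonneg _) hφ).trans (hF x y))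
  have h2 := h _ h1
  rw [integral_const_mul, integral_const_mul, ← mul_sub,
    φ.integral_comp_comm (hF.integrable hc.le ρ), φ.integral_comp_comm (hF.integrable hc.le σ),
    ← map_sub, hφv, abs_mul, abs_inv, abs_of_pos hc, inv_mul_le_iff₀ hc] at h2
  simpa using h2

/-- Measures with small Wasserstein distance are close. -/
lemma exists_closeMeas_of_W2_lt (Λ : ℝ) {η : ℝ} (hη : 0 < η) :
    ∃ δ : ℝ≥0∞, 0 < δ ∧ ∀ ν σ : P2 k, ∫ θ, ‖θ‖ ^ 2 ∂σ.law ≤ Λ → W2 ν σ < δ →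
      CloseMeas η ν.law σ.law := by
  set S : ℝ := 8 * (1 + |Λ|) with hS
  have hS0 : 0 < S := by positivity
  -- Here l is the parameter in Young's inequality for (1 + |θ'|)|θ - θ'|. With these values of S
  -- and δ, the moment part and the transport part of the estimate each contribute η/2.
  set l : ℝ := η / S with hl
  have hl0 : 0 < l := by positivity
  set δ : ℝ := Real.sqrt (η / 2 / (1 / (2 * l) + 1)) with hδ
  have hδ0 : 0 < δ := Real.sqrt_pos.2 (by positivity)
  have hδ2 : (1 / (2 * l) + 1) * δ ^ 2 = η / 2 := by
    rw [hδ, Real.sq_sqrt (by positivity)]; field_simp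
  refine ⟨ENNReal.ofReal δ, by simpa using hδ0, fun ν σ hσ hW F hF => ?_⟩
  have hW' : ⨅ π ∈ Couplings ν.law σ.law, ∫⁻ q, ‖q.1 - q.2‖ₑ ^ 2 ∂π < ENNReal.ofReal (δ ^ 2) := by
    rw [W2] at hW
    have := ENNReal.rpow_lt_rpow hW (z := 2) (by norm_num)
    rw [← ENNReal.rpow_mul] at this
    norm_num at this
    rwa [ENNReal.ofReal_pow hδ0.le]
  -- The strict inequality provides a nearly optimal plan; an optimal one is not needed.
  simp only [iInf_lt_iff] at hW'
  obtain ⟨π, ⟨h1, h2⟩, hπ⟩ := hW'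
  have hm : AEStronglyMeasurable (fun q : Vec k × Vec k => q.1 - q.2) π := by fun_prop
  have hint : Integrable (fun q : Vec k × Vec k => ‖q.1 - q.2‖ ^ 2) π :=
    integrable_norm_sq_of_lintegral_lt_top hm (hπ.trans ENNReal.ofReal_lt_top)
  have hle : ∫ q, ‖q.1 - q.2‖ ^ 2 ∂π ≤ δ ^ 2 := by
    rw [← ofReal_integral_norm_sq hint] at hπ
    exact (ENNReal.ofReal_lt_ofReal_iff (by positivity)).1 hπ |>.le
  have e1 : ∫ θ, F θ ∂ν.law = ∫ q, F q.1 ∂π := by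
    rw [← h1, integral_map (by fun_prop) hF.continuous.aestronglyMeasurable]
  have e2 : ∫ θ, F θ ∂σ.law = ∫ q, F q.2 ∂π := by
    rw [← h2, integral_map (by fun_prop) hF.continuous.aestronglyMeasurable]
  have i1 : Integrable (fun q : Vec k × Vec k => F q.1) π := by
    have := hF.integrable zero_le_one ν
    rw [← h1] at this
    exact this.comp_measurable measurable_fst
  have i2 : Integrable (fun q : Vec k × Vec k => F q.2) π := by
    have := hF.integrable zero_le_one σ
    rw [← h2] at this
    exact this.comp_measurable measurable_snd
  have i3 : Integrable (fun q : Vec k × Vec k => (1 + ‖q.2‖) ^ 2) π := by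
    have := σ.integrable_one_add_sq
    rw [← h2] at this
    exact this.comp_measurable measurable_snd
  have e3 : ∫ q, (1 + ‖q.2‖) ^ 2 ∂π ≤ 2 * (1 + |Λ|) := by
    have : ∫ q, (1 + ‖q.2‖) ^ 2 ∂π = ∫ θ, (1 + ‖θ‖) ^ 2 ∂σ.law := by
      rw [← h2, integral_map (f := fun θ : Vec k => (1 + ‖θ‖) ^ 2) (by fun_prop) (by fun_prop)]
    rw [this]
    refine σ.integral_one_add_sq_le.trans ?_
    have := hσ.trans (le_abs_self Λ)
    gcongr
  rw [e1, e2, ← integral_sub i1 i2]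
  calc |∫ q, (F q.1 - F q.2) ∂π| ≤ ∫ q, (2 * l * (1 + ‖q.2‖) ^ 2
        + (1 / (2 * l) + 1) * ‖q.1 - q.2‖ ^ 2) ∂π := by
        rw [← Real.norm_eq_abs]
        refine norm_integral_le_of_norm_le ((i3.const_mul _).add (hint.const_mul _))
          (ae_of_all _ fun q => (hF q.1 q.2).trans ?_)
        have h3 : ‖q.1‖ ≤ ‖q.1 - q.2‖ + ‖q.2‖ := by simpa using norm_add_le (q.1 - q.2) q.2
        have h4 : 2 * (1 + ‖q.2‖) * ‖q.1 - q.2‖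
            ≤ 2 * l * (1 + ‖q.2‖) ^ 2 + 1 / (2 * l) * ‖q.1 - q.2‖ ^ 2 := by
          have : 0 ≤ 1 / (2 * l) * (2 * l * (1 + ‖q.2‖) - ‖q.1 - q.2‖) ^ 2 := by positivity
          have e : 1 / (2 * l) * (2 * l * (1 + ‖q.2‖) - ‖q.1 - q.2‖) ^ 2
            = 2 * l * (1 + ‖q.2‖) ^ 2 - 2 * (1 + ‖q.2‖) * ‖q.1 - q.2‖
              + 1 / (2 * l) * ‖q.1 - q.2‖ ^ 2 := by field_simp; ring
          linarith
        have h5 := norm_nonneg q.2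
        have h6 : (1 + ‖q.1‖ + ‖q.2‖) * ‖q.1 - q.2‖
            ≤ (2 * (1 + ‖q.2‖) + ‖q.1 - q.2‖) * ‖q.1 - q.2‖ :=
          mul_le_mul_of_nonneg_right (by linarith) (norm_nonneg _)
        nlinarith
    _ ≤ 2 * l * (2 * (1 + |Λ|)) + (1 / (2 * l) + 1) * δ ^ 2 := by
        rw [integral_add (i3.const_mul _) (hint.const_mul _), integral_const_mul,
          integral_const_mul]
        gcongr
    _ ≤ η := by
        rw [hδ2, hl, hS]
        have : 2 * (η / (8 * (1 + |Λ|))) * (2 * (1 + |Λ|)) = η / 2 := by field_simp; norm_num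
        linarith

/-- Closeness of curves, uniformly in `t`. -/
def Close (η : ℝ) (ρ σ : PathP2 k) : Prop := ∀ t, CloseMeas η (ρ t) (σ t)

lemma PathP2.continuous_integral {G : Type*} [NormedAddCommGroup G] [NormedSpace ℝ G]
    [CompleteSpace G] (ρ : PathP2 k) {c : ℝ} {F : Vec k → G} (hF : WLip c F) :
    Continuous fun t => ∫ θ, F θ ∂(ρ t) := by
  have hF' : WLip (|c| + 1) F := fun x y => (hF x y).trans (by
    gcongr
    linarith [le_abs_self c])
  have hc : 0 < |c| + 1 := by positivity
  rw [continuous_iff_continuousAt]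
  intro t₀
  rw [ContinuousAt, Metric.tendsto_nhds]
  intro ε hε
  obtain ⟨δ, hδ, h⟩ := exists_closeMeas_of_W2_lt (k := k) (∫ θ, ‖θ‖ ^ 2 ∂(ρ t₀))
    (η := ε / (2 * (|c| + 1))) (by positivity)
  filter_upwards [(ρ.continuous_W2 t₀).eventually (gt_mem_nhds hδ)] with t ht
  have := (h _ (ρ.at_time t₀) le_rfl ht).norm_integral_sub_le hc hF'
  rw [dist_eq_norm]
  refine this.trans_lt ?_
  have e : (|c| + 1) * (ε / (2 * (|c| + 1))) = ε / 2 := by field_simp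
  linarith

lemma PathP2.continuous_moment (ρ : PathP2 k) : Continuous fun t => ∫ θ, ‖θ‖ ^ 2 ∂(ρ t) :=
  ρ.continuous_integral wLip_norm_sq

lemma PathP2.exists_moment_le (ρ : PathP2 k) :
    ∃ Λ, 0 ≤ Λ ∧ ∀ t, ∫ θ, ‖θ‖ ^ 2 ∂(ρ t) ≤ Λ := by
  obtain ⟨Λ, hΛ⟩ := isCompact_univ.exists_bound_of_continuousOn ρ.continuous_moment.continuousOn
  exact ⟨|Λ|, abs_nonneg _, fun t => (le_abs_self _).trans ((hΛ t trivial).trans (le_abs_self _))⟩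

/-- The joint law of X and Y is a competitor in the infimum. -/
lemma W2_le_of_map {Ω : Type*} {mΩ : MeasurableSpace Ω} {P : Measure Ω} {X Y : Ω → Vec k}
    (hX : Measurable X) (hY : Measurable Y) {ρ σ : P2 k} (hρ : ρ.law = P.map X)
    (hσ : σ.law = P.map Y) : W2 ρ σ ≤ (∫⁻ ω, ‖X ω - Y ω‖ₑ ^ 2 ∂P) ^ (1 / 2 : ℝ) := by
  rw [W2]
  gcongr
  have hmem : P.map (fun ω => (X ω, Y ω)) ∈ Couplings ρ.law σ.law := by
    constructor
    · rw [Measure.map_map measurable_fst (hX.prodMk hY), hρ]; rfl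
    · rw [Measure.map_map measurable_snd (hX.prodMk hY), hσ]; rfl
  refine (iInf₂_le _ hmem).trans ?_
  rw [lintegral_map (by fun_prop) (hX.prodMk hY)]

/-- Dominated convergence with an additional bound that tends to zero in mean. -/
lemma tendsto_lintegral_zero_of_le_add {ι Ω : Type*} {mΩ : MeasurableSpace Ω} {P : Measure Ω}
    {l : Filter ι} [l.IsCountablyGenerated] {D e : ι → Ω → ℝ≥0∞} {b : Ω → ℝ≥0∞}
    (hD : ∀ i, Measurable (D i)) (he : ∀ i, Measurable (e i))
    (hle : ∀ᶠ i in l, ∀ ω, D i ω ≤ b ω + e i ω) (hb : ∫⁻ ω, b ω ∂P ≠ ∞)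
    (hlim : ∀ ω, Tendsto (fun i => D i ω) l (𝓝 0))
    (he0 : Tendsto (fun i => ∫⁻ ω, e i ω ∂P) l (𝓝 0)) :
    Tendsto (fun i => ∫⁻ ω, D i ω ∂P) l (𝓝 0) := by
  -- The truncated difference D - e is dominated by b, and D ≤ (D - e) + e recovers the claim.
  have h1 : Tendsto (fun i => ∫⁻ ω, (D i ω - e i ω) ∂P) l (𝓝 (∫⁻ _, 0 ∂P)) := by
    refine tendsto_lintegral_filter_of_dominated_convergence b
      (Eventually.of_forall fun i => (hD i).sub (he i)) ?_ hb (ae_of_all _ fun ω => ?_)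
    · filter_upwards [hle] with i hi
      exact ae_of_all _ fun ω => tsub_le_iff_right.2 (hi ω)
    · exact tendsto_of_tendsto_of_tendsto_of_le_of_le tendsto_const_nhds (hlim ω)
        (fun _ => zero_le) (fun _ => tsub_le_self)
  rw [lintegral_zero] at h1
  have h2 := h1.add he0
  rw [add_zero] at h2
  refine tendsto_of_tendsto_of_tendsto_of_le_of_le tendsto_const_nhds h2 (fun _ => zero_le)
    fun i => ?_
  rw [← lintegral_add_right _ (he i)]
  exact lintegral_mono fun ω => le_tsub_add

end Moments
end MeanFieldResNet

namespace MeanFieldResNet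

/-! ### Transport of an admissible curve by a displacement -/

section Displacement

variable {k : ℕ}

/-- Path continuity gives pointwise convergence. The growth of G gives domination by an integrable
function of the limiting layer plus a multiple of |X_t - X_{t₀}|², which vanishes in mean by
mean-square continuity. Both halves of admissibility are used here. The case p = 1 serves integrals,
p = 2 serves W₂. -/
lemma Admissible.tendsto_lintegral_enorm_sub {ρ : PathP2 k} {Ω : Type} {mΩ : MeasurableSpace Ω}
    {P : Measure Ω} [IsProbabilityMeasure P] {X : I01 → Ω → Vec k} (hXm : ∀ t, Measurable (X t))
    (hXc : ∀ ω, Continuous fun t => X t ω) (hXl : ∀ t, P.map (X t) = ρ t)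
    (hXt : ∀ t₀, Tendsto (fun t => ∫⁻ ω, ‖X t ω - X t₀ ω‖ₑ ^ 2 ∂P) (𝓝 t₀) (𝓝 0))
    {W F : Type*} [TopologicalSpace W] [FirstCountableTopology W] [NormedAddCommGroup F]
    [MeasurableSpace F] [BorelSpace F] [SecondCountableTopology F]
    {τ : W → I01} (hτ : Continuous τ) {G : W → Vec k → F} (hG : Continuous (Function.uncurry G))
    {w₀ : W} {C : ℝ} {p : ℕ} (hp : p ≠ 0)
    (hgrow : ∀ᶠ w in 𝓝 w₀, ∀ θ, ‖G w θ‖ ^ p ≤ C * (1 + ‖θ‖) ^ 2) :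
    Tendsto (fun w => ∫⁻ ω, ‖G w (X (τ w) ω) - G w₀ (X (τ w₀) ω)‖ₑ ^ p ∂P) (𝓝 w₀) (𝓝 0) := by
  have hGm : ∀ w, Measurable (G w) := fun w => (hG.comp (by fun_prop : Continuous fun θ => (w, θ))).measurable
  have hC : 0 ≤ C := by
    have := (by positivity : (0 : ℝ) ≤ ‖G w₀ 0‖ ^ p).trans (hgrow.self_of_nhds 0)
    simpa using this
  have hint : Integrable (fun ω => (1 + ‖X (τ w₀) ω‖) ^ 2) P := by
    have := (ρ.at_time (τ w₀)).integrable_one_add_sq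
    have hl : P.map (X (τ w₀)) = (ρ.at_time (τ w₀)).law := hXl _
    rw [← hl] at this
    exact this.comp_measurable (hXm _)
  refine tendsto_lintegral_zero_of_le_add
    -- The constants come from |a - b|^p ≤ 2^p (|a|^p + |b|^p) and (1 + |x|)² ≤ 2(1 + |z|)² + 2|x -
    -- z|².
    (e := fun w ω => ENNReal.ofReal (2 ^ p * (2 * C)) * ‖X (τ w) ω - X (τ w₀) ω‖ₑ ^ 2)
    (b := fun ω => ENNReal.ofReal (2 ^ p * (3 * C) * (1 + ‖X (τ w₀) ω‖) ^ 2)) (fun w => ?_)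
    (fun w => ?_) ?_ ?_ (fun ω => ?_) ?_
  · exact ((((hGm _).comp (hXm _)).sub ((hGm _).comp (hXm _))).enorm.pow_const _)
  · exact ((((hXm _).sub (hXm _)).enorm.pow_const _).const_mul _)
  · filter_upwards [hgrow] with w hw ω
    rw [← ofReal_norm, ← ofReal_norm, ← ENNReal.ofReal_pow (norm_nonneg _),
      ← ENNReal.ofReal_pow (norm_nonneg _), ← ENNReal.ofReal_mul (by positivity),
      ← ENNReal.ofReal_add (by positivity) (by positivity)]
    refine ENNReal.ofReal_le_ofReal ?_
    set x := X (τ w) ω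
    set z := X (τ w₀) ω
    have h1 := hw x
    have h2 := hgrow.self_of_nhds z
    have h3 : ‖G w x - G w₀ z‖ ^ p ≤ 2 ^ p * (‖G w x‖ ^ p + ‖G w₀ z‖ ^ p) := by
      calc ‖G w x - G w₀ z‖ ^ p ≤ (2 * max ‖G w x‖ ‖G w₀ z‖) ^ p := by
            gcongr
            have := norm_sub_le (G w x) (G w₀ z)
            linarith [le_max_left ‖G w x‖ ‖G w₀ z‖, le_max_right ‖G w x‖ ‖G w₀ z‖]
        _ = 2 ^ p * (max ‖G w x‖ ‖G w₀ z‖) ^ p := mul_pow _ _ _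
        _ ≤ _ := by
            gcongr
            rcases max_choice ‖G w x‖ ‖G w₀ z‖ with h | h <;> rw [h]
            · linarith [pow_nonneg (norm_nonneg (G w₀ z)) p]
            · linarith [pow_nonneg (norm_nonneg (G w x)) p]
    have h4 : ‖x‖ ≤ ‖x - z‖ + ‖z‖ := by simpa using norm_add_le (x - z) z
    have h5 : (1 + ‖x‖) ^ 2 ≤ 2 * (1 + ‖z‖) ^ 2 + 2 * ‖x - z‖ ^ 2 := by
      have : (1 + ‖x‖) ^ 2 ≤ ((1 + ‖z‖) + ‖x - z‖) ^ 2 :=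
        pow_le_pow_left₀ (by positivity) (by linarith) 2
      nlinarith [sq_nonneg ((1 + ‖z‖) - ‖x - z‖)]
    have h6 : ‖G w x‖ ^ p + ‖G w₀ z‖ ^ p
        ≤ 3 * C * (1 + ‖z‖) ^ 2 + 2 * C * ‖x - z‖ ^ 2 := by
      have := mul_le_mul_of_nonneg_left h5 hC
      linarith
    calc _ ≤ 2 ^ p * (‖G w x‖ ^ p + ‖G w₀ z‖ ^ p) := h3
      _ ≤ 2 ^ p * (3 * C * (1 + ‖z‖) ^ 2 + 2 * C * ‖x - z‖ ^ 2) := by gcongr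
      _ = _ := by ring
  · have := (hint.const_mul (2 ^ p * (3 * C)))
    rw [← ofReal_integral_eq_lintegral_ofReal this (ae_of_all _ fun _ => by positivity)]
    exact ENNReal.ofReal_ne_top
  · have h1 : Continuous fun w => ‖G w (X (τ w) ω) - G w₀ (X (τ w₀) ω)‖ₑ ^ p := by
      have h2 : Continuous fun w => G w (X (τ w) ω) :=
        hG.comp (continuous_id.prodMk ((hXc ω).comp hτ))
      have h3 : Continuous fun w => G w (X (τ w) ω) - G w₀ (X (τ w₀) ω) := h2.sub continuous_const
      exact (ENNReal.continuous_pow p).comp h3.enorm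
    have := h1.tendsto w₀
    simpa [hp] using this
  · refine (tendsto_congr fun w => lintegral_const_mul (ENNReal.ofReal (2 ^ p * (2 * C)))
      (((hXm (τ w)).sub (hXm (τ w₀))).enorm.pow_const 2)).2 ?_
    have := ENNReal.Tendsto.const_mul (a := ENNReal.ofReal (2 ^ p * (2 * C)))
      ((hXt (τ w₀)).comp (hτ.tendsto w₀)) (Or.inr ENNReal.ofReal_ne_top)
    simpa using this

/-- Integrals of jointly continuous functions of quadratic growth against an admissible curve
depend continuously on parameters. -/
lemma Admissible.continuous_integral {ρ : PathP2 k} (hρ : Admissible ρ) {W F : Type*}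
    [TopologicalSpace W] [FirstCountableTopology W] [NormedAddCommGroup F] [NormedSpace ℝ F]
    [SecondCountableTopology F] {τ : W → I01} (hτ : Continuous τ)
    {G : W → Vec k → F} (hG : Continuous (Function.uncurry G))
    (hgrow : ∀ w₀, ∃ C : ℝ, ∀ᶠ w in 𝓝 w₀, ∀ θ, ‖G w θ‖ ≤ C * (1 + ‖θ‖) ^ 2) :
    Continuous fun w => ∫ θ, G w θ ∂(ρ (τ w)) := by
  borelize F
  obtain ⟨Ω, mΩ, P, hP, X, hXm, hXc, hXl, hXt⟩ := hρ
  have hGc : ∀ w, Continuous (G w) := fun w => hG.comp (by fun_prop : Continuous fun θ => (w, θ))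
  have e : ∀ w, ∫ θ, G w θ ∂(ρ (τ w)) = ∫ ω, G w (X (τ w) ω) ∂P := fun w => by
    rw [← hXl, integral_map (hXm _).aemeasurable (hGc w).aestronglyMeasurable]
  simp_rw [e]
  rw [continuous_iff_continuousAt]
  intro w₀
  obtain ⟨C, hC⟩ := hgrow w₀
  have hint : ∀ w, (∀ θ, ‖G w θ‖ ≤ C * (1 + ‖θ‖) ^ 2) →
      Integrable (fun ω => G w (X (τ w) ω)) P := fun w hw => by
    have := (ρ.at_time (τ w)).integrable_of_growth (hGc w).aestronglyMeasurable hw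
    have hl : P.map (X (τ w)) = (ρ.at_time (τ w)).law := hXl _
    rw [← hl] at this
    exact this.comp_measurable (hXm _)
  refine tendsto_integral_of_L1 _ (hint w₀ hC.self_of_nhds).aestronglyMeasurable
    (hC.mono fun w hw => hint w hw) ?_
  have := Admissible.tendsto_lintegral_enorm_sub hXm hXc hXl hXt hτ hG (w₀ := w₀) one_ne_zero
    (by simpa using hC)
  simpa using this

/-- Weighted displacement fields on `[0,1] × ℝᵏ`. -/
abbrev Disp (k : ℕ) : Type := BoundedContinuousFunction (I01 × Vec k) (Vec k)

/-- The transport map with weighted displacement `ψ`. -/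
noncomputable def disp (ψ : Disp k) (t : I01) (θ : Vec k) : Vec k := θ + (1 + ‖θ‖) • ψ (t, θ)

lemma continuous_disp (ψ : Disp k) : Continuous (Function.uncurry (disp ψ)) := by
  unfold disp Function.uncurry
  have := ψ.continuous
  fun_prop

lemma continuous_disp_apply (ψ : Disp k) (t : I01) : Continuous (disp ψ t) :=
  (continuous_disp ψ).comp (by fun_prop : Continuous fun θ => (t, θ))

lemma one_add_norm_disp_le (ψ : Disp k) (t : I01) (θ : Vec k) :
    1 + ‖disp ψ t θ‖ ≤ (1 + ‖ψ‖) * (1 + ‖θ‖) := by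
  have h1 : ‖disp ψ t θ‖ ≤ ‖θ‖ + (1 + ‖θ‖) * ‖ψ‖ := by
    refine (norm_add_le _ _).trans ?_
    rw [norm_smul, Real.norm_of_nonneg (by positivity)]
    gcongr
    exact ψ.norm_coe_le_norm _
  linarith

lemma norm_disp_le (ψ : Disp k) (t : I01) (θ : Vec k) :
    ‖disp ψ t θ‖ ≤ (1 + ‖ψ‖) * (1 + ‖θ‖) := by
  linarith [one_add_norm_disp_le ψ t θ]

lemma disp_sub (ψ χ : Disp k) (t : I01) (θ : Vec k) :
    disp ψ t θ - disp χ t θ = (1 + ‖θ‖) • (ψ - χ) (t, θ) := by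
  simp [disp, smul_sub]

lemma norm_disp_sub_le (ψ χ : Disp k) (t : I01) (θ : Vec k) :
    ‖disp ψ t θ - disp χ t θ‖ ≤ (1 + ‖θ‖) * ‖ψ - χ‖ := by
  rw [disp_sub, norm_smul, Real.norm_of_nonneg (by positivity)]
  gcongr
  exact (ψ - χ).norm_coe_le_norm _

@[simp] lemma disp_zero (t : I01) (θ : Vec k) : disp 0 t θ = θ := by simp [disp]

lemma norm_disp_sq_le (ψ : Disp k) (t : I01) (θ : Vec k) :
    ‖disp ψ t θ‖ ^ 2 ≤ (1 + ‖ψ‖) ^ 2 * (1 + ‖θ‖) ^ 2 := by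
  rw [← mul_pow]
  gcongr
  exact norm_disp_le ψ t θ

lemma P2.integrable_norm_sq_disp (ρ : P2 k) (ψ : Disp k) (t : I01) :
    Integrable (fun θ => ‖disp ψ t θ‖ ^ 2) ρ.law :=
  ρ.integrable_of_growth (C := (1 + ‖ψ‖) ^ 2)
    (((continuous_disp_apply ψ t).norm.pow 2).aestronglyMeasurable) fun θ => by
      rw [Real.norm_of_nonneg (by positivity)]
      exact norm_disp_sq_le ψ t θ

/-- The image of a curve of measures under the maps `disp ψ t`. -/
noncomputable def pushP2 (ρ : P2 k) (ψ : Disp k) (t : I01) : P2 k where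
  law := ρ.law.map (disp ψ t)
  isProbabilityMeasure :=
    Measure.isProbabilityMeasure_map (continuous_disp_apply ψ t).measurable.aemeasurable
  second_moment := by
    rw [lintegral_map (by fun_prop) (continuous_disp_apply ψ t).measurable,
      ← ofReal_integral_norm_sq (ρ.integrable_norm_sq_disp ψ t)]
    exact ENNReal.ofReal_lt_top

/-- The image of an admissible curve under the maps `disp ψ t`. -/
noncomputable def pushPath {ρ : PathP2 k} (hρ : Admissible ρ) (ψ : Disp k) : PathP2 k where
  at_time t := pushP2 (ρ.at_time t) ψ t
  continuous_W2 t₀ := by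
    -- A coupling of two layers cannot simply be pushed forward, since ψ has no modulus of
    -- continuity in θ uniform over ℝᵏ. The coupling along the paths of the process avoids this.
    obtain ⟨Ω, mΩ, P, hP, X, hXm, hXc, hXl, hXt⟩ := hρ
    have h := Admissible.tendsto_lintegral_enorm_sub hXm hXc hXl hXt continuous_id
      (continuous_disp ψ) (w₀ := t₀) two_ne_zero
      (Eventually.of_forall fun w θ => norm_disp_sq_le ψ w θ)
    have h' := h.ennrpow_const (1 / 2 : ℝ)
    rw [ENNReal.zero_rpow_of_pos (by norm_num)] at h'
    have hm : ∀ t, Measurable fun ω => disp ψ t (X t ω) := fun t =>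
      (continuous_disp_apply ψ t).measurable.comp (hXm t)
    have hl : ∀ t, (pushP2 (ρ.at_time t) ψ t).law = P.map fun ω => disp ψ t (X t ω) := fun t => by
      rw [← Function.comp_def, ← Measure.map_map (continuous_disp_apply ψ t).measurable (hXm t),
        hXl]
      rfl
    exact tendsto_of_tendsto_of_tendsto_of_le_of_le tendsto_const_nhds h' (fun _ => zero_le)
      fun t => W2_le_of_map (hm t) (hm t₀) (hl t) (hl t₀)

variable {ρ : PathP2 k} (hρ : Admissible ρ)

lemma pushPath_apply (ψ : Disp k) (t : I01) : (pushPath hρ ψ) t = (ρ t).map (disp ψ t) := rfl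

lemma integral_pushPath {G : Type*} [NormedAddCommGroup G] [NormedSpace ℝ G] (ψ : Disp k)
    (t : I01) {F : Vec k → G} (hF : Continuous F) :
    ∫ θ, F θ ∂(pushPath hρ ψ t) = ∫ θ, F (disp ψ t θ) ∂(ρ t) := by
  rw [pushPath_apply, integral_map (continuous_disp_apply ψ t).measurable.aemeasurable]
  borelize G
  exact hF.aestronglyMeasurable

lemma pushPath_zero : pushPath hρ 0 = ρ := by
  ext t : 2
  refine P2.ext ?_
  change (ρ t).map (disp 0 t) = ρ t
  have : disp (0 : Disp k) t = id := by ext1 θ; simp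
  rw [this, Measure.map_id]

lemma admissible_pushPath (ψ : Disp k) : Admissible (pushPath hρ ψ) := by
  have hρ' := hρ
  obtain ⟨Ω, mΩ, P, hP, X, hXm, hXc, hXl, hXt⟩ := hρ'
  refine ⟨Ω, mΩ, P, hP, fun t ω => disp ψ t (X t ω),
    fun t => (continuous_disp_apply ψ t).measurable.comp (hXm t),
    fun ω => (continuous_disp ψ).comp (continuous_id.prodMk (hXc ω)), fun t => ?_, fun t₀ => ?_⟩
  · rw [pushPath_apply, ← hXl, Measure.map_map (continuous_disp_apply ψ t).measurable (hXm t)]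
    rfl
  · exact Admissible.tendsto_lintegral_enorm_sub hXm hXc hXl hXt continuous_id
      (continuous_disp ψ) (w₀ := t₀) two_ne_zero
      (Eventually.of_forall fun w θ => norm_disp_sq_le ψ w θ)

lemma integral_one_add_sq_le {Λ : ℝ} (hΛ : ∀ t, ∫ θ, ‖θ‖ ^ 2 ∂(ρ t) ≤ Λ) (t : I01) :
    ∫ θ, (1 + ‖θ‖) ^ 2 ∂(ρ t) ≤ 2 * (1 + Λ) :=
  (ρ.at_time t).integral_one_add_sq_le.trans (by gcongr; exact hΛ t)

lemma integral_norm_sq_pushPath_le {Λ : ℝ} (hΛ : ∀ t, ∫ θ, ‖θ‖ ^ 2 ∂(ρ t) ≤ Λ) (ψ : Disp k)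
    (t : I01) : ∫ θ, ‖θ‖ ^ 2 ∂(pushPath hρ ψ t) ≤ (1 + ‖ψ‖) ^ 2 * (2 * (1 + Λ)) := by
  rw [integral_pushPath hρ ψ t (by fun_prop)]
  calc ∫ θ, ‖disp ψ t θ‖ ^ 2 ∂(ρ t) ≤ ∫ θ, (1 + ‖ψ‖) ^ 2 * (1 + ‖θ‖) ^ 2 ∂(ρ t) :=
        integral_mono ((ρ.at_time t).integrable_norm_sq_disp ψ t)
          ((ρ.at_time t).integrable_one_add_sq.const_mul _) fun θ => norm_disp_sq_le ψ t θ
    _ ≤ _ := by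
        rw [integral_const_mul]
        gcongr
        exact integral_one_add_sq_le hΛ t

/-- Both images are coupled through their common starting point θ. Each factor of the weighted
Lipschitz bound contributes one power of 1 + |θ|, so a second moment of the initial curve suffices.
-/
lemma close_pushPath {Λ : ℝ} (hΛ : ∀ t, ∫ θ, ‖θ‖ ^ 2 ∂(ρ t) ≤ Λ) (ψ χ : Disp k) :
    Close ((2 + ‖ψ‖ + ‖χ‖) * (2 * (1 + Λ)) * ‖ψ - χ‖) (pushPath hρ ψ) (pushPath hρ χ) := by
  intro t F hF
  have hi : ∀ ψ : Disp k, Integrable (fun θ => F (disp ψ t θ)) (ρ t) := fun ψ => by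
    have := hF.integrable zero_le_one (pushP2 (ρ.at_time t) ψ t)
    exact this.comp_measurable (continuous_disp_apply ψ t).measurable
  rw [integral_pushPath hρ ψ t hF.continuous, integral_pushPath hρ χ t hF.continuous,
    ← integral_sub (hi ψ) (hi χ), ← Real.norm_eq_abs]
  calc ‖∫ θ, (F (disp ψ t θ) - F (disp χ t θ)) ∂(ρ t)‖
      ≤ ∫ θ, ((2 + ‖ψ‖ + ‖χ‖) * ‖ψ - χ‖) * (1 + ‖θ‖) ^ 2 ∂(ρ t) := by
        refine norm_integral_le_of_norm_le ((ρ.at_time t).integrable_one_add_sq.const_mul _)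
          (ae_of_all _ fun θ => (hF _ _).trans ?_)
        have h1 := one_add_norm_disp_le ψ t θ
        have h2 := one_add_norm_disp_le χ t θ
        have h3 := norm_disp_sub_le ψ χ t θ
        calc 1 * (1 + ‖disp ψ t θ‖ + ‖disp χ t θ‖) * ‖disp ψ t θ - disp χ t θ‖
            ≤ ((2 + ‖ψ‖ + ‖χ‖) * (1 + ‖θ‖)) * ((1 + ‖θ‖) * ‖ψ - χ‖) :=
              mul_le_mul (by linarith) h3 (norm_nonneg _) (by positivity)
          _ = _ := by ring
    _ ≤ _ := by
        rw [integral_const_mul]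
        calc _ ≤ ((2 + ‖ψ‖ + ‖χ‖) * ‖ψ - χ‖) * (2 * (1 + Λ)) := by
              gcongr
              exact integral_one_add_sq_le hΛ t
          _ = _ := by ring

lemma d1_pushPath_le {Λ : ℝ} (hΛ : ∀ t, ∫ θ, ‖θ‖ ^ 2 ∂(ρ t) ≤ Λ) (ψ χ : Disp k) :
    d1 (pushPath hρ ψ) (pushPath hρ χ)
      ≤ ENNReal.ofReal (‖ψ - χ‖ ^ 2 * (2 * (1 + Λ))) ^ (1 / 2 : ℝ) := by
  refine iSup_le fun t => (W2_le_of_map (continuous_disp_apply ψ t).measurable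
    (continuous_disp_apply χ t).measurable rfl rfl).trans ?_
  gcongr
  have hle : ∀ θ, ‖disp ψ t θ - disp χ t θ‖ ^ 2 ≤ ‖ψ - χ‖ ^ 2 * (1 + ‖θ‖) ^ 2 := fun θ => by
    rw [← mul_pow, mul_comm ‖ψ - χ‖]
    gcongr
    exact norm_disp_sub_le ψ χ t θ
  have hi : Integrable (fun θ => ‖disp ψ t θ - disp χ t θ‖ ^ 2) (ρ t) :=
    (ρ.at_time t).integrable_of_growth (C := ‖ψ - χ‖ ^ 2)
      ((((continuous_disp_apply ψ t).sub (continuous_disp_apply χ t)).norm.pow 2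
        ).aestronglyMeasurable) fun θ => by
        rw [Real.norm_of_nonneg (by positivity)]
        exact hle θ
  refine (ofReal_integral_norm_sq hi).symm.le.trans (ENNReal.ofReal_le_ofReal ?_)
  calc ∫ θ, ‖disp ψ t θ - disp χ t θ‖ ^ 2 ∂(ρ t)
      ≤ ∫ θ, ‖ψ - χ‖ ^ 2 * (1 + ‖θ‖) ^ 2 ∂(ρ t) :=
        integral_mono hi ((ρ.at_time t).integrable_one_add_sq.const_mul _) hle
    _ ≤ _ := by
        rw [integral_const_mul]
        gcongr
        exact integral_one_add_sq_le hΛ t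

end Displacement
end MeanFieldResNet

namespace MeanFieldResNet

/-! ### Bounds on the activation function -/

/-- First-order Taylor estimate for a function with Lipschitz derivative. -/
lemma norm_sub_sub_fderiv_le {E F : Type*} [NormedAddCommGroup E] [NormedSpace ℝ E]
    [NormedAddCommGroup F] [NormedSpace ℝ F] {u : E → F} {L : ℝ} (hL : 0 ≤ L) {x : E}
    (hu : Differentiable ℝ u) (h : ∀ z, ‖fderiv ℝ u z - fderiv ℝ u x‖ ≤ L * ‖z - x‖) (y : E) :
    ‖u y - u x - fderiv ℝ u x (y - x)‖ ≤ L * ‖y - x‖ ^ 2 := by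
  have h1 := (convex_closedBall x ‖y - x‖).norm_image_sub_le_of_norm_fderiv_le'
    (𝕜 := ℝ) (f := u) (C := L * ‖y - x‖) (φ := fderiv ℝ u x) (fun z _ => hu z)
    (fun z hz => (h z).trans (by
      gcongr
      simpa [dist_eq_norm] using hz))
    (Metric.mem_closedBall_self (norm_nonneg _)) (y := y) (by simp [dist_eq_norm])
  calc _ ≤ L * ‖y - x‖ * ‖y - x‖ := h1
    _ = _ := by ring

variable {d k : ℕ}

/-- The derivative of the activation function in the space variable. -/
noncomputable def dX (f : Vec d → Vec k → Vec d) (z : Vec d) (θ : Vec k) : Vec d →L[ℝ] Vec d :=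
  fderiv ℝ (fun z => f z θ) z

/-- The derivative of the activation function in the parameter. -/
noncomputable def dTh (f : Vec d → Vec k → Vec d) (z : Vec d) (θ : Vec k) : Vec k →L[ℝ] Vec d :=
  fderiv ℝ (f z) θ

/-- Quantitative regularity of the activation function. -/
structure ActivationBounds (f : Vec d → Vec k → Vec d) (C : ℝ) : Prop where
  contDiff : ContDiff ℝ 2 (fun q : Vec d × Vec k => f q.1 q.2)
  one_le : 1 ≤ C
  norm_zero_le : ‖f 0 0‖ ≤ C
  norm_dX_le : ∀ z θ, ‖dX f z θ‖ ≤ C * ‖θ‖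
  norm_dTh_le : ∀ z θ, ‖dTh f z θ‖ ≤ C * (1 + ‖z‖)
  dX_sub_le : ∀ z z' θ, ‖dX f z θ - dX f z' θ‖ ≤ C * ‖θ‖ ^ 2 * ‖z - z'‖
  dTh_sub_le : ∀ z θ θ', ‖dTh f z θ - dTh f z θ'‖ ≤ C * (1 + ‖z‖) ^ 2 * ‖θ - θ'‖
  dTh_sub_left_le : ∀ z z' θ,
    ‖dTh f z θ - dTh f z' θ‖ ≤ C * ‖θ‖ * (1 + ‖z‖ + ‖z'‖) * ‖z - z'‖

section

variable {f : Vec d → Vec k → Vec d}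

lemma contDiff_left (hf : ContDiff ℝ 2 (fun q : Vec d × Vec k => f q.1 q.2)) (θ : Vec k) :
    ContDiff ℝ 2 (fun z => f z θ) :=
  hf.comp (contDiff_id.prodMk contDiff_const)

lemma contDiff_right (hf : ContDiff ℝ 2 (fun q : Vec d × Vec k => f q.1 q.2)) (z : Vec d) :
    ContDiff ℝ 2 (f z) :=
  hf.comp (contDiff_const.prodMk contDiff_id)

lemma contDiff_dTh (hf : ContDiff ℝ 2 (fun q : Vec d × Vec k => f q.1 q.2)) :
    ContDiff ℝ 1 (fun q : Vec d × Vec k => dTh f q.1 q.2) := by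
  have h : ContDiff ℝ 2 (Function.uncurry fun (q : Vec d × Vec k) (θ : Vec k) => f q.1 θ) :=
    hf.comp ((contDiff_fst.comp contDiff_fst).prodMk contDiff_snd)
  exact h.fderiv contDiff_snd (by norm_num [one_add_one_eq_two])

lemma norm_fderiv_fderiv_eq {E F : Type*} [NormedAddCommGroup E] [NormedSpace ℝ E]
    [NormedAddCommGroup F] [NormedSpace ℝ F] (u : E → F) (x : E) :
    ‖fderiv ℝ (fderiv ℝ u) x‖ = ‖iteratedFDeriv ℝ 2 u x‖ := by
  rw [← norm_iteratedFDeriv_one, norm_iteratedFDeriv_fderiv]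

lemma norm_iteratedFDeriv_iteratedFDeriv_zero (i : ℕ) (z : Vec d) (θ : Vec k) :
    ‖iteratedFDeriv ℝ i (fun z' => iteratedFDeriv ℝ 0 (fun θ' => f z' θ') θ) z‖
      = ‖iteratedFDeriv ℝ i (fun z' => f z' θ) z‖ := by
  have : (fun z' => iteratedFDeriv ℝ 0 (fun θ' => f z' θ') θ)
      = (continuousMultilinearCurryFin0 ℝ (Vec k) (Vec d)).symm ∘ fun z' => f z' θ := by
    ext1 z'
    simp [iteratedFDeriv_zero_eq_comp]
  rw [this, LinearIsometryEquiv.norm_iteratedFDeriv_comp_left]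

/-- Currying isometries identify the nested iterated derivatives in the assumption on f with
derivatives of `dTh`, without changing norms. -/
lemma norm_iteratedFDeriv_iteratedFDeriv_one (i : ℕ) (z : Vec d) (θ : Vec k) :
    ‖iteratedFDeriv ℝ i (fun z' => iteratedFDeriv ℝ 1 (fun θ' => f z' θ') θ) z‖
      = ‖iteratedFDeriv ℝ i (fun z' => dTh f z' θ) z‖ := by
  let J : (Vec k →L[ℝ] Vec d) ≃ₗᵢ[ℝ] ContinuousMultilinearMap ℝ (fun _ : Fin 1 => Vec k) (Vec d) :=
    (continuousMultilinearCurryFin0 ℝ (Vec k) (Vec k →L[ℝ] Vec d)).symm.trans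
      (continuousMultilinearCurryRightEquiv' ℝ 0 (Vec k) (Vec d)).symm
  have : (fun z' => iteratedFDeriv ℝ 1 (fun θ' => f z' θ') θ) = J ∘ fun z' => dTh f z' θ := by
    ext1 z'
    simp [iteratedFDeriv_succ_eq_comp_right, iteratedFDeriv_zero_eq_comp, dTh, J]
  rw [this, LinearIsometryEquiv.norm_iteratedFDeriv_comp_left]

/-- The orders (1,0) and (0,1) are bounds on first derivatives. The orders (2,0), (0,2) and (1,1)
become Lipschitz bounds for them through the mean value inequality. -/
lemma Regular.exists_activationBounds {g y : Vec d → ℝ} {μ : Measure (Vec d)}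
    (h : Regular f g y μ) : ∃ C, ActivationBounds f C := by
  obtain ⟨C₁, hC₁⟩ := h.deriv_bound
  have hf := h.contDiff_f
  set C : ℝ := |C₁| + ‖f 0 0‖ + 1 with hC
  have hC0 : 0 ≤ C := by positivity
  have hle : ∀ a : ℝ, 0 ≤ a → C₁ * a ≤ C * a := fun a ha => by
    gcongr
    linarith [le_abs_self C₁, norm_nonneg (f 0 0)]
  have hdiff1 : ∀ z, Differentiable ℝ (fderiv ℝ (f z)) := fun z =>
    ((contDiff_right hf z).fderiv_right (m := 1) (by norm_num [one_add_one_eq_two])).differentiable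
      one_ne_zero
  have hdiff2 : ∀ θ, Differentiable ℝ (fderiv ℝ (fun z => f z θ)) := fun θ =>
    ((contDiff_left hf θ).fderiv_right (m := 1) (by norm_num [one_add_one_eq_two])).differentiable
      one_ne_zero
  refine ⟨C, hf, by linarith [abs_nonneg C₁, norm_nonneg (f 0 0)],
    by linarith [abs_nonneg C₁], ?_, ?_, ?_, ?_, ?_⟩
  · intro z θ
    have := hC₁ 1 0 (by norm_num) (by norm_num) z θ
    rw [norm_iteratedFDeriv_iteratedFDeriv_zero, norm_iteratedFDeriv_one, pow_one, pow_zero,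
      mul_one] at this
    exact this.trans (hle _ (norm_nonneg _))
  · intro z θ
    have := hC₁ 0 1 (by norm_num) (by norm_num) z θ
    rw [norm_iteratedFDeriv_zero, norm_iteratedFDeriv_one, pow_one, pow_zero, mul_one,
      add_comm] at this
    exact this.trans (hle _ (by positivity))
  · intro z z' θ
    refine convex_univ.norm_image_sub_le_of_norm_fderiv_le (𝕜 := ℝ) (f := fun z => dX f z θ)
      (fun x _ => hdiff2 θ x) (fun x _ => ?_) (mem_univ z') (mem_univ z)
    have := hC₁ 2 0 (by norm_num) (by norm_num) x θ
    rw [norm_iteratedFDeriv_iteratedFDeriv_zero, pow_zero, mul_one, ← norm_fderiv_fderiv_eq] at this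
    exact this.trans (hle _ (by positivity))
  · intro z θ θ'
    refine convex_univ.norm_image_sub_le_of_norm_fderiv_le (𝕜 := ℝ) (f := fun θ => dTh f z θ)
      (fun x _ => hdiff1 z x) (fun x _ => ?_) (mem_univ θ') (mem_univ θ)
    have := hC₁ 0 2 (by norm_num) (by norm_num) z x
    rw [norm_iteratedFDeriv_zero, pow_zero, mul_one, ← norm_fderiv_fderiv_eq, add_comm] at this
    exact this.trans (hle _ (by positivity))
  · intro z z' θ
    -- The bound on the mixed derivative grows with ‖x‖, so the mean value inequality is restricted
    -- to a ball containing both points.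
    have hconv := convex_closedBall (0 : Vec d) (‖z‖ + ‖z'‖)
    refine hconv.norm_image_sub_le_of_norm_fderiv_le (𝕜 := ℝ) (f := fun z => dTh f z θ)
      (fun x _ => ?_) (fun x hx => ?_) (by simp) (by simp)
    · exact ((contDiff_dTh hf).differentiable one_ne_zero).comp
        (differentiable_id.prodMk (differentiable_const θ)) x
    have := hC₁ 1 1 (by norm_num) (by norm_num) x θ
    rw [norm_iteratedFDeriv_iteratedFDeriv_one, norm_iteratedFDeriv_one, pow_one, pow_one,
      mul_assoc] at this
    refine (this.trans (hle _ (by positivity))).trans ?_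
    rw [← mul_assoc]
    rw [mem_closedBall_zero_iff] at hx
    have : ‖x‖ + 1 ≤ 1 + ‖z‖ + ‖z'‖ := by linarith
    gcongr

end

namespace ActivationBounds

variable {f : Vec d → Vec k → Vec d} {C : ℝ} (hf : ActivationBounds f C)
include hf

lemma nonneg : 0 ≤ C := zero_le_one.trans hf.one_le

lemma differentiable_left (θ : Vec k) : Differentiable ℝ (fun z => f z θ) :=
  (contDiff_left hf.contDiff θ).differentiable two_ne_zero

lemma differentiable_right (z : Vec d) : Differentiable ℝ (f z) :=
  (contDiff_right hf.contDiff z).differentiable two_ne_zero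

lemma continuous : Continuous (fun q : Vec d × Vec k => f q.1 q.2) := hf.contDiff.continuous

lemma continuous_dTh : Continuous (fun q : Vec d × Vec k => dTh f q.1 q.2) :=
  (contDiff_dTh hf.contDiff).continuous

lemma sub_left_le (z z' : Vec d) (θ : Vec k) : ‖f z θ - f z' θ‖ ≤ C * ‖θ‖ * ‖z - z'‖ :=
  convex_univ.norm_image_sub_le_of_norm_fderiv_le (𝕜 := ℝ) (f := fun z => f z θ)
    (fun x _ => hf.differentiable_left θ x) (fun x _ => hf.norm_dX_le x θ) (mem_univ z')
    (mem_univ z)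

lemma sub_right_le (z : Vec d) (θ θ' : Vec k) :
    ‖f z θ - f z θ'‖ ≤ C * (1 + ‖z‖) * ‖θ - θ'‖ :=
  convex_univ.norm_image_sub_le_of_norm_fderiv_le (𝕜 := ℝ) (f := f z)
    (fun x _ => hf.differentiable_right z x) (fun x _ => hf.norm_dTh_le z x) (mem_univ θ')
    (mem_univ θ)

lemma norm_le (z : Vec d) (θ : Vec k) : ‖f z θ‖ ≤ C * (1 + ‖θ‖) * (1 + ‖z‖) := by
  have h1 := hf.sub_left_le z 0 0
  have h2 := hf.sub_right_le z θ 0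
  simp only [norm_zero, mul_zero, zero_mul, sub_zero] at h1 h2
  have h3 : f z θ = (f z θ - f z 0) + (f z 0 - f 0 0) + f 0 0 := by abel
  rw [h3]
  refine (norm_add₃_le).trans ?_
  have h4 := hf.norm_zero_le
  have h5 := mul_nonneg hf.nonneg (norm_nonneg z)
  nlinarith

/-- Symmetry of the mixed derivative is not invoked. The second difference of f is estimated by |z'
- z||θ - θ'| through the derivative in θ, and letting z' tend to z reads off the norm of the
derivative in z. The 3 covers 1 + |z'| + |z| for z' in the unit ball around z. -/
lemma dX_sub_right_le (z : Vec d) (θ θ' : Vec k) :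
    ‖dX f z θ - dX f z θ'‖ ≤ 3 * C * (1 + ‖z‖) * (1 + ‖θ‖ + ‖θ'‖) * ‖θ - θ'‖ := by
  have hC := hf.nonneg
  have key : ∀ z' ∈ Metric.ball z 1, ‖(f z' θ - f z' θ') - (f z θ - f z θ')‖
      ≤ 3 * C * (1 + ‖z‖) * (1 + ‖θ‖ + ‖θ'‖) * ‖θ - θ'‖ * ‖z' - z‖ := by
    intro z' hz'
    have hz1 : ‖z'‖ ≤ ‖z‖ + 1 := by
      have h1 : ‖z'‖ ≤ ‖z' - z‖ + ‖z‖ := by simpa using norm_add_le (z' - z) z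
      rw [Metric.mem_ball, dist_eq_norm] at hz'
      linarith
    have h := (convex_closedBall (0 : Vec k) (‖θ‖ + ‖θ'‖)).norm_image_sub_le_of_norm_fderiv_le
      (𝕜 := ℝ) (f := fun θ => f z' θ - f z θ)
      (C := C * (‖θ‖ + ‖θ'‖) * (1 + ‖z'‖ + ‖z‖) * ‖z' - z‖)
      (fun x _ => (hf.differentiable_right z' x).sub (hf.differentiable_right z x))
      (fun x hx => ?_) (x := θ') (y := θ) (by simp) (by simp)
    · have e : (f z' θ - f z' θ') - (f z θ - f z θ')
          = (f z' θ - f z θ) - (f z' θ' - f z θ') := by abel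
      rw [e]
      refine h.trans ?_
      have : (‖θ‖ + ‖θ'‖) * (1 + ‖z'‖ + ‖z‖) ≤ 3 * ((1 + ‖z‖) * (1 + ‖θ‖ + ‖θ'‖)) := by
        nlinarith [norm_nonneg z, norm_nonneg θ, norm_nonneg θ', mul_nonneg (norm_nonneg z)
          (norm_nonneg θ), mul_nonneg (norm_nonneg z) (norm_nonneg θ')]
      calc _ = C * ((‖θ‖ + ‖θ'‖) * (1 + ‖z'‖ + ‖z‖)) * (‖z' - z‖ * ‖θ - θ'‖) := by ring
        _ ≤ C * (3 * ((1 + ‖z‖) * (1 + ‖θ‖ + ‖θ'‖))) * (‖z' - z‖ * ‖θ - θ'‖) := by gcongr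
        _ = _ := by ring
    · rw [fderiv_fun_sub (hf.differentiable_right z' x) (hf.differentiable_right z x)]
      refine (hf.dTh_sub_left_le z' z x).trans ?_
      rw [mem_closedBall_zero_iff] at hx
      gcongr
  have hd : HasFDerivAt (fun z => f z θ - f z θ') (dX f z θ - dX f z θ') z :=
    (hf.differentiable_left θ z).hasFDerivAt.sub (hf.differentiable_left θ' z).hasFDerivAt
  refine hd.le_of_lip' (by positivity) ?_
  filter_upwards [Metric.ball_mem_nhds z one_pos] with z' hz' using key z' hz'

/-- The increment is telescoped through f(z',θ). When θ' - θ is of order 1 + |θ| and z, z' are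
bounded, every error term is at most quadratic in θ, hence integrable against measures in `P2`. -/
lemma taylor_le (z z' : Vec d) (θ θ' : Vec k) :
    ‖f z' θ' - f z θ - dX f z θ (z' - z) - dTh f z θ (θ' - θ)‖
      ≤ C * (1 + ‖z'‖) ^ 2 * ‖θ' - θ‖ ^ 2
        + C * ‖θ‖ * (1 + ‖z'‖ + ‖z‖) * ‖z' - z‖ * ‖θ' - θ‖ + C * ‖θ‖ ^ 2 * ‖z' - z‖ ^ 2 := by
  have hC := hf.nonneg
  have h1 : ‖f z' θ' - f z' θ - dTh f z' θ (θ' - θ)‖ ≤ C * (1 + ‖z'‖) ^ 2 * ‖θ' - θ‖ ^ 2 :=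
    norm_sub_sub_fderiv_le (by positivity) (hf.differentiable_right z')
      (fun x => hf.dTh_sub_le z' x θ) θ'
  have h2 : ‖f z' θ - f z θ - dX f z θ (z' - z)‖ ≤ C * ‖θ‖ ^ 2 * ‖z' - z‖ ^ 2 :=
    norm_sub_sub_fderiv_le (by positivity) (hf.differentiable_left θ)
      (fun x => hf.dX_sub_le x z θ) z'
  have h3 : ‖(dTh f z' θ - dTh f z θ) (θ' - θ)‖
      ≤ C * ‖θ‖ * (1 + ‖z'‖ + ‖z‖) * ‖z' - z‖ * ‖θ' - θ‖ :=
    ((dTh f z' θ - dTh f z θ).le_opNorm _).trans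
      (by gcongr; exact hf.dTh_sub_left_le z' z θ)
  have e : f z' θ' - f z θ - dX f z θ (z' - z) - dTh f z θ (θ' - θ)
      = (f z' θ' - f z' θ - dTh f z' θ (θ' - θ)) + (dTh f z' θ - dTh f z θ) (θ' - θ)
        + (f z' θ - f z θ - dX f z θ (z' - z)) := by
    rw [sub_apply]; abel
  rw [e]
  exact norm_add₃_le.trans (by linarith)

lemma wLip (z : Vec d) : WLip (C * (1 + ‖z‖)) (f z) := fun θ θ' => by
  have hC := hf.nonneg
  refine (hf.sub_right_le z θ θ').trans ?_
  have : 1 ≤ 1 + ‖θ‖ + ‖θ'‖ := by linarith [norm_nonneg θ, norm_nonneg θ']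
  calc _ = C * (1 + ‖z‖) * 1 * ‖θ - θ'‖ := by ring
    _ ≤ _ := by gcongr

lemma wLip_dX (z : Vec d) : WLip (3 * C * (1 + ‖z‖)) (dX f z) := fun θ θ' =>
  hf.dX_sub_right_le z θ θ'

end ActivationBounds

end MeanFieldResNet

namespace MeanFieldResNet

/-! ### The forward and adjoint equations -/

variable {d k : ℕ}

/-- Projection of a real number to a layer time. -/
noncomputable def toI01 (r : ℝ) : I01 := projIcc 0 1 zero_le_one r

lemma continuous_toI01 : Continuous toI01 :=
  continuous_projIcc (h := zero_le_one)

@[simp] lemma toI01_coe (t : I01) : toI01 t = t := projIcc_val _ t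

lemma coe_toI01 {r : ℝ} (hr : r ∈ Icc (0 : ℝ) 1) : (toI01 r : ℝ) = r := by
  rw [toI01, projIcc_of_mem _ hr]

lemma intervalIntegral_toI01 (φ : I01 → ℝ) :
    ∫ r in (0 : ℝ)..1, φ (toI01 r) = ∫ t : I01, φ t := by
  rw [intervalIntegral.integral_of_le zero_le_one, ← integral_Icc_eq_integral_Ioc,
    ← integral_subtype_comap measurableSet_Icc]
  refine integral_congr_ae (ae_of_all _ fun t => ?_)
  simp only [toI01_coe]

/-- The second moment averaged over the layers. -/
noncomputable def meanMoment (ρ : PathP2 k) : ℝ := ∫ t : I01, ∫ θ, ‖θ‖ ^ 2 ∂(ρ t)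

lemma meanMoment_nonneg (ρ : PathP2 k) : 0 ≤ meanMoment ρ :=
  integral_nonneg fun _ => integral_nonneg fun _ => by positivity

lemma PathP2.integrable_moment (ρ : PathP2 k) :
    Integrable fun t : I01 => ∫ θ, ‖θ‖ ^ 2 ∂(ρ t) :=
  ρ.continuous_moment.integrable_of_hasCompactSupport (HasCompactSupport.of_compactSpace _)

lemma meanMoment_le {ρ : PathP2 k} {Λ : ℝ} (hΛ : ∀ t, ∫ θ, ‖θ‖ ^ 2 ∂(ρ t) ≤ Λ) :
    meanMoment ρ ≤ Λ := by
  have : meanMoment ρ ≤ ∫ _ : I01, Λ :=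
    integral_mono ρ.integrable_moment (integrable_const _) hΛ
  simpa using this

/-- The mean-field vector field of the forward equation. -/
noncomputable def drift (f : Vec d → Vec k → Vec d) (ρ : PathP2 k) (t : I01) (z : Vec d) : Vec d :=
  ∫ θ, f z θ ∂(ρ t)

/-- The Jacobian of the mean-field vector field. -/
noncomputable def driftDX (f : Vec d → Vec k → Vec d) (ρ : PathP2 k) (t : I01) (z : Vec d) :
    Vec d →L[ℝ] Vec d :=
  ∫ θ, dX f z θ ∂(ρ t)

namespace ActivationBounds

variable {f : Vec d → Vec k → Vec d} {C : ℝ} (hf : ActivationBounds f C)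
include hf

lemma integrable (z : Vec d) (ρ : P2 k) : Integrable (f z) ρ.law :=
  (hf.wLip z).integrable (mul_nonneg hf.nonneg (by positivity)) ρ

lemma integrable_dX (z : Vec d) (ρ : P2 k) : Integrable (dX f z) ρ.law :=
  (hf.wLip_dX z).integrable (mul_nonneg (mul_nonneg (by norm_num) hf.nonneg) (by positivity)) ρ

lemma norm_drift_le (ρ : PathP2 k) (t : I01) (z : Vec d) :
    ‖drift f ρ t z‖ ≤ C * (2 + ∫ θ, ‖θ‖ ^ 2 ∂(ρ t)) * (1 + ‖z‖) := by
  have hC := hf.nonneg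
  have hi := (ρ.at_time t).integrable_norm
  calc ‖drift f ρ t z‖ ≤ ∫ θ, (C * (1 + ‖z‖)) * (1 + ‖θ‖) ∂(ρ t) :=
        norm_integral_le_of_norm_le (((integrable_const _).add hi).const_mul _)
          (ae_of_all _ fun θ => (hf.norm_le z θ).trans (by rw [mul_right_comm]))
    _ = (C * (1 + ‖z‖)) * (1 + ∫ θ, ‖θ‖ ∂(ρ t)) := by
        rw [integral_const_mul, integral_add (integrable_const _) hi, integral_const,
          probReal_univ, one_smul]
    _ ≤ (C * (1 + ‖z‖)) * (1 + (1 + ∫ θ, ‖θ‖ ^ 2 ∂(ρ t))) := by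
        gcongr
        exact (ρ.at_time t).integral_norm_le
    _ = _ := by ring

lemma drift_sub_le (ρ : PathP2 k) (t : I01) (z z' : Vec d) :
    ‖drift f ρ t z - drift f ρ t z'‖ ≤ C * (1 + ∫ θ, ‖θ‖ ^ 2 ∂(ρ t)) * ‖z - z'‖ := by
  have hC := hf.nonneg
  have hi := (ρ.at_time t).integrable_norm
  rw [drift, drift, ← integral_sub (hf.integrable z (ρ.at_time t))
    (hf.integrable z' (ρ.at_time t))]
  calc _ ≤ ∫ θ, (C * ‖z - z'‖) * ‖θ‖ ∂(ρ t) :=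
        norm_integral_le_of_norm_le (hi.const_mul _)
          (ae_of_all _ fun θ => (hf.sub_left_le z z' θ).trans (by rw [mul_right_comm]))
    _ ≤ (C * ‖z - z'‖) * (1 + ∫ θ, ‖θ‖ ^ 2 ∂(ρ t)) := by
        rw [integral_const_mul]
        gcongr
        exact (ρ.at_time t).integral_norm_le
    _ = _ := by ring

lemma norm_driftDX_le (ρ : PathP2 k) (t : I01) (z : Vec d) :
    ‖driftDX f ρ t z‖ ≤ C * (1 + ∫ θ, ‖θ‖ ^ 2 ∂(ρ t)) := by
  have hC := hf.nonneg
  have hi := (ρ.at_time t).integrable_norm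
  calc _ ≤ ∫ θ, C * ‖θ‖ ∂(ρ t) :=
        norm_integral_le_of_norm_le (hi.const_mul _) (ae_of_all _ fun θ => hf.norm_dX_le z θ)
    _ ≤ _ := by
        rw [integral_const_mul]
        gcongr
        exact (ρ.at_time t).integral_norm_le

lemma driftDX_sub_le (ρ : PathP2 k) (t : I01) (z z' : Vec d) :
    ‖driftDX f ρ t z - driftDX f ρ t z'‖ ≤ C * (∫ θ, ‖θ‖ ^ 2 ∂(ρ t)) * ‖z - z'‖ := by
  have hi := (ρ.at_time t).integrable_norm_sq
  rw [driftDX, driftDX, ← integral_sub (hf.integrable_dX z (ρ.at_time t))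
    (hf.integrable_dX z' (ρ.at_time t))]
  calc _ ≤ ∫ θ, (C * ‖z - z'‖) * ‖θ‖ ^ 2 ∂(ρ t) :=
        norm_integral_le_of_norm_le (hi.const_mul _)
          (ae_of_all _ fun θ => (hf.dX_sub_le z z' θ).trans (by rw [mul_right_comm]))
    _ = _ := by rw [integral_const_mul]; ring

lemma drift_close {ρ ρ' : PathP2 k} {η : ℝ} (h : Close η ρ ρ') (t : I01) (z : Vec d) :
    ‖drift f ρ t z - drift f ρ' t z‖ ≤ C * (1 + ‖z‖) * η :=
  CloseMeas.norm_integral_sub_le (ρ := ρ.at_time t) (σ := ρ'.at_time t)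
    (mul_pos (zero_lt_one.trans_le hf.one_le) (by positivity)) (h t) (hf.wLip z)

lemma driftDX_close {ρ ρ' : PathP2 k} {η : ℝ} (h : Close η ρ ρ') (t : I01) (z : Vec d) :
    ‖driftDX f ρ t z - driftDX f ρ' t z‖ ≤ 3 * C * (1 + ‖z‖) * η :=
  CloseMeas.norm_integral_sub_le (ρ := ρ.at_time t) (σ := ρ'.at_time t)
    (mul_pos (mul_pos (by norm_num) (zero_lt_one.trans_le hf.one_le)) (by positivity)) (h t)
    (hf.wLip_dX z)

lemma continuous_drift (ρ : PathP2 k) (z : Vec d) : Continuous fun t => drift f ρ t z :=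
  ρ.continuous_integral (hf.wLip z)

lemma continuous_driftDX (ρ : PathP2 k) :
    Continuous fun q : I01 × Vec d => driftDX f ρ q.1 q.2 := by
  obtain ⟨Λ, hΛ0, hΛ⟩ := ρ.exists_moment_le
  have hC := hf.nonneg
  refine continuous_prod_of_continuous_lipschitzWith' _ (C * Λ).toNNReal
    (fun t => LipschitzWith.of_dist_le' fun z z' => ?_)
    fun z => ρ.continuous_integral (hf.wLip_dX z)
  rw [dist_eq_norm, dist_eq_norm]
  refine (hf.driftDX_sub_le ρ t z z').trans ?_
  gcongr
  exact hΛ t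

lemma exists_isForward (ρ : PathP2 k) (x : Vec d) : ∃ z, IsForward f ρ x z := by
  obtain ⟨Λ, hΛ0, hΛ⟩ := ρ.exists_moment_le
  have hC := hf.nonneg
  -- Freezing the layer time outside [0,1] extends the field to [0,∞).
  obtain ⟨z, hz0, hz⟩ := exists_solution_Ici_of_lipschitz
    (v := fun s z => drift f ρ (toI01 s) z) x
    (fun z => ((hf.continuous_drift ρ z).comp continuous_toI01).continuousOn)
    (fun T => ⟨(C * (1 + Λ)).toNNReal, fun s _ => LipschitzWith.of_dist_le'
      fun z z' => by
        rw [dist_eq_norm, dist_eq_norm]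
        refine (hf.drift_sub_le ρ _ z z').trans ?_
        gcongr
        exact hΛ _⟩)
  refine ⟨z, hz0, fun t => ?_⟩
  have := (hz t t.2.1).mono (Icc_subset_Ici_self (b := 0) (a := 1))
  rwa [toI01_coe] at this

/-- Existence turns the choice in `Z` into a solution. The later estimates use only the equation, so
they do not depend on which solution was chosen. -/
lemma isForward_Z (ρ : PathP2 k) (x : Vec d) : IsForward f ρ x (Z f ρ x) :=
  Classical.epsilon_spec (hf.exists_isForward ρ x)

lemma Z_zero (ρ : PathP2 k) (x : Vec d) : Z f ρ x 0 = x := (hf.isForward_Z ρ x).1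

lemma hasDerivWithinAt_Z (ρ : PathP2 k) (x : Vec d) {t : ℝ} (ht : t ∈ Icc (0 : ℝ) 1) :
    HasDerivWithinAt (Z f ρ x) (drift f ρ (toI01 t) (Z f ρ x t)) (Icc 0 1) t := by
  have := (hf.isForward_Z ρ x).2 ⟨t, ht⟩
  rwa [show toI01 t = ⟨t, ht⟩ from projIcc_of_mem _ ht]

lemma continuous_Z (ρ : PathP2 k) (x : Vec d) : Continuous fun t : I01 => Z f ρ x t :=
  continuousOn_iff_continuous_domRestrict.1
    fun _ ht => (hf.hasDerivWithinAt_Z ρ x ht).continuousWithinAt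

lemma exists_isAdjoint (g y : Vec d → ℝ) (ρ : PathP2 k) (x : Vec d) :
    ∃ p, IsAdjoint f g y ρ x p := by
  obtain ⟨Λ, hΛ0, hΛ⟩ := ρ.exists_moment_le
  have hC := hf.nonneg
  set A : I01 → Vec d →L[ℝ] Vec d := fun t => driftDX f ρ t (Z f ρ x t) with hA
  have hAc : Continuous A :=
    (hf.continuous_driftDX ρ).comp (continuous_id.prodMk (hf.continuous_Z ρ x))
  -- The substitution s = 1 - t turns the terminal condition into an initial one.
  obtain ⟨q, hq0, hq⟩ := exists_solution_Ici_of_lipschitz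
    (v := fun s q => ContinuousLinearMap.adjoint (A (toI01 (1 - s))) q)
    ((g (Z f ρ x 1) - y x) • gradient g (Z f ρ x 1))
    (fun q => by
      have h1 : Continuous fun s : ℝ => A (toI01 (1 - s)) :=
        hAc.comp (continuous_toI01.comp (by fun_prop))
      have h2 : Continuous fun s : ℝ => ContinuousLinearMap.adjoint (A (toI01 (1 - s))) :=
        ContinuousLinearMap.adjoint.continuous.comp h1
      exact (h2.clm_apply continuous_const).continuousOn)
    (fun T => ⟨(C * (1 + Λ)).toNNReal, fun s _ => LipschitzWith.of_dist_le'
      fun z z' => by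
        rw [dist_eq_norm, dist_eq_norm, ← map_sub]
        refine (ContinuousLinearMap.le_opNorm _ _).trans ?_
        rw [LinearIsometryEquiv.norm_map]
        gcongr
        refine (hf.norm_driftDX_le ρ _ _).trans ?_
        gcongr
        exact hΛ _⟩)
  refine ⟨fun t => q (1 - t), by simpa using hq0, fun t => ?_⟩
  have h1 := hq (1 - t) (by have := t.2.2; simp only [mem_Ici]; linarith)
  have h2 : HasDerivWithinAt (fun r : ℝ => 1 - r) (-1) (Icc 0 1) (t : ℝ) :=
    ((hasDerivAt_id (t : ℝ)).const_sub 1).hasDerivWithinAt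
  have h3 := h1.scomp (t : ℝ) h2 (fun r hr => by
    have := hr.2; simp only [mem_Ici]; linarith)
  have h4 : HasDerivWithinAt (fun r => q (1 - r))
      (-(ContinuousLinearMap.adjoint (A t) (q (1 - t)))) (Icc 0 1) t := by
    simpa [Function.comp_def] using h3
  exact h4

lemma isAdjoint_adj (g y : Vec d → ℝ) (ρ : PathP2 k) (x : Vec d) :
    IsAdjoint f g y ρ x (adj f g y ρ x) :=
  Classical.epsilon_spec (hf.exists_isAdjoint g y ρ x)

lemma adj_one (g y : Vec d → ℝ) (ρ : PathP2 k) (x : Vec d) :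
    adj f g y ρ x 1 = (g (Z f ρ x 1) - y x) • gradient g (Z f ρ x 1) :=
  (hf.isAdjoint_adj g y ρ x).1

lemma hasDerivWithinAt_adj (g y : Vec d → ℝ) (ρ : PathP2 k) (x : Vec d) {t : ℝ}
    (ht : t ∈ Icc (0 : ℝ) 1) :
    HasDerivWithinAt (adj f g y ρ x)
      (-(ContinuousLinearMap.adjoint (driftDX f ρ (toI01 t) (Z f ρ x t)) (adj f g y ρ x t)))
      (Icc 0 1) t := by
  have := (hf.isAdjoint_adj g y ρ x).2 ⟨t, ht⟩
  rwa [show toI01 t = ⟨t, ht⟩ from projIcc_of_mem _ ht]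

lemma continuous_adj (g y : Vec d → ℝ) (ρ : PathP2 k) (x : Vec d) :
    Continuous fun t : I01 => adj f g y ρ x t :=
  continuousOn_iff_continuous_domRestrict.1
    fun _ ht => (hf.hasDerivWithinAt_adj g y ρ x ht).continuousWithinAt

end ActivationBounds

/-- Quantitative regularity of the measuring function. -/
structure ObjectiveBounds (g : Vec d → ℝ) (K : ℝ) : Prop where
  nonneg : 0 ≤ K
  norm_zero_le : |g 0| ≤ K
  sub_le : ∀ a b, |g a - g b| ≤ K * ‖a - b‖
  norm_gradient_le : ∀ a, ‖gradient g a‖ ≤ K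
  gradient_sub_le : ∀ a b, ‖gradient g a - gradient g b‖ ≤ K * ‖a - b‖
  taylor_le : ∀ a b, |g b - g a - inner ℝ (gradient g a) (b - a)| ≤ K * ‖b - a‖ ^ 2

lemma Regular.exists_objectiveBounds {f : Vec d → Vec k → Vec d} {g y : Vec d → ℝ}
    {μ : Measure (Vec d)} (h : Regular f g y μ) : ∃ K, ObjectiveBounds g K := by
  obtain ⟨K₁, hK₁⟩ := h.lipschitz_g
  obtain ⟨K₂, hK₂⟩ := h.lipschitz_grad_g
  have hd : Differentiable ℝ g := h.contDiff_g.differentiable two_ne_zero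
  have e : ∀ a v, inner ℝ (gradient g a) v = fderiv ℝ g a v := fun a v => by
    rw [gradient, InnerProductSpace.toDual_symm_apply]
  have hK1 : (K₁ : ℝ) ≤ K₁ + K₂ + |g 0| := by
    have := K₂.2; have := abs_nonneg (g 0); linarith [K₂.coe_nonneg]
  have hK2 : (K₂ : ℝ) ≤ K₁ + K₂ + |g 0| := by
    have := abs_nonneg (g 0); linarith [K₁.coe_nonneg]
  have hn : ∀ a b, ‖fderiv ℝ g a - fderiv ℝ g b‖ = ‖gradient g a - gradient g b‖ := fun a b => by
    rw [gradient, gradient, ← map_sub, LinearIsometryEquiv.norm_map]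
  have hg2 : ∀ a b, ‖gradient g a - gradient g b‖ ≤ K₂ * ‖a - b‖ := fun a b => by
    simpa [dist_eq_norm] using hK₂.dist_le_mul a b
  refine ⟨K₁ + K₂ + |g 0|, by positivity, by linarith [K₁.coe_nonneg, K₂.coe_nonneg],
    fun a b => ?_, fun a => ?_, fun a b => ?_, fun a b => ?_⟩
  · have : |g a - g b| ≤ K₁ * ‖a - b‖ := by
      simpa [dist_eq_norm, Real.dist_eq] using hK₁.dist_le_mul a b
    exact this.trans (by gcongr)
  · rw [gradient, LinearIsometryEquiv.norm_map]
    exact (norm_fderiv_le_of_lipschitz ℝ hK₁).trans hK1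
  · exact (hg2 a b).trans (by gcongr)
  · rw [e, ← Real.norm_eq_abs]
    refine (norm_sub_sub_fderiv_le K₂.coe_nonneg hd (fun z => ?_) b).trans (by gcongr)
    rw [hn]
    exact hg2 z a

end MeanFieldResNet

namespace MeanFieldResNet

/-! ### Bounds and stability for the forward and adjoint equations -/

namespace ActivationBounds

variable {d k : ℕ} {f : Vec d → Vec k → Vec d} {g y : Vec d → ℝ} {C K : ℝ}

/-- The Grönwall rate at layer t is C(2 + ∫|θ|² dρ(·,t)), and its integral over the layers involves
the mean moment alone. -/
lemma norm_Z_le (hf : ActivationBounds f C) {Q : ℝ} {ρ : PathP2 k} (hQ : meanMoment ρ ≤ Q)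
    (x : Vec d) {t : ℝ} (ht : t ∈ Icc (0 : ℝ) 1) :
    ‖Z f ρ x t‖ ≤ (1 + ‖x‖) * Real.exp (3 * (C * (2 + Q))) := by
  have hC := hf.nonneg
  have hm0 : ∀ t, 0 ≤ ∫ θ, ‖θ‖ ^ 2 ∂(ρ t) := fun t => integral_nonneg fun _ => by positivity
  set a : I01 → ℝ := fun t => C * (2 + ∫ θ, ‖θ‖ ^ 2 ∂(ρ t)) with ha
  have hac : Continuous a := continuous_const.mul (continuous_const.add ρ.continuous_moment)
  have h := norm_le_of_gronwall (a := fun r => a (toI01 r)) (ε := 1)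
    (hac.comp continuous_toI01)
    (fun r => mul_nonneg hC (add_nonneg zero_le_two (hm0 _))) zero_le_one
    (fun t ht => hf.hasDerivWithinAt_Z ρ x ht) (fun t _ => hf.norm_drift_le ρ _ _) ht
    (left_mem_Icc.2 zero_le_one)
  rw [intervalIntegral_toI01 a, hf.Z_zero] at h
  refine h.trans ?_
  have e : ∫ t, a t = C * (2 + meanMoment ρ) := by
    rw [ha, integral_const_mul, integral_add (integrable_const _) ρ.integrable_moment, meanMoment]
    simp
  rw [e]
  gcongr

lemma norm_adj_le (hf : ActivationBounds f C) {Q : ℝ} {ρ : PathP2 k} (hQ : meanMoment ρ ≤ Q)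
    (x : Vec d) {t : ℝ} (ht : t ∈ Icc (0 : ℝ) 1) :
    ‖adj f g y ρ x t‖ ≤ ‖adj f g y ρ x 1‖ * Real.exp (3 * (C * (2 + Q))) := by
  have hC := hf.nonneg
  have hm0 : ∀ t, 0 ≤ ∫ θ, ‖θ‖ ^ 2 ∂(ρ t) := fun t => integral_nonneg fun _ => by positivity
  set a : I01 → ℝ := fun t => C * (2 + ∫ θ, ‖θ‖ ^ 2 ∂(ρ t)) with ha
  have hac : Continuous a := continuous_const.mul (continuous_const.add ρ.continuous_moment)
  have h := norm_le_of_gronwall (a := fun r => a (toI01 r)) (ε := 0)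
    (hac.comp continuous_toI01)
    (fun r => mul_nonneg hC (add_nonneg zero_le_two (hm0 _))) le_rfl
    (fun t ht => hf.hasDerivWithinAt_adj g y ρ x ht) (fun t _ => ?_) ht
    (right_mem_Icc.2 zero_le_one)
  · rw [intervalIntegral_toI01 a, zero_add] at h
    refine h.trans ?_
    have e : ∫ t, a t = C * (2 + meanMoment ρ) := by
      rw [ha, integral_const_mul, integral_add (integrable_const _) ρ.integrable_moment,
        meanMoment]
      simp
    rw [e]
    gcongr
  · rw [norm_neg, zero_add]
    refine (ContinuousLinearMap.le_opNorm _ _).trans ?_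
    rw [LinearIsometryEquiv.norm_map]
    refine mul_le_mul_of_nonneg_right ?_ (norm_nonneg _)
    refine (hf.norm_driftDX_le ρ _ _).trans ?_
    change _ ≤ C * (2 + ∫ θ, ‖θ‖ ^ 2 ∂(ρ _))
    exact mul_le_mul_of_nonneg_left (by linarith) hC

/-- Uniform bounds for the forward and adjoint variables on balls of inputs. -/
lemma exists_bound (hf : ActivationBounds f C) (hg : ObjectiveBounds g K)
    (hy : ∀ R : ℝ, ∃ Y : ℝ, ∀ x, ‖x‖ ≤ R → |y x| ≤ Y) (r Q : ℝ) :
    ∃ B, 0 ≤ B ∧ ∀ ρ : PathP2 k, meanMoment ρ ≤ Q → ∀ x, ‖x‖ ≤ r → ∀ t ∈ Icc (0 : ℝ) 1,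
      ‖Z f ρ x t‖ ≤ B ∧ ‖adj f g y ρ x t‖ ≤ B ∧ |g (Z f ρ x 1) - y x| ≤ B := by
  obtain ⟨Y, hY⟩ := hy r
  set e := Real.exp (3 * (C * (2 + Q)))
  set A := (1 + |r|) * e
  have hA : 0 ≤ A := by positivity
  set D := K + K * A + |Y|
  have hK := hg.nonneg
  have hD : 0 ≤ D := by positivity
  refine ⟨A + D + D * K * e, by positivity, fun ρ hQ x hx t ht => ?_⟩
  have hZ : ∀ t ∈ Icc (0 : ℝ) 1, ‖Z f ρ x t‖ ≤ A := fun t ht => by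
    refine (hf.norm_Z_le hQ x ht).trans ?_
    have := hx.trans (le_abs_self r)
    exact mul_le_mul_of_nonneg_right (by linarith) (Real.exp_pos _).le
  have h1 : |g (Z f ρ x 1) - y x| ≤ D := by
    have h2 := hg.sub_le (Z f ρ x 1) 0
    have h3 := hZ 1 (right_mem_Icc.2 zero_le_one)
    rw [sub_zero] at h2
    have h4 : K * ‖Z f ρ x 1‖ ≤ K * A := by gcongr
    have h5 := hg.norm_zero_le
    have h6 := (hY x hx).trans (le_abs_self Y)
    have e : g (Z f ρ x 1) - y x = (g (Z f ρ x 1) - g 0) + g 0 + - y x := by ring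
    rw [e]
    refine (abs_add_three _ _ _).trans ?_
    rw [abs_neg]
    linarith
  have hDKe : 0 ≤ D * K * e := by positivity
  refine ⟨(hZ t ht).trans (by linarith), ?_, h1.trans (by linarith)⟩
  refine (hf.norm_adj_le hQ x ht).trans ?_
  have : ‖adj f g y ρ x 1‖ ≤ D * K := by
    rw [hf.adj_one, norm_smul, Real.norm_eq_abs]
    gcongr
    exact hg.norm_gradient_le _
  calc _ ≤ D * K * e := by gcongr
    _ ≤ _ := by linarith

/-- Stability of the forward and adjoint variables. -/
lemma exists_stability (hf : ActivationBounds f C) (hg : ObjectiveBounds g K)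
    (hy : ∀ R : ℝ, ∃ Y : ℝ, ∀ x, ‖x‖ ≤ R → |y x| ≤ Y) (r : ℝ) {Λ : ℝ} (hΛ0 : 0 ≤ Λ) :
    ∃ L, 0 ≤ L ∧ ∀ ρ ρ' : PathP2 k, (∀ t, ∫ θ, ‖θ‖ ^ 2 ∂(ρ t) ≤ Λ) →
      (∀ t, ∫ θ, ‖θ‖ ^ 2 ∂(ρ' t) ≤ Λ) → ∀ η, Close η ρ ρ' → ∀ x x', ‖x‖ ≤ r → ‖x'‖ ≤ r →
      ∀ t ∈ Icc (0 : ℝ) 1, ‖Z f ρ x t - Z f ρ' x' t‖ ≤ L * (η + ‖x - x'‖) ∧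
        ‖adj f g y ρ x t - adj f g y ρ' x' t‖ ≤ L * (η + ‖x - x'‖ + |y x - y x'|) := by
  obtain ⟨B, hB0, hB⟩ := hf.exists_bound hg hy r Λ
  have hC := hf.nonneg
  have hK := hg.nonneg
  -- The constants a₁ and L₁ are rate and stability constant of the forward equation, K₁ bounds the
  -- change of the Jacobian along the two trajectories, and a₂ and L₂ play the same roles for the
  -- adjoint equation, which is compared starting from t = 1. The labels enter through the terminal
  -- value only.
  set a₁ := C * (1 + Λ) + C * (1 + B)
  set L₁ := Real.exp (3 * a₁)
  set K₁ := C * Λ * L₁ + 3 * C * (1 + B)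
  set a₂ := C * (1 + Λ) + K₁ * B
  set L₂ := (1 + (K * L₁ + 1) * K + B * (K * L₁)) * Real.exp (3 * a₂)
  refine ⟨L₁ + L₂, by positivity, fun ρ ρ' hρ hρ' η hη x x' hx hx' => ?_⟩
  have hη0 : 0 ≤ η := (hη 0).nonneg
  have hb := hB ρ (meanMoment_le hρ) x hx
  have hb' := hB ρ' (meanMoment_le hρ') x' hx'
  have hZ : ∀ t ∈ Icc (0 : ℝ) 1, ‖Z f ρ x t - Z f ρ' x' t‖ ≤ L₁ * (η + ‖x - x'‖) := by
    intro t ht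
    have h := norm_le_of_gronwall_const (a := a₁) (ε := η) (by positivity) hη0
      (fun t ht => (hf.hasDerivWithinAt_Z ρ x ht).sub (hf.hasDerivWithinAt_Z ρ' x' ht))
      (fun t ht => ?_) ht (left_mem_Icc.2 zero_le_one)
    · simp only [Pi.sub_apply, hf.Z_zero] at h
      rwa [mul_comm]
    · simp only [Pi.sub_apply]
      set z := Z f ρ x t
      set z' := Z f ρ' x' t
      have h1 : ‖drift f ρ (toI01 t) z - drift f ρ (toI01 t) z'‖ ≤ C * (1 + Λ) * ‖z - z'‖ := by
        refine (hf.drift_sub_le ρ _ _ _).trans ?_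
        gcongr
        exact hρ _
      have h2 : ‖drift f ρ (toI01 t) z' - drift f ρ' (toI01 t) z'‖ ≤ C * (1 + B) * η := by
        refine (hf.drift_close hη _ _).trans ?_
        gcongr
        exact (hb' t ht).1
      calc _ ≤ ‖drift f ρ (toI01 t) z - drift f ρ (toI01 t) z'‖
            + ‖drift f ρ (toI01 t) z' - drift f ρ' (toI01 t) z'‖ := norm_sub_le_norm_sub_add_norm_sub _ _ _
        _ ≤ C * (1 + Λ) * ‖z - z'‖ + C * (1 + B) * η := add_le_add h1 h2
        _ ≤ a₁ * (η + ‖z - z'‖) := by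
            have : 0 ≤ C * (1 + Λ) * η := by positivity
            have : 0 ≤ C * (1 + B) * ‖z - z'‖ := by positivity
            simp only [a₁]
            linarith
  intro t ht
  set ε := η + ‖x - x'‖ with hε
  have hε0 : 0 ≤ ε := by positivity
  refine ⟨(hZ t ht).trans ?_, ?_⟩
  · gcongr
    have : 0 ≤ L₂ := by positivity
    linarith
  have h := norm_le_of_gronwall_const (a := a₂) (ε := ε) (by positivity) hε0
    (fun t ht => (hf.hasDerivWithinAt_adj g y ρ x ht).sub (hf.hasDerivWithinAt_adj g y ρ' x' ht))
    (fun t ht => ?_) ht (right_mem_Icc.2 zero_le_one)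
  · simp only [Pi.sub_apply] at h
    refine h.trans ?_
    have h1 := hZ 1 (right_mem_Icc.2 zero_le_one)
    have h2 : ‖adj f g y ρ x 1 - adj f g y ρ' x' 1‖
        ≤ (K * (L₁ * ε) + |y x - y x'|) * K + B * (K * (L₁ * ε)) := by
      rw [hf.adj_one, hf.adj_one]
      set c := g (Z f ρ x 1) - y x
      set c' := g (Z f ρ' x' 1) - y x'
      set v := gradient g (Z f ρ x 1)
      set v' := gradient g (Z f ρ' x' 1)
      have e : c • v - c' • v' = (c - c') • v + c' • (v - v') := by
        simp only [sub_smul, smul_sub]; abel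
      rw [e]
      refine (norm_add_le _ _).trans ?_
      rw [norm_smul, norm_smul, Real.norm_eq_abs, Real.norm_eq_abs]
      have h3 : |c - c'| ≤ K * (L₁ * ε) + |y x - y x'| := by
        have e : c - c' = (g (Z f ρ x 1) - g (Z f ρ' x' 1)) - (y x - y x') := by
          simp only [c, c']; ring
        rw [e]
        refine (abs_sub _ _).trans ?_
        gcongr
        exact (hg.sub_le _ _).trans (by gcongr)
      have h4 : ‖v - v'‖ ≤ K * (L₁ * ε) := (hg.gradient_sub_le _ _).trans (by gcongr)
      have h5 : |c'| ≤ B := (hb' 1 (right_mem_Icc.2 zero_le_one)).2.2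
      have h6 := hg.norm_gradient_le (Z f ρ x 1)
      gcongr
    set δ := |y x - y x'|
    have hδ : 0 ≤ δ := abs_nonneg _
    have h7 : ε + ‖adj f g y ρ x 1 - adj f g y ρ' x' 1‖
        ≤ (1 + (K * L₁ + 1) * K + B * (K * L₁)) * (ε + δ) := by
      have : 0 ≤ K * L₁ * K * δ := by positivity
      have : 0 ≤ K * ε := by positivity
      have : 0 ≤ B * (K * L₁) * δ := by positivity
      nlinarith
    calc _ ≤ (1 + (K * L₁ + 1) * K + B * (K * L₁)) * (ε + δ) * Real.exp (3 * a₂) := by gcongr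
      _ = L₂ * (ε + δ) := by simp only [L₂]; ring
      _ ≤ (L₁ + L₂) * (ε + δ) := by
          gcongr
          have : 0 ≤ L₁ := by positivity
          linarith
  · simp only [Pi.sub_apply]
    set A := driftDX f ρ (toI01 t) (Z f ρ x t)
    set A' := driftDX f ρ' (toI01 t) (Z f ρ' x' t)
    set p := adj f g y ρ x t
    set p' := adj f g y ρ' x' t
    have hA : ‖A‖ ≤ C * (1 + Λ) := by
      refine (hf.norm_driftDX_le ρ _ _).trans ?_
      gcongr
      exact hρ _
    have hAA : ‖A - A'‖ ≤ K₁ * ε := by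
      have h1 : ‖driftDX f ρ (toI01 t) (Z f ρ x t) - driftDX f ρ (toI01 t) (Z f ρ' x' t)‖
          ≤ C * Λ * (L₁ * ε) := by
        refine (hf.driftDX_sub_le ρ _ _ _).trans ?_
        gcongr
        · exact hρ _
        · exact hZ t ht
      have h2 : ‖driftDX f ρ (toI01 t) (Z f ρ' x' t) - driftDX f ρ' (toI01 t) (Z f ρ' x' t)‖
          ≤ 3 * C * (1 + B) * ε := by
        refine (hf.driftDX_close hη _ _).trans ?_
        gcongr
        · exact (hb' t ht).1
        · simp [hε]
      calc _ ≤ _ := norm_sub_le_norm_sub_add_norm_sub _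
              (driftDX f ρ (toI01 t) (Z f ρ' x' t)) _
        _ ≤ C * Λ * (L₁ * ε) + 3 * C * (1 + B) * ε := add_le_add h1 h2
        _ = K₁ * ε := by simp only [K₁]; ring
    have e : -(ContinuousLinearMap.adjoint A p) - -(ContinuousLinearMap.adjoint A' p')
        = -(ContinuousLinearMap.adjoint A (p - p')) - ContinuousLinearMap.adjoint (A - A') p' := by
      simp only [map_sub, sub_apply]; abel
    rw [e]
    refine (norm_sub_le _ _).trans ?_
    rw [norm_neg]
    have h1 : ‖ContinuousLinearMap.adjoint A (p - p')‖ ≤ C * (1 + Λ) * ‖p - p'‖ := by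
      refine (ContinuousLinearMap.le_opNorm _ _).trans ?_
      rw [LinearIsometryEquiv.norm_map]
      gcongr
    have h2 : ‖ContinuousLinearMap.adjoint (A - A') p'‖ ≤ K₁ * ε * B := by
      refine (ContinuousLinearMap.le_opNorm _ _).trans ?_
      rw [LinearIsometryEquiv.norm_map]
      gcongr
      exact (hb' t ht).2.1
    have : 0 ≤ C * (1 + Λ) * ε := by positivity
    have : 0 ≤ K₁ * B * ‖p - p'‖ := by positivity
    simp only [a₂]
    linarith

/-- Stability with equal measures and η = 0 controls the dependence on x uniformly in t; continuity
in t for fixed x completes joint continuity. -/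
lemma continuous_Z_adj (hf : ActivationBounds f C) (hg : ObjectiveBounds g K)
    (hy : ∀ R : ℝ, ∃ Y : ℝ, ∀ x, ‖x‖ ≤ R → |y x| ≤ Y) (hyc : Continuous y) (ρ : PathP2 k) :
    Continuous (fun q : Vec d × I01 => Z f ρ q.1 q.2) ∧
      Continuous (fun q : Vec d × I01 => adj f g y ρ q.1 q.2) := by
  obtain ⟨Λ, hΛ0, hΛ⟩ := ρ.exists_moment_le
  have key : ∀ u : Vec d → I01 → Vec d, (∀ x, Continuous (u x)) →
      (∀ r, ∃ L : ℝ, ∀ x x', ‖x‖ ≤ r → ‖x'‖ ≤ r → ∀ t,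
        ‖u x t - u x' t‖ ≤ L * (‖x - x'‖ + |y x - y x'|)) →
      Continuous fun q : Vec d × I01 => u q.1 q.2 := by
    intro u hut hux
    rw [continuous_iff_continuousAt]
    rintro ⟨x₀, t₀⟩
    obtain ⟨L, hL⟩ := hux (‖x₀‖ + 1)
    rw [ContinuousAt, tendsto_iff_norm_sub_tendsto_zero]
    have h1 : Tendsto (fun q : Vec d × I01 => L * (‖q.1 - x₀‖ + |y q.1 - y x₀|)
        + ‖u x₀ q.2 - u x₀ t₀‖) (𝓝 (x₀, t₀)) (𝓝 0) := by
      have hc : Continuous (fun q : Vec d × I01 => L * (‖q.1 - x₀‖ + |y q.1 - y x₀|)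
        + ‖u x₀ q.2 - u x₀ t₀‖) := by
        have := hut x₀
        fun_prop
      simpa using hc.tendsto (x₀, t₀)
    refine squeeze_zero' (Eventually.of_forall fun _ => norm_nonneg _) ?_ h1
    have h2 : ∀ᶠ q : Vec d × I01 in 𝓝 (x₀, t₀), ‖q.1‖ < ‖x₀‖ + 1 :=
      (continuous_fst.norm.tendsto (x₀, t₀)).eventually (gt_mem_nhds (by simp))
    filter_upwards [h2] with q hq
    calc ‖u q.1 q.2 - u x₀ t₀‖ ≤ ‖u q.1 q.2 - u x₀ q.2‖ + ‖u x₀ q.2 - u x₀ t₀‖ :=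
          norm_sub_le_norm_sub_add_norm_sub _ _ _
      _ ≤ _ := by
          gcongr
          exact hL _ _ hq.le (by linarith) _
  have hst := fun r => hf.exists_stability hg hy r hΛ0 (k := k)
  have hself : Close 0 ρ ρ := fun t => closeMeas_self _
  refine ⟨key (fun x t => Z f ρ x t) (hf.continuous_Z ρ) fun r => ?_,
    key (fun x t => adj f g y ρ x t) (hf.continuous_adj g y ρ) fun r => ?_⟩
  · obtain ⟨L, hL0, hL⟩ := hst r
    refine ⟨L, fun x x' hx hx' t => ((hL ρ ρ hΛ hΛ 0 hself x x' hx hx' t t.2).1).trans ?_⟩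
    rw [zero_add]
    gcongr
    linarith [abs_nonneg (y x - y x')]
  · obtain ⟨L, hL0, hL⟩ := hst r
    refine ⟨L, fun x x' hx hx' t => ((hL ρ ρ hΛ hΛ 0 hself x x' hx hx' t t.2).2).trans ?_⟩
    rw [zero_add]

end ActivationBounds
end MeanFieldResNet

namespace MeanFieldResNet

/-! ### The gradient of the first variation of the cost -/

/-- A quadratic bound on the remainder gives differentiability. -/
lemma hasFDerivAt_of_quadratic_bound {E F : Type*} [NormedAddCommGroup E] [NormedSpace ℝ E]
    [NormedAddCommGroup F] [NormedSpace ℝ F] {u : E → F} {A : E →L[ℝ] F} {x : E} {M : ℝ}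
    (h : ∀ᶠ z in 𝓝 x, ‖u z - u x - A (z - x)‖ ≤ M * ‖z - x‖ ^ 2) : HasFDerivAt u A x := by
  refine HasFDerivAt.of_isLittleO ?_
  have h1 : (fun z => u z - u x - A (z - x)) =O[𝓝 x] fun z => ‖z - x‖ ^ 2 :=
    Asymptotics.IsBigO.of_bound M (h.mono fun z hz => by simpa using hz)
  have h2 : (fun z : E => ‖z - x‖ ^ 2) =o[𝓝 x] fun z => z - x := by
    have h3 : (fun z : E => ‖z - x‖) =o[𝓝 x] fun _ => (1 : ℝ) := by
      rw [Asymptotics.isLittleO_one_iff]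
      have : Continuous fun z : E => ‖z - x‖ := by fun_prop
      simpa using this.tendsto x
    have h4 := h3.mul_isBigO (Asymptotics.isBigO_refl (fun z : E => ‖z - x‖) (𝓝 x))
    simp only [one_mul] at h4
    refine (h4.congr_left fun z => (sq _).symm).trans_isBigO ?_
    exact (Asymptotics.isBigO_refl _ _).norm_left
  exact h1.trans_isLittleO h2

variable {d k : ℕ}

/-- The standing assumptions in quantitative form. -/
structure Setting (f : Vec d → Vec k → Vec d) (g y : Vec d → ℝ) (μ : Measure (Vec d))
    (C K R : ℝ) : Prop where
  act : ActivationBounds f C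
  obj : ObjectiveBounds g K
  label_bdd : ∀ R : ℝ, ∃ Y : ℝ, ∀ x, ‖x‖ ≤ R → |y x| ≤ Y
  label_cont : Continuous y
  supp : ∀ᵐ x ∂μ, ‖x‖ ≤ R

lemma Regular.exists_setting {f : Vec d → Vec k → Vec d} {g y : Vec d → ℝ}
    {μ : Measure (Vec d)} (h : Regular f g y μ) : ∃ C K R, Setting f g y μ C K R := by
  obtain ⟨C, hC⟩ := h.exists_activationBounds
  obtain ⟨K, hK⟩ := h.exists_objectiveBounds
  obtain ⟨R, -, hR⟩ := h.compact_support
  refine ⟨C, K, R, hC, hK, h.locally_bounded_y, h.contDiff_y.continuous, ?_⟩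
  rw [ae_iff]
  refine measure_mono_null (fun x hx => ?_) hR
  simp only [mem_ofPred_eq, not_le] at hx ⊢
  exact hx.le

/-- The gradient in `θ` of the first variation of the cost. -/
noncomputable def costGrad (f : Vec d → Vec k → Vec d) (g y : Vec d → ℝ) (μ : Measure (Vec d))
    (ρ : PathP2 k) (t : I01) (θ : Vec k) : Vec k :=
  ∫ x, ContinuousLinearMap.adjoint (dTh f (Z f ρ x t) θ) (adj f g y ρ x t) ∂μ

namespace Setting

variable {f : Vec d → Vec k → Vec d} {g y : Vec d → ℝ} {μ : Measure (Vec d)}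
  {C K R : ℝ} (h : Setting f g y μ C K R)
include h

lemma continuous_Z (ρ : PathP2 k) : Continuous (fun q : Vec d × I01 => Z f ρ q.1 q.2) :=
  (h.act.continuous_Z_adj h.obj h.label_bdd h.label_cont ρ).1

lemma continuous_adj (ρ : PathP2 k) : Continuous (fun q : Vec d × I01 => adj f g y ρ q.1 q.2) :=
  (h.act.continuous_Z_adj h.obj h.label_bdd h.label_cont ρ).2

lemma continuous_dTh_Z (ρ : PathP2 k) :
    Continuous fun q : Vec d × I01 × Vec k => dTh f (Z f ρ q.1 q.2.1) q.2.2 :=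
  h.act.continuous_dTh.comp (((h.continuous_Z ρ).comp
    (continuous_fst.prodMk (continuous_fst.comp continuous_snd))).prodMk
      (continuous_snd.comp continuous_snd))

lemma continuous_integrand (ρ : PathP2 k) :
    Continuous fun q : Vec d × I01 × Vec k =>
      ContinuousLinearMap.adjoint (dTh f (Z f ρ q.1 q.2.1) q.2.2) (adj f g y ρ q.1 q.2.1) := by
  have h1 := h.continuous_dTh_Z ρ
  have h2 : Continuous fun q : Vec d × I01 × Vec k => adj f g y ρ q.1 q.2.1 :=
    (h.continuous_adj ρ).comp (continuous_fst.prodMk (continuous_fst.comp continuous_snd))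
  exact (ContinuousLinearMap.adjoint.continuous.comp h1).clm_apply h2

/-- A bound for the forward and adjoint variables on the support of the input distribution. -/
lemma exists_bound (Q : ℝ) :
    ∃ B, 0 ≤ B ∧ ∀ ρ : PathP2 k, meanMoment ρ ≤ Q → ∀ x, ‖x‖ ≤ R → ∀ t : I01,
      ‖Z f ρ x t‖ ≤ B ∧ ‖adj f g y ρ x t‖ ≤ B ∧ |g (Z f ρ x 1) - y x| ≤ B := by
  obtain ⟨B, hB0, hB⟩ := h.act.exists_bound h.obj h.label_bdd R Q (k := k)
  exact ⟨B, hB0, fun ρ hρ x hx t => hB ρ hρ x hx t t.2⟩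

lemma norm_integrand_le {B : ℝ} {z p : Vec d} (hz : ‖z‖ ≤ B) (hp : ‖p‖ ≤ B) (θ : Vec k) :
    ‖ContinuousLinearMap.adjoint (dTh f z θ) p‖ ≤ C * (1 + B) * B := by
  have hC := h.act.nonneg
  have hB : 0 ≤ B := (norm_nonneg _).trans hz
  refine (ContinuousLinearMap.le_opNorm _ _).trans ?_
  rw [LinearIsometryEquiv.norm_map]
  gcongr
  exact (h.act.norm_dTh_le z θ).trans (by gcongr)

variable [IsProbabilityMeasure μ]

lemma integrable_integrand (ρ : PathP2 k) (t : I01) (θ : Vec k) :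
    Integrable (fun x => ContinuousLinearMap.adjoint (dTh f (Z f ρ x t) θ) (adj f g y ρ x t)) μ := by
  obtain ⟨B, hB0, hB⟩ := h.exists_bound (meanMoment ρ) (k := k)
  refine (integrable_const (C * (1 + B) * B)).mono'
    ((h.continuous_integrand ρ).comp (by fun_prop : Continuous fun x => (x, t, θ))).aestronglyMeasurable ?_
  filter_upwards [h.supp] with x hx
  have := hB ρ le_rfl x hx t
  exact h.norm_integrand_le this.1 this.2.1 θ

/-- The bound is uniform in θ because ∂_θ f and its θ-derivative are bounded in θ, with constants
depending on z. The mean moment suffices to control Z and p, and the a priori estimate relies on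
this. -/
lemma exists_costGrad_bound (Q : ℝ) :
    ∃ B, 0 ≤ B ∧ ∀ ρ : PathP2 k, meanMoment ρ ≤ Q → ∀ t θ,
      ‖costGrad f g y μ ρ t θ‖ ≤ B ∧
      ∀ θ', ‖costGrad f g y μ ρ t θ - costGrad f g y μ ρ t θ'‖ ≤ B * ‖θ - θ'‖ := by
  obtain ⟨B, hB0, hB⟩ := h.exists_bound Q (k := k)
  have hC := h.act.nonneg
  refine ⟨C * (1 + B) * B + C * (1 + B) ^ 2 * B, by positivity, fun ρ hρ t θ => ⟨?_, fun θ' => ?_⟩⟩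
  · refine (norm_integral_le_of_norm_le_const (C := C * (1 + B) * B) ?_).trans ?_
    · filter_upwards [h.supp] with x hx
      have := hB ρ hρ x hx t
      exact h.norm_integrand_le this.1 this.2.1 θ
    · rw [probReal_univ, mul_one]
      have : 0 ≤ C * (1 + B) ^ 2 * B := by positivity
      linarith
  · rw [costGrad, costGrad, ← integral_sub (h.integrable_integrand ρ t θ)
      (h.integrable_integrand ρ t θ')]
    refine (norm_integral_le_of_norm_le_const (C := C * (1 + B) ^ 2 * B * ‖θ - θ'‖) ?_).trans ?_
    · filter_upwards [h.supp] with x hx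
      have := hB ρ hρ x hx t
      rw [← sub_apply, ← map_sub]
      refine (ContinuousLinearMap.le_opNorm _ _).trans ?_
      rw [LinearIsometryEquiv.norm_map, mul_right_comm]
      gcongr
      · refine (h.act.dTh_sub_le _ _ _).trans ?_
        gcongr
        exact this.1
      · exact this.2.1
    · rw [probReal_univ, mul_one]
      gcongr
      have : 0 ≤ C * (1 + B) * B := by positivity
      linarith

/-- The factor 1 + |θ| comes from the mixed derivative of f, which grows linearly in θ. It is
absorbed by the weight of the displacements. -/
lemma exists_costGrad_stability {Λ : ℝ} (hΛ0 : 0 ≤ Λ) :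
    ∃ L, 0 ≤ L ∧ ∀ ρ ρ' : PathP2 k, (∀ t, ∫ θ, ‖θ‖ ^ 2 ∂(ρ t) ≤ Λ) →
      (∀ t, ∫ θ, ‖θ‖ ^ 2 ∂(ρ' t) ≤ Λ) → ∀ η, Close η ρ ρ' → ∀ t θ,
      ‖costGrad f g y μ ρ t θ - costGrad f g y μ ρ' t θ‖ ≤ L * η * (1 + ‖θ‖) := by
  obtain ⟨B, hB0, hB⟩ := h.exists_bound Λ (k := k)
  obtain ⟨L, hL0, hL⟩ := h.act.exists_stability h.obj h.label_bdd R hΛ0 (k := k)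
  have hC := h.act.nonneg
  refine ⟨C * (1 + B + B) * L * B + C * (1 + B) * L, by positivity,
    fun ρ ρ' hρ hρ' η hη t θ => ?_⟩
  have hη0 : 0 ≤ η := (hη 0).nonneg
  rw [costGrad, costGrad, ← integral_sub (h.integrable_integrand ρ t θ)
    (h.integrable_integrand ρ' t θ)]
  refine (norm_integral_le_of_norm_le_const
    (C := (C * (1 + B + B) * L * B + C * (1 + B) * L) * η * (1 + ‖θ‖)) ?_).trans ?_
  swap
  · rw [probReal_univ, mul_one]
  filter_upwards [h.supp] with x hx
  have hb := hB ρ (meanMoment_le hρ) x hx t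
  have hb' := hB ρ' (meanMoment_le hρ') x hx t
  have hst := hL ρ ρ' hρ hρ' η hη x x hx hx t t.2
  simp only [sub_self, norm_zero, abs_zero, add_zero] at hst
  set z := Z f ρ x t
  set z' := Z f ρ' x t
  set p := adj f g y ρ x t
  set p' := adj f g y ρ' x t
  have e : ContinuousLinearMap.adjoint (dTh f z θ) p - ContinuousLinearMap.adjoint (dTh f z' θ) p'
      = ContinuousLinearMap.adjoint (dTh f z θ - dTh f z' θ) p
        + ContinuousLinearMap.adjoint (dTh f z' θ) (p - p') := by
    simp only [map_sub, sub_apply]; abel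
  rw [e]
  refine (norm_add_le _ _).trans ?_
  have h1 : ‖ContinuousLinearMap.adjoint (dTh f z θ - dTh f z' θ) p‖
      ≤ C * (1 + ‖θ‖) * (1 + B + B) * (L * η) * B := by
    refine (ContinuousLinearMap.le_opNorm _ _).trans ?_
    rw [LinearIsometryEquiv.norm_map]
    gcongr
    · refine (h.act.dTh_sub_left_le _ _ _).trans ?_
      gcongr
      · linarith
      · exact hb.1
      · exact hb'.1
      · exact hst.1
    · exact hb.2.1
  have h2 : ‖ContinuousLinearMap.adjoint (dTh f z' θ) (p - p')‖ ≤ C * (1 + B) * (L * η) := by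
    refine (ContinuousLinearMap.le_opNorm _ _).trans ?_
    rw [LinearIsometryEquiv.norm_map]
    gcongr
    · refine (h.act.norm_dTh_le _ _).trans ?_
      gcongr
      exact hb'.1
    · exact hst.2
  have h3 : 0 ≤ C * (1 + B) * (L * η) * ‖θ‖ := by positivity
  linarith

lemma continuous_costGrad (ρ : PathP2 k) :
    Continuous fun q : I01 × Vec k => costGrad f g y μ ρ q.1 q.2 := by
  obtain ⟨B, hB0, hB⟩ := h.exists_bound (meanMoment ρ) (k := k)
  refine continuous_of_dominated (F := fun (q : I01 × Vec k) x =>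
      ContinuousLinearMap.adjoint (dTh f (Z f ρ x q.1) q.2) (adj f g y ρ x q.1))
    (bound := fun _ => C * (1 + B) * B) (fun q => ?_) (fun q => ?_)
    (integrable_const _) (ae_of_all _ fun x => ?_)
  · exact (h.integrable_integrand ρ q.1 q.2).aestronglyMeasurable
  · filter_upwards [h.supp] with x hx
    have := hB ρ le_rfl x hx q.1
    exact h.norm_integrand_le this.1 this.2.1 q.2
  · have hc : Continuous fun q : I01 × Vec k => (x, q) := by fun_prop
    have hcomp := (h.continuous_integrand ρ).comp hc
    simpa only [Function.comp_def] using hcomp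

lemma inner_costGrad (ρ : PathP2 k) (t : I01) (θ v : Vec k) :
    inner ℝ (costGrad f g y μ ρ t θ) v
      = ∫ x, inner ℝ (adj f g y ρ x t) (dTh f (Z f ρ x t) θ v) ∂μ := by
  rw [costGrad, real_inner_comm, ← integral_inner (h.integrable_integrand ρ t θ)]
  refine integral_congr_ae (ae_of_all _ fun x => ?_)
  simp only
  rw [ContinuousLinearMap.adjoint_inner_right, real_inner_comm]

/-- The second-order Taylor remainder of f in θ is uniform over the support of μ, so it can be
integrated directly in place of a theorem on differentiation under the integral. -/
lemma hasGradientAt_costDeriv (ρ : PathP2 k) (t : I01) (θ : Vec k) :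
    HasGradientAt (costDeriv f g y μ ρ t) (costGrad f g y μ ρ t θ) θ := by
  obtain ⟨B, hB0, hB⟩ := h.exists_bound (meanMoment ρ) (k := k)
  have hC := h.act.nonneg
  have hZc : Continuous fun x => Z f ρ x t :=
    (h.continuous_Z ρ).comp (continuous_id.prodMk continuous_const)
  have hpc : Continuous fun x => adj f g y ρ x t :=
    (h.continuous_adj ρ).comp (continuous_id.prodMk continuous_const)
  have hi : ∀ θ, Integrable (fun x => inner ℝ (adj f g y ρ x t) (f (Z f ρ x t) θ)) μ := fun θ => by
    have hfc : Continuous fun x => f (Z f ρ x t) θ :=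
      h.act.continuous.comp (hZc.prodMk continuous_const)
    refine (integrable_const (B * (C * (1 + ‖θ‖) * (1 + B)))).mono'
      (hpc.inner hfc).aestronglyMeasurable ?_
    filter_upwards [h.supp] with x hx
    have hb := hB ρ le_rfl x hx t
    refine (norm_inner_le_norm _ _).trans ?_
    gcongr
    · exact hb.2.1
    · refine (h.act.norm_le _ _).trans ?_
      gcongr
      exact hb.1
  have hi2 : ∀ v, Integrable
      (fun x => inner ℝ (adj f g y ρ x t) (dTh f (Z f ρ x t) θ v)) μ := fun v => by
    have := ((h.integrable_integrand ρ t θ).const_inner (𝕜 := ℝ) v)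
    refine this.congr (ae_of_all _ fun x => ?_)
    simp only
    rw [ContinuousLinearMap.adjoint_inner_right, real_inner_comm]
  rw [HasGradientAt]
  refine hasFDerivAt_of_quadratic_bound (M := B * (C * (1 + B) ^ 2)) (Eventually.of_forall
    fun θ' => ?_)
  rw [InnerProductSpace.toDual_apply_apply, h.inner_costGrad, costDeriv, costDeriv,
    ← integral_sub (hi θ') (hi θ)]
  have hsub := integral_sub ((hi θ').sub (hi θ)) (hi2 (θ' - θ))
  simp only [Pi.sub_apply] at hsub
  rw [← hsub]
  refine (norm_integral_le_of_norm_le_const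
    (C := B * (C * (1 + B) ^ 2) * ‖θ' - θ‖ ^ 2) ?_).trans ?_
  swap
  · rw [probReal_univ, mul_one]
  filter_upwards [h.supp] with x hx
  have hb := hB ρ le_rfl x hx t
  rw [← inner_sub_right, ← inner_sub_right, mul_assoc]
  refine (norm_inner_le_norm _ _).trans ?_
  gcongr
  · exact hb.2.1
  · refine (norm_sub_sub_fderiv_le (L := C * (1 + ‖Z f ρ x t‖) ^ 2) (by positivity)
      (h.act.differentiable_right _) (fun x => h.act.dTh_sub_le _ _ _) θ').trans ?_
    gcongr
    exact hb.1

lemma gradient_energyDeriv (s : ℝ) (ρ : PathP2 k) (t : I01) (θ : Vec k) :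
    gradient (energyDeriv f g y μ s ρ t) θ
      = costGrad f g y μ ρ t θ + (2 * Real.exp (-s)) • θ := by
  refine HasGradientAt.gradient ?_
  have h1 := h.hasGradientAt_costDeriv ρ t θ
  rw [HasGradientAt] at h1 ⊢
  have h2 : HasFDerivAt (fun θ : Vec k => ‖θ‖ ^ 2) (2 • (innerSL ℝ θ)) θ :=
    (hasStrictFDerivAt_norm_sq θ).hasFDerivAt
  refine HasFDerivAt.congr_fderiv (h1.add (h2.const_mul (Real.exp (-s)))) ?_
  ext v
  simp
  ring

end Setting
end MeanFieldResNet

namespace MeanFieldResNet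

/-! ### The gradient flow as an ordinary differential equation for displacements -/

section Flow

variable {d k : ℕ}

namespace Setting

variable {f : Vec d → Vec k → Vec d} {g y : Vec d → ℝ} {μ : Measure (Vec d)}
  {C K R : ℝ} [IsProbabilityMeasure μ]

/-- The gradient field of the energy at `ρ`. -/
noncomputable def energyGrad (_ : Setting f g y μ C K R) (ρ : PathP2 k) (s : ℝ) (t : I01)
    (θ : Vec k) : Vec k :=
  costGrad f g y μ ρ t θ + (2 * Real.exp (-s)) • θ

variable (h : Setting f g y μ C K R)

lemma continuous_energyGrad (ρ : PathP2 k) (s : ℝ) :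
    Continuous fun q : I01 × Vec k => h.energyGrad ρ s q.1 q.2 := by
  have h1 : Continuous fun q : I01 × Vec k => (2 * Real.exp (-s)) • q.2 := by fun_prop
  exact (h.continuous_costGrad ρ).add h1

lemma exists_energyGrad_bound (Q : ℝ) :
    ∃ B, 0 ≤ B ∧ ∀ ρ : PathP2 k, meanMoment ρ ≤ Q → ∀ s, 0 ≤ s → ∀ t θ,
      ‖h.energyGrad ρ s t θ‖ ≤ B * (1 + ‖θ‖) ∧
      ∀ θ', ‖h.energyGrad ρ s t θ - h.energyGrad ρ s t θ'‖ ≤ B * ‖θ - θ'‖ := by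
  obtain ⟨B, hB0, hB⟩ := h.exists_costGrad_bound Q (k := k)
  refine ⟨B + 2, by positivity, fun ρ hρ s hs t θ => ?_⟩
  have hexp : 2 * Real.exp (-s) ≤ 2 := by
    have := Real.exp_le_one_iff.2 (neg_nonpos.2 hs)
    linarith
  refine ⟨(norm_add_le _ _).trans ?_, fun θ' => ?_⟩
  · rw [norm_smul, Real.norm_of_nonneg (by positivity)]
    have h1 := (hB ρ hρ t θ).1
    have h2 : 2 * Real.exp (-s) * ‖θ‖ ≤ 2 * ‖θ‖ := by gcongr
    nlinarith [norm_nonneg θ]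
  · have e : h.energyGrad ρ s t θ - h.energyGrad ρ s t θ'
        = (costGrad f g y μ ρ t θ - costGrad f g y μ ρ t θ')
          + (2 * Real.exp (-s)) • (θ - θ') := by
      simp only [energyGrad, smul_sub]; abel
    rw [e]
    refine (norm_add_le _ _).trans ?_
    rw [norm_smul, Real.norm_of_nonneg (by positivity), add_mul]
    have := (hB ρ hρ t θ).2 θ'
    gcongr

omit [IsProbabilityMeasure μ] in
lemma norm_vecField_aux_le (ρ : PathP2 k) (s : ℝ) (ψ : Disp k) {B : ℝ}
    (hB : ∀ t θ, ‖costGrad f g y μ ρ t θ‖ ≤ B) (q : I01 × Vec k) :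
    ‖-((1 + ‖q.2‖)⁻¹ • h.energyGrad ρ s q.1 (disp ψ q.1 q.2))‖
      ≤ B + 2 * Real.exp (-s) * (1 + ‖ψ‖) := by
  have hB0 : 0 ≤ B := (norm_nonneg _).trans (hB q.1 q.2)
  rw [norm_neg, norm_smul, norm_inv, Real.norm_of_nonneg (by positivity),
    inv_mul_le_iff₀ (by positivity)]
  refine (norm_add_le _ _).trans ?_
  rw [norm_smul, Real.norm_of_nonneg (by positivity)]
  have h1 := hB q.1 (disp ψ q.1 q.2)
  have h2 := norm_disp_le ψ q.1 q.2
  have h3 : 2 * Real.exp (-s) * ‖disp ψ q.1 q.2‖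
      ≤ 2 * Real.exp (-s) * ((1 + ‖ψ‖) * (1 + ‖q.2‖)) := by gcongr
  nlinarith [norm_nonneg q.2]

/-- The vector field of the gradient flow in the space of displacements. -/
noncomputable def vecField (ρ : PathP2 k) (s : ℝ) (ψ : Disp k) : Disp k :=
  BoundedContinuousFunction.ofNormedAddCommGroup
    (fun q => -((1 + ‖q.2‖)⁻¹ • h.energyGrad ρ s q.1 (disp ψ q.1 q.2)))
    (((continuous_const.add continuous_snd.norm).inv₀
      (fun q => (by positivity : (0 : ℝ) < 1 + ‖q.2‖).ne')).smul ((h.continuous_energyGrad ρ s).comp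
        (continuous_fst.prodMk (continuous_disp ψ)))).neg
    ((h.exists_costGrad_bound (meanMoment ρ)).choose + 2 * Real.exp (-s) * (1 + ‖ψ‖))
    (h.norm_vecField_aux_le ρ s ψ fun t θ =>
      ((h.exists_costGrad_bound (meanMoment ρ)).choose_spec.2 ρ le_rfl t θ).1)

lemma vecField_apply (ρ : PathP2 k) (s : ℝ) (ψ : Disp k) (t : I01) (θ : Vec k) :
    h.vecField ρ s ψ (t, θ) = -((1 + ‖θ‖)⁻¹ • h.energyGrad ρ s t (disp ψ t θ)) := rfl

lemma smul_vecField_apply (ρ : PathP2 k) (s : ℝ) (ψ : Disp k) (t : I01) (θ : Vec k) :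
    (1 + ‖θ‖) • h.vecField ρ s ψ (t, θ) = -h.energyGrad ρ s t (disp ψ t θ) := by
  have : 1 + ‖θ‖ ≠ 0 := by positivity
  rw [vecField_apply, smul_neg, smul_smul, mul_inv_cancel₀ this, one_smul]

/-- The coefficient of ‖ψ‖ is an absolute constant and ρ enters only through B. Grönwall's
inequality therefore excludes blow-up once the gradient of the cost is bounded. -/
lemma norm_vecField_le (ρ : PathP2 k) {s : ℝ} (hs : 0 ≤ s) (ψ : Disp k) {B : ℝ}
    (hB : ∀ t θ, ‖costGrad f g y μ ρ t θ‖ ≤ B) :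
    ‖h.vecField ρ s ψ‖ ≤ 2 * ‖ψ‖ + (B + 2) := by
  have hB0 : 0 ≤ B := (norm_nonneg _).trans (hB 0 0)
  have hexp := Real.exp_le_one_iff.2 (neg_nonpos.2 hs)
  refine (BoundedContinuousFunction.norm_le (by positivity)).2 fun q => ?_
  refine (h.norm_vecField_aux_le ρ s ψ hB q).trans ?_
  have : 2 * Real.exp (-s) * (1 + ‖ψ‖) ≤ 2 * 1 * (1 + ‖ψ‖) := by gcongr
  linarith

lemma exists_vecField_sub_le (Q : ℝ) :
    ∃ B, 0 ≤ B ∧ ∀ ρ : PathP2 k, meanMoment ρ ≤ Q → ∀ s, 0 ≤ s → ∀ ψ χ : Disp k,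
      ‖h.vecField ρ s ψ - h.vecField ρ s χ‖ ≤ B * ‖ψ - χ‖ := by
  obtain ⟨B, hB0, hB⟩ := h.exists_energyGrad_bound Q (k := k)
  refine ⟨B, hB0, fun ρ hρ s hs ψ χ => ?_⟩
  refine (BoundedContinuousFunction.norm_le (by positivity)).2 fun q => ?_
  rw [BoundedContinuousFunction.sub_apply, h.vecField_apply, h.vecField_apply, neg_sub_neg,
    ← smul_sub, norm_smul, norm_inv, Real.norm_of_nonneg (by positivity),
    inv_mul_le_iff₀ (by positivity), norm_sub_rev]
  calc _ ≤ B * ‖disp ψ q.1 q.2 - disp χ q.1 q.2‖ := (hB ρ hρ s hs _ _).2 _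
    _ ≤ B * ((1 + ‖q.2‖) * ‖ψ - χ‖) := by
        gcongr
        exact norm_disp_sub_le _ _ _ _
    _ = _ := by ring

lemma exists_energyGrad_close {Λ : ℝ} (hΛ0 : 0 ≤ Λ) :
    ∃ L, 0 ≤ L ∧ ∀ ρ ρ' : PathP2 k, (∀ t, ∫ θ, ‖θ‖ ^ 2 ∂(ρ t) ≤ Λ) →
      (∀ t, ∫ θ, ‖θ‖ ^ 2 ∂(ρ' t) ≤ Λ) → ∀ η, Close η ρ ρ' → ∀ s s' t θ,
      ‖h.energyGrad ρ s t θ - h.energyGrad ρ' s' t θ‖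
        ≤ L * (η + |Real.exp (-s) - Real.exp (-s')|) * (1 + ‖θ‖) := by
  obtain ⟨L, hL0, hL⟩ := h.exists_costGrad_stability hΛ0 (k := k)
  refine ⟨L + 2, by positivity, fun ρ ρ' hρ hρ' η hη s s' t θ => ?_⟩
  have hη0 : 0 ≤ η := (hη 0).nonneg
  have e : h.energyGrad ρ s t θ - h.energyGrad ρ' s' t θ
      = (costGrad f g y μ ρ t θ - costGrad f g y μ ρ' t θ)
        + (2 * (Real.exp (-s) - Real.exp (-s'))) • θ := by
    simp only [energyGrad, mul_sub, sub_smul]; abel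
  rw [e]
  refine (norm_add_le _ _).trans ?_
  rw [norm_smul, norm_mul, Real.norm_eq_abs, Real.norm_eq_abs, abs_two]
  have h1 := hL ρ ρ' hρ hρ' η hη t θ
  set a := |Real.exp (-s) - Real.exp (-s')|
  have ha : 0 ≤ a := abs_nonneg _
  have h2 : 0 ≤ L * a * (1 + ‖θ‖) := by positivity
  have h3 : 0 ≤ η * (1 + ‖θ‖) := by positivity
  linarith

/-- The displacement acts on the field both directly and through the transported measure. This is
the second dependence; `exists_vecField_sub_le` is the first. -/
lemma exists_vecField_close {Λ : ℝ} (hΛ0 : 0 ≤ Λ) :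
    ∃ L, 0 ≤ L ∧ ∀ ρ ρ' : PathP2 k, (∀ t, ∫ θ, ‖θ‖ ^ 2 ∂(ρ t) ≤ Λ) →
      (∀ t, ∫ θ, ‖θ‖ ^ 2 ∂(ρ' t) ≤ Λ) → ∀ η, Close η ρ ρ' → ∀ s s' (ψ : Disp k),
      ‖h.vecField ρ s ψ - h.vecField ρ' s' ψ‖
        ≤ L * (η + |Real.exp (-s) - Real.exp (-s')|) * (1 + ‖ψ‖) := by
  obtain ⟨L, hL0, hL⟩ := h.exists_energyGrad_close hΛ0 (k := k)
  refine ⟨L, hL0, fun ρ ρ' hρ hρ' η hη s s' ψ => ?_⟩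
  have hη0 : 0 ≤ η := (hη 0).nonneg
  refine (BoundedContinuousFunction.norm_le (by positivity)).2 fun q => ?_
  rw [BoundedContinuousFunction.sub_apply, h.vecField_apply, h.vecField_apply, neg_sub_neg,
    ← smul_sub, norm_smul, norm_inv, Real.norm_of_nonneg (by positivity),
    inv_mul_le_iff₀ (by positivity), norm_sub_rev]
  refine (hL ρ ρ' hρ hρ' η hη s s' _ _).trans ?_
  have := one_add_norm_disp_le ψ q.1 q.2
  calc _ ≤ L * (η + |Real.exp (-s) - Real.exp (-s')|) * ((1 + ‖ψ‖) * (1 + ‖q.2‖)) := by gcongr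
    _ = _ := by ring

end Setting

/-! ### Continuity in pseudo-time of flows of measures -/

lemma Close.triangle {η η' : ℝ} {ρ σ τ : PathP2 k} (h : Close η ρ σ) (h' : Close η' σ τ) :
    Close (η + η') ρ τ := fun t F hF =>
  (abs_sub_le _ _ _).trans (add_le_add (h t F hF) (h' t F hF))

lemma Close.symm {η : ℝ} {ρ σ : PathP2 k} (h : Close η ρ σ) : Close η σ ρ := fun t => (h t).symm

lemma Close.mono {η η' : ℝ} {ρ σ : PathP2 k} (h : Close η ρ σ) (hη : η ≤ η') : Close η' ρ σ :=
  fun t F hF => (h t F hF).trans hη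

lemma close_self (ρ : PathP2 k) : Close 0 ρ ρ := fun _ => closeMeas_self _

lemma FlowP2.eventually_close (ρ : FlowP2 k) (s₀ : ℝ≥0) {η : ℝ} (hη : 0 < η) :
    ∀ᶠ s in 𝓝 s₀, Close η (ρ s) (ρ s₀) := by
  obtain ⟨Λ, -, hΛ⟩ := (ρ s₀).exists_moment_le
  obtain ⟨δ, hδ, h⟩ := exists_closeMeas_of_W2_lt (k := k) Λ hη
  filter_upwards [(ρ.continuous_d1 s₀).eventually (gt_mem_nhds hδ)] with s hs t
  exact h _ _ (hΛ t) ((le_iSup (fun _ => W2 _ _) t).trans_lt hs)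

/-- Nearby curves have moments differing by at most 1, since |θ|² is a test function for
`CloseMeas`. Compactness of [0,T] makes the bound uniform. -/
lemma FlowP2.exists_moment_le (ρ : FlowP2 k) (T : ℝ≥0) :
    ∃ Λ, 0 ≤ Λ ∧ ∀ s ≤ T, ∀ t, ∫ θ, ‖θ‖ ^ 2 ∂(ρ s t) ≤ Λ := by
  have key : ∃ Λ, ∀ s ∈ Icc (0 : ℝ≥0) T, ∀ t, ∫ θ, ‖θ‖ ^ 2 ∂(ρ s t) ≤ Λ := by
    refine isCompact_Icc.induction_on
      (p := fun S => ∃ Λ, ∀ s ∈ S, ∀ t, ∫ θ, ‖θ‖ ^ 2 ∂(ρ s t) ≤ Λ) ⟨0, by simp⟩ ?_ ?_ ?_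
    · rintro S S' hSS ⟨Λ, hΛ⟩
      exact ⟨Λ, fun s hs => hΛ s (hSS hs)⟩
    · rintro S S' ⟨Λ, hΛ⟩ ⟨Λ', hΛ'⟩
      refine ⟨max Λ Λ', fun s hs t => ?_⟩
      rcases hs with hs | hs
      · exact (hΛ s hs t).trans (le_max_left _ _)
      · exact (hΛ' s hs t).trans (le_max_right _ _)
    · intro s₀ _
      obtain ⟨Λ, -, hΛ⟩ := (ρ s₀).exists_moment_le
      refine ⟨_, mem_nhdsWithin_of_mem_nhds (ρ.eventually_close s₀ one_pos), Λ + 1,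
        fun s hs t => ?_⟩
      have := (abs_le.1 (hs t _ wLip_norm_sq)).2
      linarith [hΛ t]
  obtain ⟨Λ, hΛ⟩ := key
  exact ⟨max Λ 0, le_max_right _ _, fun s hs t => (hΛ s ⟨zero_le, hs⟩ t).trans (le_max_left _ _)⟩

/-- This is the Heine–Cantor argument with a Lebesgue number: two nearby times lie in one covering
set and are each η/2-close to its centre. -/
lemma FlowP2.exists_uniform_close (ρ : FlowP2 k) (T : ℝ≥0) {η : ℝ} (hη : 0 < η) :
    ∃ δ > 0, ∀ s ≤ T, ∀ r ≤ T, dist s r < δ → Close η (ρ s) (ρ r) := by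
  obtain ⟨δ, hδ, h⟩ := lebesgue_number_lemma_of_metric (s := Icc (0 : ℝ≥0) T)
    (c := fun s₀ => interior {s | Close (η / 2) (ρ s) (ρ s₀)}) isCompact_Icc
    (fun _ => isOpen_interior) fun s₀ _ => mem_iUnion.2
      ⟨s₀, mem_interior_iff_mem_nhds.2 (ρ.eventually_close s₀ (half_pos hη))⟩
  refine ⟨δ, hδ, fun s hs r _ hsr => ?_⟩
  obtain ⟨s₀, hs₀⟩ := h s ⟨zero_le, hs⟩
  have h1 : Close _ _ _ := interior_subset (hs₀ (Metric.mem_ball_self hδ))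
  have h2 : Close _ _ _ := interior_subset (hs₀ (Metric.mem_ball'.2 hsr))
  exact (h1.triangle h2.symm).mono (add_halves η).le

lemma close_pushPath_of_norm_le {ρ₀ : PathP2 k} (hρ₀ : Admissible ρ₀) {Λ r : ℝ} (hΛ0 : 0 ≤ Λ)
    (hΛ : ∀ t, ∫ θ, ‖θ‖ ^ 2 ∂(ρ₀ t) ≤ Λ) {ψ χ : Disp k} (hψ : ‖ψ‖ ≤ r) (hχ : ‖χ‖ ≤ r) :
    Close ((2 + r + r) * (2 * (1 + Λ)) * ‖ψ - χ‖) (pushPath hρ₀ ψ) (pushPath hρ₀ χ) :=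
  (close_pushPath hρ₀ hΛ ψ χ).mono (by gcongr)

/-! ### Solutions of the linear and nonlinear equations for displacements -/

namespace Setting

variable {f : Vec d → Vec k → Vec d} {g y : Vec d → ℝ} {μ : Measure (Vec d)}
  {C K R : ℝ} [IsProbabilityMeasure μ] (h : Setting f g y μ C K R)
include h

/-- The vector field is continuous along continuous flows. -/
lemma continuous_vecField_of_close {σ : ℝ → PathP2 k}
    (hσ : ∀ s₀, ∀ η > 0, ∀ᶠ s in 𝓝 s₀, Close η (σ s) (σ s₀)) (ψ : Disp k) :
    Continuous fun s => h.vecField (σ s) s ψ := by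
  rw [continuous_iff_continuousAt]
  intro s₀
  obtain ⟨Λ, hΛ0, hΛ⟩ := (σ s₀).exists_moment_le
  obtain ⟨L, hL0, hL⟩ := h.exists_vecField_close (k := k) (Λ := Λ + 1) (by positivity)
  rw [ContinuousAt, Metric.tendsto_nhds]
  intro ε hε
  -- The bound 1 keeps nearby moments below Λ + 1, so that one constant L applies; the other term
  -- makes the resulting error smaller than ε.
  set η := min 1 (ε / (4 * (L + 1) * (1 + ‖ψ‖)))
  have hη : 0 < η := by positivity
  have hη2 : L * (η + η) * (1 + ‖ψ‖) < ε := by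
    have h1 : η ≤ ε / (4 * (L + 1) * (1 + ‖ψ‖)) := min_le_right _ _
    rw [le_div_iff₀ (by positivity)] at h1
    have h2 : 0 < η * (1 + ‖ψ‖) := by positivity
    nlinarith
  have hexp : ∀ᶠ s in 𝓝 s₀, |Real.exp (-s) - Real.exp (-s₀)| < η := by
    have hc : Continuous fun s => |Real.exp (-s) - Real.exp (-s₀)| := by fun_prop
    exact (hc.tendsto s₀).eventually (gt_mem_nhds (by simpa using hη))
  filter_upwards [hσ s₀ η hη, hexp] with s hs hs2
  rw [dist_eq_norm]
  have hm : ∀ t, ∫ θ, ‖θ‖ ^ 2 ∂(σ s t) ≤ Λ + 1 := fun t => by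
    have := (abs_le.1 (hs t _ wLip_norm_sq)).2
    have h3 : η ≤ 1 := min_le_left _ _
    linarith [hΛ t]
  refine (hL (σ s) (σ s₀) hm (fun t => (hΛ t).trans (by linarith)) η hs s s₀ ψ).trans_lt ?_
  refine lt_of_le_of_lt ?_ hη2
  gcongr

/-- The displacements transported by the gradient field of a given flow of measures. -/
lemma exists_linear_solution (ρ : FlowP2 k) :
    ∃ ψ : ℝ → Disp k, ψ 0 = 0 ∧ ∀ s ∈ Ici (0 : ℝ),
      HasDerivWithinAt ψ (h.vecField (ρ s.toNNReal) s (ψ s)) (Ici 0) s := by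
  refine exists_solution_Ici_of_lipschitz (v := fun s ψ => h.vecField (ρ s.toNNReal) s ψ) 0
    (fun ψ => (h.continuous_vecField_of_close (σ := fun s => ρ s.toNNReal)
      (fun s₀ η hη => (continuous_real_toNNReal.tendsto s₀).eventually
        (ρ.eventually_close s₀.toNNReal hη)) ψ).continuousOn) fun T => ?_
  obtain ⟨Λ, hΛ0, hΛ⟩ := ρ.exists_moment_le T.toNNReal
  obtain ⟨B, hB0, hB⟩ := h.exists_vecField_sub_le Λ (k := k)
  refine ⟨B.toNNReal, fun s hs => LipschitzWith.of_dist_le' fun ψ χ => ?_⟩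
  rw [dist_eq_norm, dist_eq_norm]
  exact hB _ (meanMoment_le (hΛ _ (Real.toNNReal_le_toNNReal hs.2))) s hs.1 ψ χ

variable {ρ₀ : PathP2 k} (hρ₀ : Admissible ρ₀)

/-- The constant is local in ψ because the moments of the transported curve grow with ‖ψ‖, and it is
uniform in s ≥ 0. -/
lemma exists_lipschitzOn_vecField_pushPath (r : ℝ) :
    ∃ L : ℝ≥0, ∀ s, 0 ≤ s → LipschitzOnWith L (fun ψ => h.vecField (pushPath hρ₀ ψ) s ψ)
      (Metric.closedBall 0 r) := by
  obtain ⟨Λ, hΛ0, hΛ⟩ := ρ₀.exists_moment_le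
  set Λ' := (1 + |r|) ^ 2 * (2 * (1 + Λ))
  have hΛ' : 0 ≤ Λ' := by positivity
  have hm : ∀ ψ : Disp k, ‖ψ‖ ≤ r → ∀ t, ∫ θ, ‖θ‖ ^ 2 ∂(pushPath hρ₀ ψ t) ≤ Λ' := fun ψ hψ t => by
    refine (integral_norm_sq_pushPath_le hρ₀ hΛ ψ t).trans ?_
    have := hψ.trans (le_abs_self r)
    change _ ≤ (1 + |r|) ^ 2 * (2 * (1 + Λ))
    gcongr
  obtain ⟨L, hL0, hL⟩ := h.exists_vecField_close hΛ' (k := k)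
  obtain ⟨B, hB0, hB⟩ := h.exists_vecField_sub_le Λ' (k := k)
  refine ⟨(B + L * ((2 + |r| + |r|) * (2 * (1 + Λ))) * (1 + |r|)).toNNReal,
    fun s hs => LipschitzOnWith.of_dist_le' fun ψ hψ χ hχ => ?_⟩
  rw [mem_closedBall_zero_iff] at hψ hχ
  rw [dist_eq_norm, dist_eq_norm]
  have h1 := hL _ _ (hm ψ hψ) (hm χ hχ) _ (close_pushPath_of_norm_le hρ₀ hΛ0 hΛ
    (hψ.trans (le_abs_self r)) (hχ.trans (le_abs_self r))) s s ψ
  rw [sub_self, abs_zero, add_zero] at h1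
  have h2 := hB _ (meanMoment_le (hm χ hχ)) s hs ψ χ
  have h3 : L * ((2 + |r| + |r|) * (2 * (1 + Λ)) * ‖ψ - χ‖) * (1 + ‖ψ‖)
      ≤ L * ((2 + |r| + |r|) * (2 * (1 + Λ)) * ‖ψ - χ‖) * (1 + |r|) := by
    have := hψ.trans (le_abs_self r)
    gcongr
  have h4 := norm_sub_le_norm_sub_add_norm_sub (h.vecField (pushPath hρ₀ ψ) s ψ)
    (h.vecField (pushPath hρ₀ χ) s ψ) (h.vecField (pushPath hρ₀ χ) s χ)
  linarith

end Setting

/-- A continuous curve of displacements gives a continuous flow of measures. -/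
noncomputable def pushFlow {ρ₀ : PathP2 k} (hρ₀ : Admissible ρ₀)
    (ψ : ℝ → Disp k) (hψ : ContinuousOn ψ (Ici 0)) : FlowP2 k where
  at_pseudotime s := pushPath hρ₀ (ψ s)
  continuous_d1 s₀ := by
    obtain ⟨Λ, hΛ0, hΛ⟩ := ρ₀.exists_moment_le
    have hc : Continuous fun s : ℝ≥0 => ψ s :=
      hψ.comp_continuous NNReal.continuous_coe fun s => s.2
    have h1 : Tendsto (fun s : ℝ≥0 => ‖ψ s - ψ s₀‖ ^ 2 * (2 * (1 + Λ))) (𝓝 s₀) (𝓝 0) := by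
      have : Continuous fun s : ℝ≥0 => ‖ψ s - ψ s₀‖ ^ 2 * (2 * (1 + Λ)) :=
        ((hc.sub continuous_const).norm.pow 2).mul continuous_const
      simpa using this.tendsto s₀
    have h2 := (ENNReal.tendsto_ofReal h1).ennrpow_const (1 / 2 : ℝ)
    rw [ENNReal.ofReal_zero, ENNReal.zero_rpow_of_pos (by norm_num)] at h2
    exact tendsto_of_tendsto_of_tendsto_of_le_of_le tendsto_const_nhds h2 (fun _ => zero_le)
      fun s => d1_pushPath_le hρ₀ hΛ _ _

end Flow
end MeanFieldResNet

namespace MeanFieldResNet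

/-! ### First variations along displacements -/

section Pairing

variable {k : ℕ}

/-- The pairing of a vector field with a weighted displacement, at a fixed layer. -/
noncomputable def pairAt (ρ : PathP2 k) (W : I01 → Vec k → Vec k) (t : I01) (χ : Disp k) : ℝ :=
  ∫ θ, inner ℝ (W t θ) ((1 + ‖θ‖) • χ (t, θ)) ∂(ρ t)

lemma continuous_smul_disp (χ : Disp k) :
    Continuous fun q : I01 × Vec k => (1 + ‖q.2‖) • χ (q.1, q.2) := by
  have := χ.continuous
  fun_prop

lemma norm_smul_disp_le (χ : Disp k) (t : I01) (θ : Vec k) :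
    ‖(1 + ‖θ‖) • χ (t, θ)‖ ≤ (1 + ‖θ‖) * ‖χ‖ := by
  rw [norm_smul, Real.norm_of_nonneg (by positivity)]
  gcongr
  exact χ.norm_coe_le_norm _

variable {W : I01 → Vec k → Vec k} {N : ℝ}

lemma norm_inner_smul_disp_le {w : Vec k} {t : I01} {θ : Vec k} (hN : ‖w‖ ≤ N * (1 + ‖θ‖))
    (χ : Disp k) : ‖inner ℝ w ((1 + ‖θ‖) • χ (t, θ))‖ ≤ N * ‖χ‖ * (1 + ‖θ‖) ^ 2 := by
  calc _ ≤ (N * (1 + ‖θ‖)) * ((1 + ‖θ‖) * ‖χ‖) :=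
        (norm_inner_le_norm _ _).trans (mul_le_mul hN (norm_smul_disp_le χ t θ) (norm_nonneg _)
          ((norm_nonneg _).trans hN))
    _ = _ := by ring

lemma integrable_pairAt (hW : Continuous (Function.uncurry W))
    (hN : ∀ t θ, ‖W t θ‖ ≤ N * (1 + ‖θ‖)) (ρ : PathP2 k) (t : I01) (χ : Disp k) :
    Integrable (fun θ => inner ℝ (W t θ) ((1 + ‖θ‖) • χ (t, θ))) (ρ t) := by
  have hc : Continuous fun θ : Vec k => (t, θ) := by fun_prop
  refine (ρ.at_time t).integrable_of_growth
    ((hW.comp hc).inner ((continuous_smul_disp χ).comp hc)).aestronglyMeasurable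
    fun θ => norm_inner_smul_disp_le (hN t θ) χ

lemma abs_pairAt_le (hN : ∀ t θ, ‖W t θ‖ ≤ N * (1 + ‖θ‖)) {ρ : PathP2 k} {Λ : ℝ}
    (hΛ : ∀ t, ∫ θ, ‖θ‖ ^ 2 ∂(ρ t) ≤ Λ) (t : I01) (χ : Disp k) :
    |pairAt ρ W t χ| ≤ N * (2 * (1 + Λ)) * ‖χ‖ := by
  have hN0 : 0 ≤ N := by simpa using (norm_nonneg _).trans (hN t 0)
  rw [← Real.norm_eq_abs]
  calc _ ≤ ∫ θ, N * ‖χ‖ * (1 + ‖θ‖) ^ 2 ∂(ρ t) :=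
        norm_integral_le_of_norm_le ((ρ.at_time t).integrable_one_add_sq.const_mul _)
          (ae_of_all _ fun θ => norm_inner_smul_disp_le (hN t θ) χ)
    _ ≤ N * ‖χ‖ * (2 * (1 + Λ)) := by
        rw [integral_const_mul]
        gcongr
        exact integral_one_add_sq_le hΛ t
    _ = _ := by ring

lemma pairAt_add (hW : Continuous (Function.uncurry W))
    (hN : ∀ t θ, ‖W t θ‖ ≤ N * (1 + ‖θ‖)) (ρ : PathP2 k) (t : I01) (χ χ' : Disp k) :
    pairAt ρ W t (χ + χ') = pairAt ρ W t χ + pairAt ρ W t χ' := by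
  rw [pairAt, pairAt, pairAt, ← integral_add (integrable_pairAt hW hN ρ t χ)
    (integrable_pairAt hW hN ρ t χ')]
  simp [smul_add, inner_add_right]

lemma pairAt_smul (ρ : PathP2 k) (t : I01) (c : ℝ) (χ : Disp k) :
    pairAt ρ W t (c • χ) = c * pairAt ρ W t χ := by
  rw [pairAt, pairAt, ← integral_const_mul]
  simp only [BoundedContinuousFunction.coe_smul, smul_comm _ c, inner_smul_right]

lemma continuous_pairAt {ρ : PathP2 k} (hρ : Admissible ρ) (hW : Continuous (Function.uncurry W))
    (hN : ∀ t θ, ‖W t θ‖ ≤ N * (1 + ‖θ‖)) (χ : Disp k) :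
    Continuous fun t => pairAt ρ W t χ :=
  hρ.continuous_integral continuous_id (hW.inner (continuous_smul_disp χ)) fun _ =>
    ⟨N * ‖χ‖, Eventually.of_forall fun t θ => norm_inner_smul_disp_le (hN t θ) χ⟩

lemma exists_clm_pairAt (hW : Continuous (Function.uncurry W))
    (hN : ∀ t θ, ‖W t θ‖ ≤ N * (1 + ‖θ‖)) (ρ : PathP2 k) (t : I01) :
    ∃ A : Disp k →L[ℝ] ℝ, ∀ χ, A χ = pairAt ρ W t χ := by
  obtain ⟨Λ, -, hΛ⟩ := ρ.exists_moment_le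
  let A : Disp k →ₗ[ℝ] ℝ := ⟨⟨pairAt ρ W t, pairAt_add hW hN ρ t⟩, pairAt_smul ρ t⟩
  exact ⟨A.mkContinuous (N * (2 * (1 + Λ))) (abs_pairAt_le hN hΛ t), fun _ => rfl⟩

lemma Continuous.integrable_I01 {G : Type*} [NormedAddCommGroup G] {u : I01 → G}
    (hu : Continuous u) : Integrable u :=
  hu.integrable_of_hasCompactSupport (HasCompactSupport.of_compactSpace _)

lemma exists_clm_integral_pairAt {ρ : PathP2 k} (hρ : Admissible ρ)
    (hW : Continuous (Function.uncurry W)) (hN : ∀ t θ, ‖W t θ‖ ≤ N * (1 + ‖θ‖)) :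
    ∃ A : Disp k →L[ℝ] ℝ, ∀ χ, A χ = ∫ t, pairAt ρ W t χ := by
  obtain ⟨Λ, -, hΛ⟩ := ρ.exists_moment_le
  let A : Disp k →ₗ[ℝ] ℝ := ⟨⟨fun χ => ∫ t, pairAt ρ W t χ, fun χ χ' => by
      simp_rw [pairAt_add hW hN]
      exact integral_add (Continuous.integrable_I01 (continuous_pairAt hρ hW hN χ))
        (Continuous.integrable_I01 (continuous_pairAt hρ hW hN χ'))⟩, fun c χ => by
      simp_rw [pairAt_smul]
      exact integral_const_mul _ _⟩
  refine ⟨A.mkContinuous (N * (2 * (1 + Λ))) fun χ => ?_, fun _ => rfl⟩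
  refine (norm_integral_le_of_norm_le_const (C := N * (2 * (1 + Λ)) * ‖χ‖)
    (ae_of_all _ fun t => abs_pairAt_le hN hΛ t χ)).trans ?_
  rw [probReal_univ, mul_one]

/-- The chain rule along a curve for a function with a quadratic Taylor remainder. -/
lemma hasDerivWithinAt_of_quadratic_bound {E : Type*} [NormedAddCommGroup E] [NormedSpace ℝ E]
    {J : E → ℝ} {A : E →L[ℝ] ℝ} {u : ℝ → E} {u' : E} {S : Set ℝ} {s M r : ℝ} (hr : ‖u s‖ < r)
    (h : ∀ z, ‖z‖ ≤ r → |J z - J (u s) - A (z - u s)| ≤ M * ‖z - u s‖ ^ 2)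
    (hu : HasDerivWithinAt u u' S s) : HasDerivWithinAt (fun v => J (u v)) (A u') S s := by
  have hJ : HasFDerivAt J A (u s) := by
    refine hasFDerivAt_of_quadratic_bound (M := M) ?_
    have : ∀ᶠ z in 𝓝 (u s), ‖z‖ < r := (continuous_norm.tendsto _).eventually (gt_mem_nhds hr)
    filter_upwards [this] with z hz using h z hz.le
  exact hJ.comp_hasDerivWithinAt s hu

/-- Taylor estimate for the integral of a function against a transported measure. -/
lemma integral_pushPath_taylor_le {ρ : PathP2 k} (hρ : Admissible ρ) {Λ M : ℝ} (hM : 0 ≤ M)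
    (hΛ : ∀ t, ∫ θ, ‖θ‖ ^ 2 ∂(ρ t) ≤ Λ) {c : ℝ} (hc : 0 ≤ c) {F : Vec k → ℝ} (hF : WLip c F)
    (hd : Differentiable ℝ F) (hL : ∀ z z', ‖fderiv ℝ F z - fderiv ℝ F z'‖ ≤ M * ‖z - z'‖)
    (hN : ∀ z, ‖gradient F z‖ ≤ N * (1 + ‖z‖)) (ψ χ : Disp k) (t : I01) :
    |∫ θ, F θ ∂(pushPath hρ χ t) - ∫ θ, F θ ∂(pushPath hρ ψ t)
      - pairAt ρ (fun t θ => gradient F (disp ψ t θ)) t (χ - ψ)|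
      ≤ M * (2 * (1 + Λ)) * ‖χ - ψ‖ ^ 2 := by
  have hi : ∀ ψ : Disp k, Integrable (fun θ => F (disp ψ t θ)) (ρ t) := fun ψ => by
    have := hF.integrable hc (pushP2 (ρ.at_time t) ψ t)
    exact this.comp_measurable (continuous_disp_apply ψ t).measurable
  have hgc : Continuous (gradient F) := by
    have h1 : Continuous (fderiv ℝ F) := (LipschitzWith.of_dist_le' (K := M) fun z z' => by
      rw [dist_eq_norm, dist_eq_norm]
      exact hL z z').continuous
    exact (InnerProductSpace.toDual ℝ (Vec k)).symm.continuous.comp h1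
  have hN0 : 0 ≤ N := by simpa using (norm_nonneg _).trans (hN 0)
  have hj := integrable_pairAt (W := fun t θ => gradient F (disp ψ t θ)) (N := N * (1 + ‖ψ‖))
    (hgc.comp (continuous_disp ψ)) (fun t θ => (hN _).trans (by
      rw [mul_assoc]
      gcongr
      exact one_add_norm_disp_le ψ t θ)) ρ t (χ - ψ)
  rw [integral_pushPath hρ _ t hF.continuous, integral_pushPath hρ _ t hF.continuous, pairAt,
    ← integral_sub (hi χ) (hi ψ)]
  have hs := integral_sub ((hi χ).sub (hi ψ)) hj
  simp only [Pi.sub_apply] at hs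
  rw [← hs, ← Real.norm_eq_abs]
  calc _ ≤ ∫ θ, M * ‖χ - ψ‖ ^ 2 * (1 + ‖θ‖) ^ 2 ∂(ρ t) := by
        refine norm_integral_le_of_norm_le ((ρ.at_time t).integrable_one_add_sq.const_mul _)
          (ae_of_all _ fun θ => ?_)
        have e : inner ℝ (gradient F (disp ψ t θ)) ((1 + ‖θ‖) • (χ - ψ) (t, θ))
            = fderiv ℝ F (disp ψ t θ) (disp χ t θ - disp ψ t θ) := by
          rw [← disp_sub, gradient, InnerProductSpace.toDual_symm_apply]
        simp only [e]
        refine (norm_sub_sub_fderiv_le hM hd (fun z => hL z _) _).trans ?_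
        have h1 := norm_disp_sub_le χ ψ t θ
        calc M * ‖disp χ t θ - disp ψ t θ‖ ^ 2 ≤ M * ((1 + ‖θ‖) * ‖χ - ψ‖) ^ 2 := by gcongr
          _ = _ := by ring
    _ ≤ M * ‖χ - ψ‖ ^ 2 * (2 * (1 + Λ)) := by
        rw [integral_const_mul]
        gcongr
        exact integral_one_add_sq_le hΛ t
    _ = _ := by ring

end Pairing

end MeanFieldResNet

namespace MeanFieldResNet

/-! ### First variation of the cost -/

section CostVariation

variable {d k : ℕ} {f : Vec d → Vec k → Vec d} {g y : Vec d → ℝ} {μ : Measure (Vec d)}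
  {C K R : ℝ}

/-- The unregularized part of the energy. -/
noncomputable def cost (f : Vec d → Vec k → Vec d) (g y : Vec d → ℝ) (μ : Measure (Vec d))
    (ρ : PathP2 k) : ℝ :=
  ∫ x, 1 / 2 * (g (Z f ρ x 1) - y x) ^ 2 ∂μ

/-- The gradient of the cost of a single input. -/
noncomputable def inputGrad (f : Vec d → Vec k → Vec d) (g y : Vec d → ℝ) (ρ : PathP2 k)
    (ψ : Disp k) (x : Vec d) (t : I01) (θ : Vec k) : Vec k :=
  ContinuousLinearMap.adjoint (dTh f (Z f ρ x t) (disp ψ t θ)) (adj f g y ρ x t)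

/-- The remainder equals (g a - c) times the Taylor remainder of g, plus half the square of g b - g
a. These account for B·K and K². -/
lemma ObjectiveBounds.half_sq_taylor_le (hg : ObjectiveBounds g K) {a b : Vec d} {c B : ℝ}
    (hB : |g a - c| ≤ B) :
    |1 / 2 * (g b - c) ^ 2 - 1 / 2 * (g a - c) ^ 2
      - inner ℝ ((g a - c) • gradient g a) (b - a)| ≤ (B * K + K ^ 2) * ‖b - a‖ ^ 2 := by
  have hK := hg.nonneg
  have h1 := hg.taylor_le a b
  have h2 := hg.sub_le b a
  rw [inner_smul_left, RCLike.conj_to_real]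
  have e : 1 / 2 * (g b - c) ^ 2 - 1 / 2 * (g a - c) ^ 2
      - (g a - c) * inner ℝ (gradient g a) (b - a)
      = (g a - c) * (g b - g a - inner ℝ (gradient g a) (b - a))
        + 1 / 2 * (g b - g a) ^ 2 := by ring
  rw [e]
  refine (abs_add_le _ _).trans ?_
  have h3 : |(g a - c) * (g b - g a - inner ℝ (gradient g a) (b - a))|
      ≤ B * (K * ‖b - a‖ ^ 2) := by
    rw [abs_mul]
    exact mul_le_mul hB h1 (abs_nonneg _) ((abs_nonneg _).trans hB)
  have h4 : |1 / 2 * (g b - g a) ^ 2| ≤ (K * ‖b - a‖) ^ 2 := by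
    rw [abs_mul, abs_of_pos (by norm_num : (0 : ℝ) < 1 / 2), abs_pow]
    have : |g b - g a| ^ 2 ≤ (K * ‖b - a‖) ^ 2 := by gcongr
    nlinarith [sq_nonneg |g b - g a|]
  nlinarith

namespace Setting

variable (h : Setting f g y μ C K R)
include h

lemma continuous_inputGrad (ρ : PathP2 k) (ψ : Disp k) :
    Continuous fun q : Vec d × I01 × Vec k => inputGrad f g y ρ ψ q.1 q.2.1 q.2.2 := by
  have h1 : Continuous fun q : Vec d × I01 × Vec k => (q.1, q.2.1, disp ψ q.2.1 q.2.2) :=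
    continuous_fst.prodMk ((continuous_fst.comp continuous_snd).prodMk
      ((continuous_disp ψ).comp continuous_snd))
  have hcomp := (h.continuous_integrand ρ).comp h1
  simpa only [Function.comp_def, inputGrad] using hcomp

lemma continuous_inputGrad_apply (ρ : PathP2 k) (ψ : Disp k) (x : Vec d) :
    Continuous (Function.uncurry (inputGrad f g y ρ ψ x)) := by
  have hc : Continuous fun q : I01 × Vec k => (x, q) := by fun_prop
  have hcomp := (h.continuous_inputGrad ρ ψ).comp hc
  simpa only [Function.comp_def, Function.uncurry_def] using hcomp

/-- Bounds on the gradient of the cost of a single input, locally uniform in the input. -/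
lemma exists_inputGrad_bound (r : ℝ) (ρ : PathP2 k) :
    ∃ N, 0 ≤ N ∧ ∀ ψ x, ‖x‖ ≤ r → ∀ t θ, ‖inputGrad f g y ρ ψ x t θ‖ ≤ N * (1 + ‖θ‖) := by
  obtain ⟨B, hB0, hB⟩ := h.act.exists_bound h.obj h.label_bdd r (meanMoment ρ) (k := k)
  have hC := h.act.nonneg
  refine ⟨C * (1 + B) * B, by positivity, fun ψ x hx t θ => ?_⟩
  have hb := hB ρ le_rfl x hx t t.2
  refine (h.norm_integrand_le hb.1 hb.2.1 _).trans ?_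
  exact le_mul_of_one_le_right (by positivity) (by linarith [norm_nonneg θ])

variable {ρ₀ : PathP2 k} (hρ₀ : Admissible ρ₀)

/-- Taylor estimate for the drift of the forward equation. -/
lemma inner_drift_taylor_le {Λ : ℝ} (hΛ : ∀ t, ∫ θ, ‖θ‖ ^ 2 ∂(ρ₀ t) ≤ Λ) {B D r : ℝ}
    {ψ χ : Disp k} (hψ : ‖ψ‖ ≤ r) (t : I01) {z z' p : Vec d} (hz : ‖z‖ ≤ B) (hz' : ‖z'‖ ≤ B)
    (hp : ‖p‖ ≤ B) (hzz : ‖z' - z‖ ≤ D * ‖χ - ψ‖) (hD : 0 ≤ D) :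
    |inner ℝ p (drift f (pushPath hρ₀ χ) t z' - drift f (pushPath hρ₀ ψ) t z
        - driftDX f (pushPath hρ₀ ψ) t z (z' - z))
      - ∫ θ, inner ℝ (ContinuousLinearMap.adjoint (dTh f z (disp ψ t θ)) p)
          ((1 + ‖θ‖) • (χ - ψ) (t, θ)) ∂(ρ₀ t)|
      ≤ B * (C * ((1 + B) ^ 2 + (1 + r) * (1 + B + B) * D + (1 + r) ^ 2 * D ^ 2)
          * (2 * (1 + Λ))) * ‖χ - ψ‖ ^ 2 := by
  have hC := h.act.nonneg
  have hB0 : 0 ≤ B := (norm_nonneg _).trans hz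
  have hr0 : 0 ≤ r := (norm_nonneg _).trans hψ
  have hf := h.act
  have i1 : ∀ (ψ : Disp k) z, Integrable (fun θ => f z (disp ψ t θ)) (ρ₀ t) := fun ψ z =>
    (hf.integrable z (pushP2 (ρ₀.at_time t) ψ t)).comp_measurable
      (continuous_disp_apply ψ t).measurable
  have i2 : Integrable (fun θ => dX f z (disp ψ t θ)) (ρ₀ t) :=
    (hf.integrable_dX z (pushP2 (ρ₀.at_time t) ψ t)).comp_measurable
      (continuous_disp_apply ψ t).measurable
  have i3 : Integrable (fun θ => dX f z (disp ψ t θ) (z' - z)) (ρ₀ t) :=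
    i2.apply_continuousLinearMap _
  have e1 : drift f (pushPath hρ₀ χ) t z' = ∫ θ, f z' (disp χ t θ) ∂(ρ₀ t) :=
    integral_pushPath hρ₀ χ t (hf.wLip z').continuous
  have e2 : drift f (pushPath hρ₀ ψ) t z = ∫ θ, f z (disp ψ t θ) ∂(ρ₀ t) :=
    integral_pushPath hρ₀ ψ t (hf.wLip z).continuous
  have e3 : driftDX f (pushPath hρ₀ ψ) t z (z' - z)
      = ∫ θ, dX f z (disp ψ t θ) (z' - z) ∂(ρ₀ t) := by
    rw [driftDX, integral_pushPath hρ₀ ψ t (hf.wLip_dX z).continuous,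
      ContinuousLinearMap.integral_apply i2]
  have i4 : Integrable (fun θ => dTh f z (disp ψ t θ) ((1 + ‖θ‖) • (χ - ψ) (t, θ))) (ρ₀ t) := by
    have hc : Continuous fun θ : Vec k => (t, θ) := by fun_prop
    have hc1 : Continuous fun θ => dTh f z (disp ψ t θ) :=
      hf.continuous_dTh.comp (continuous_const.prodMk (continuous_disp_apply ψ t))
    refine (ρ₀.at_time t).integrable_of_linear_growth (C := C * (1 + B) * ‖χ - ψ‖)
      (hc1.clm_apply ((continuous_smul_disp (χ - ψ)).comp hc)).aestronglyMeasurable fun θ => ?_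
    refine (ContinuousLinearMap.le_opNorm _ _).trans ?_
    calc _ ≤ (C * (1 + B)) * ((1 + ‖θ‖) * ‖χ - ψ‖) := by
          gcongr
          · exact (hf.norm_dTh_le _ _).trans (by gcongr)
          · exact norm_smul_disp_le _ _ _
      _ = _ := by ring
  have e4 : ∫ θ, inner ℝ (ContinuousLinearMap.adjoint (dTh f z (disp ψ t θ)) p)
        ((1 + ‖θ‖) • (χ - ψ) (t, θ)) ∂(ρ₀ t)
      = inner ℝ p (∫ θ, dTh f z (disp ψ t θ) ((1 + ‖θ‖) • (χ - ψ) (t, θ)) ∂(ρ₀ t)) := by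
    rw [← integral_inner i4]
    simp_rw [ContinuousLinearMap.adjoint_inner_left]
  rw [e4, ← inner_sub_right, e1, e2, e3, ← integral_sub (i1 χ z') (i1 ψ z)]
  have s1 := integral_sub ((i1 χ z').sub (i1 ψ z)) i3
  have s2 := integral_sub (((i1 χ z').sub (i1 ψ z)).sub i3) i4
  simp only [Pi.sub_apply] at s1 s2
  rw [← s1, ← s2, mul_assoc B]
  refine (abs_real_inner_le_norm _ _).trans (mul_le_mul hp ?_ (norm_nonneg _) hB0)
  -- The three summands correspond to the error terms of `taylor_le`: quadratic in θ, mixed, and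
  -- quadratic in z.
  set κ := C * ((1 + B) ^ 2 + (1 + r) * (1 + B + B) * D + (1 + r) ^ 2 * D ^ 2)
  have hκ : 0 ≤ κ := by positivity
  calc _ ≤ ∫ θ, κ * ‖χ - ψ‖ ^ 2 * (1 + ‖θ‖) ^ 2 ∂(ρ₀ t) := by
        refine norm_integral_le_of_norm_le ((ρ₀.at_time t).integrable_one_add_sq.const_mul _)
          (ae_of_all _ fun θ => ?_)
        have h1 := hf.taylor_le z z' (disp ψ t θ) (disp χ t θ)
        rw [disp_sub] at h1
        have h2 : ‖disp ψ t θ‖ ≤ (1 + r) * (1 + ‖θ‖) :=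
          (norm_disp_le ψ t θ).trans (by gcongr)
        have h3 := norm_smul_disp_le (χ - ψ) t θ
        set δ := ‖χ - ψ‖
        set ξ := (1 + ‖θ‖) • (χ - ψ) (t, θ)
        refine h1.trans ?_
        calc _ ≤ C * (1 + B) ^ 2 * ((1 + ‖θ‖) * δ) ^ 2
              + C * ((1 + r) * (1 + ‖θ‖)) * (1 + B + B) * (D * δ) * ((1 + ‖θ‖) * δ)
              + C * ((1 + r) * (1 + ‖θ‖)) ^ 2 * (D * δ) ^ 2 := by gcongr
          _ = κ * δ ^ 2 * (1 + ‖θ‖) ^ 2 := by simp only [κ]; ring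
    _ ≤ κ * ‖χ - ψ‖ ^ 2 * (2 * (1 + Λ)) := by
        rw [integral_const_mul]
        gcongr
        exact integral_one_add_sq_le hΛ t
    _ = _ := by ring

/-- Taylor estimate for the cost of a single input. -/
lemma exists_inputCost_taylor (r : ℝ) :
    ∃ M, 0 ≤ M ∧ ∀ ψ χ : Disp k, ‖ψ‖ ≤ r → ‖χ‖ ≤ r → ∀ x, ‖x‖ ≤ R →
      |1 / 2 * (g (Z f (pushPath hρ₀ χ) x 1) - y x) ^ 2
        - 1 / 2 * (g (Z f (pushPath hρ₀ ψ) x 1) - y x) ^ 2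
        - ∫ t, pairAt ρ₀ (inputGrad f g y (pushPath hρ₀ ψ) ψ x) t (χ - ψ)|
      ≤ M * ‖χ - ψ‖ ^ 2 := by
  obtain ⟨Λ, hΛ0, hΛ⟩ := ρ₀.exists_moment_le
  set Λ' := (1 + |r|) ^ 2 * (2 * (1 + Λ)) with hΛ'e
  have hΛ' : 0 ≤ Λ' := by positivity
  have hm : ∀ ψ : Disp k, ‖ψ‖ ≤ r → ∀ t, ∫ θ, ‖θ‖ ^ 2 ∂(pushPath hρ₀ ψ t) ≤ Λ' := fun ψ hψ t => by
    refine (integral_norm_sq_pushPath_le hρ₀ hΛ ψ t).trans ?_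
    have := hψ.trans (le_abs_self r)
    rw [hΛ'e]
    gcongr
  obtain ⟨B, hB0, hB⟩ := h.exists_bound Λ' (k := k)
  obtain ⟨L, hL0, hL⟩ := h.act.exists_stability h.obj h.label_bdd R hΛ' (k := k)
  have hC := h.act.nonneg
  have hK := h.obj.nonneg
  set D := L * ((2 + |r| + |r|) * (2 * (1 + Λ))) with hD
  have hD0 : 0 ≤ D := by positivity
  set M₂ := B * (C * ((1 + B) ^ 2 + (1 + |r|) * (1 + B + B) * D + (1 + |r|) ^ 2 * D ^ 2)
          * (2 * (1 + Λ)))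
  have hM₂ : 0 ≤ M₂ := by positivity
  refine ⟨(B * K + K ^ 2) * D ^ 2 + M₂, by positivity, fun ψ χ hψ hχ x hx => ?_⟩
  set ρ := pushPath hρ₀ ψ
  set ρ' := pushPath hρ₀ χ
  have hb := hB ρ (meanMoment_le (hm ψ hψ)) x hx
  have hb' := hB ρ' (meanMoment_le (hm χ hχ)) x hx
  have hst : ∀ t ∈ Icc (0 : ℝ) 1, ‖Z f ρ' x t - Z f ρ x t‖ ≤ D * ‖χ - ψ‖ := fun t ht => by
    have := (hL ρ' ρ (hm χ hχ) (hm ψ hψ) _ (close_pushPath_of_norm_le hρ₀ hΛ0 hΛ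
      (hχ.trans (le_abs_self r)) (hψ.trans (le_abs_self r))) x x hx hx t ht).1
    rw [sub_self, norm_zero, add_zero] at this
    exact this.trans_eq (by rw [hD]; ring)
  have hone : (1 : ℝ) ∈ Icc (0 : ℝ) 1 := by simp
  have hcost := h.obj.half_sq_taylor_le (b := Z f ρ' x 1) (hb 1).2.2
  -- The linear term of the loss is by construction the pairing of p(1) with the change of the
  -- terminal state.
  rw [← h.act.adj_one g y ρ x] at hcost
  have hcost2 : (B * K + K ^ 2) * ‖Z f ρ' x 1 - Z f ρ x 1‖ ^ 2
      ≤ (B * K + K ^ 2) * D ^ 2 * ‖χ - ψ‖ ^ 2 := by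
    rw [mul_assoc, ← mul_pow]
    gcongr
    exact hst 1 hone
  set w : I01 → ℝ := fun t => pairAt ρ₀ (inputGrad f g y ρ ψ x) t (χ - ψ)
  obtain ⟨N, hN0, hN⟩ := h.exists_inputGrad_bound R ρ
  have hwc : Continuous w := continuous_pairAt hρ₀ (h.continuous_inputGrad_apply ρ ψ x)
    (hN ψ x hx) _
  have hwc' : Continuous fun s => w (toI01 s) := hwc.comp continuous_toI01
  -- Duality: when ⟨p, Z' - Z⟩ is differentiated, the adjoint equation cancels the linearized drift
  -- in z, and w is the first-order effect of the displacement. So u' is a Taylor remainder, u(0) =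
  -- 0 because the inputs agree, and u(1) compares the linear term of the loss with the integral of
  -- w.
  set u : ℝ → ℝ := fun t => inner ℝ (adj f g y ρ x t) (Z f ρ' x t - Z f ρ x t)
    - ∫ s in (0 : ℝ)..t, w (toI01 s)
  have hu : ∀ t ∈ Icc (0 : ℝ) 1, HasDerivWithinAt u
      (inner ℝ (adj f g y ρ x t) (drift f ρ' (toI01 t) (Z f ρ' x t) - drift f ρ (toI01 t) (Z f ρ x t)
        - driftDX f ρ (toI01 t) (Z f ρ x t) (Z f ρ' x t - Z f ρ x t)) - w (toI01 t))
      (Icc 0 1) t := fun t ht => by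
    have h1 := (h.act.hasDerivWithinAt_adj g y ρ x ht).inner ℝ
      ((h.act.hasDerivWithinAt_Z ρ' x ht).sub (h.act.hasDerivWithinAt_Z ρ x ht))
    have h2 : HasDerivAt (fun t => ∫ s in (0 : ℝ)..t, w (toI01 s)) (w (toI01 t)) t :=
      intervalIntegral.integral_hasDerivAt_right (hwc'.intervalIntegrable _ _)
        (hwc'.stronglyMeasurableAtFilter _ _) hwc'.continuousAt
    refine (h1.sub h2.hasDerivWithinAt).congr_deriv ?_
    simp only [Pi.sub_apply, inner_neg_left, ContinuousLinearMap.adjoint_inner_left,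
      inner_sub_right, map_sub]
    ring
  have hmv := (convex_Icc (0 : ℝ) 1).norm_image_sub_le_of_norm_hasDerivWithin_le
    (C := M₂ * ‖χ - ψ‖ ^ 2) hu (fun t ht => by
      have hbt := hb (toI01 t)
      have hbt' := hb' (toI01 t)
      rw [coe_toI01 ht] at hbt hbt'
      have := h.inner_drift_taylor_le hρ₀ hΛ (hψ.trans (le_abs_self r)) (toI01 t) hbt.1 hbt'.1
        hbt.2.1 (hst t ht) hD0
      have ew : w (toI01 t) = ∫ θ, inner ℝ
          (ContinuousLinearMap.adjoint (dTh f (Z f ρ x t) (disp ψ (toI01 t) θ)) (adj f g y ρ x t))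
          ((1 + ‖θ‖) • (χ - ψ) (toI01 t, θ)) ∂(ρ₀ (toI01 t)) := by
        simp only [w, pairAt, inputGrad, coe_toI01 ht]
      rw [ew]
      exact this)
    (left_mem_Icc.2 zero_le_one) hone
  have hu0 : u 0 = 0 := by
    simp only [u, h.act.Z_zero, sub_self, inner_zero_right, intervalIntegral.integral_same]
  have hu1 : u 1 = inner ℝ (adj f g y ρ x 1) (Z f ρ' x 1 - Z f ρ x 1) - ∫ t, w t := by
    simp only [u, intervalIntegral_toI01]
  rw [hu0, hu1, sub_zero, sub_zero, norm_one, mul_one, Real.norm_eq_abs] at hmv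
  rw [add_mul]
  calc _ = |(1 / 2 * (g (Z f ρ' x 1) - y x) ^ 2 - 1 / 2 * (g (Z f ρ x 1) - y x) ^ 2
          - inner ℝ (adj f g y ρ x 1) (Z f ρ' x 1 - Z f ρ x 1))
        + (inner ℝ (adj f g y ρ x 1) (Z f ρ' x 1 - Z f ρ x 1) - ∫ t, w t)| := by
        congr 1; ring
    _ ≤ _ := (abs_add_le _ _).trans (add_le_add (hcost.trans hcost2) hmv)

end Setting

end CostVariation

end MeanFieldResNet

namespace MeanFieldResNet

/-! ### Energy dissipation and the weak equation for transported measures -/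

section EnergyVariation

variable {d k : ℕ} {f : Vec d → Vec k → Vec d} {g y : Vec d → ℝ} {μ : Measure (Vec d)}
  {C K R : ℝ}

lemma ObjectiveBounds.continuous (hg : ObjectiveBounds g K) : Continuous g :=
  (LipschitzWith.of_dist_le' (K := K) fun a b => by
    rw [dist_eq_norm, dist_eq_norm]
    exact hg.sub_le a b).continuous

lemma exists_bounds_of_hasCompactSupport {u : Vec k → ℝ}
    (hu : ContDiff ℝ ((⊤ : ℕ∞) : WithTop ℕ∞) u) (hc : HasCompactSupport u) :
    ∃ c, 0 ≤ c ∧ (∀ z z', |u z - u z'| ≤ c * ‖z - z'‖) ∧ (∀ z, ‖fderiv ℝ u z‖ ≤ c) ∧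
      ∀ z z', ‖fderiv ℝ u z - fderiv ℝ u z'‖ ≤ c * ‖z - z'‖ := by
  obtain ⟨c₁, h1⟩ := hu.lipschitzWith_of_hasCompactSupport hc (by simp)
  obtain ⟨c₂, h2⟩ := (hu.fderiv_right (m := 1) (by norm_cast)).lipschitzWith_of_hasCompactSupport
    (hc.fderiv ℝ) one_ne_zero
  refine ⟨c₁ + c₂, by positivity, fun z z' => ?_, fun z => ?_, fun z z' => ?_⟩
  · have := h1.dist_le_mul z z'
    rw [dist_eq_norm, dist_eq_norm, Real.norm_eq_abs] at this
    exact this.trans (by gcongr; simp)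
  · exact (norm_fderiv_le_of_lipschitz ℝ h1).trans (by simp)
  · have := h2.dist_le_mul z z'
    rw [dist_eq_norm, dist_eq_norm] at this
    exact this.trans (by gcongr; simp)

/-- The weak formulation of the transport by displacements. -/
lemma hasDerivWithinAt_integral_pushPath {ρ₀ : PathP2 k} (hρ₀ : Admissible ρ₀) {u : Vec k → ℝ}
    (hu : ContDiff ℝ ((⊤ : ℕ∞) : WithTop ℕ∞) u) (hc : HasCompactSupport u) (t : I01)
    {ψ : ℝ → Disp k} {ψ' : Disp k} {S : Set ℝ} {s : ℝ} (hψ : HasDerivWithinAt ψ ψ' S s) :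
    HasDerivWithinAt (fun r => ∫ θ, u θ ∂(pushPath hρ₀ (ψ r) t))
      (pairAt ρ₀ (fun t θ => gradient u (disp (ψ s) t θ)) t ψ') S s := by
  obtain ⟨c, hc0, h1, h2, h3⟩ := exists_bounds_of_hasCompactSupport hu hc
  obtain ⟨Λ, -, hΛ⟩ := ρ₀.exists_moment_le
  have hn : ∀ z, ‖gradient u z‖ ≤ c := fun z => by
    rw [gradient, LinearIsometryEquiv.norm_map]
    exact h2 z
  have hgc : Continuous (gradient u) :=
    (InnerProductSpace.toDual ℝ (Vec k)).symm.continuous.comp (hu.continuous_fderiv (by simp))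
  obtain ⟨A, hA⟩ := exists_clm_pairAt (W := fun t θ => gradient u (disp (ψ s) t θ)) (N := c)
    (hgc.comp (continuous_disp (ψ s))) (fun t θ => (hn _).trans
      (le_mul_of_one_le_right hc0 (by linarith [norm_nonneg θ]))) ρ₀ t
  rw [← hA]
  refine hasDerivWithinAt_of_quadratic_bound (J := fun ψ => ∫ θ, u θ ∂(pushPath hρ₀ ψ t))
    (M := c * (2 * (1 + Λ))) (lt_add_one ‖ψ s‖) (fun χ _ => ?_) hψ
  rw [hA]
  refine integral_pushPath_taylor_le hρ₀ hc0 hΛ hc0 (fun z z' => (h1 z z').trans ?_)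
    (hu.differentiable (by simp)) h3 (N := c) (fun z => (hn z).trans
      (le_mul_of_one_le_right hc0 (by linarith [norm_nonneg z]))) (ψ s) χ t
  gcongr
  exact le_mul_of_one_le_right hc0 (by linarith [norm_nonneg z, norm_nonneg z'])

lemma continuous_two_smul_disp (ψ : Disp k) :
    Continuous (Function.uncurry fun t θ => (2 : ℝ) • disp ψ t θ) := by
  have := (continuous_const_smul (2 : ℝ)).comp (continuous_disp ψ)
  simpa only [Function.comp_def, Function.uncurry_def] using this

/-- Taylor estimate for the averaged second moment. -/
lemma meanMoment_taylor_le {ρ₀ : PathP2 k} (hρ₀ : Admissible ρ₀) {Λ : ℝ}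
    (hΛ : ∀ t, ∫ θ, ‖θ‖ ^ 2 ∂(ρ₀ t) ≤ Λ) (ψ χ : Disp k) :
    |meanMoment (pushPath hρ₀ χ) - meanMoment (pushPath hρ₀ ψ)
      - ∫ t, pairAt ρ₀ (fun t θ => (2 : ℝ) • disp ψ t θ) t (χ - ψ)|
      ≤ 2 * (2 * (1 + Λ)) * ‖χ - ψ‖ ^ 2 := by
  have hfd : ∀ z : Vec k, fderiv ℝ (fun θ : Vec k => ‖θ‖ ^ 2) z = 2 • innerSL ℝ z := fun z =>
    (hasStrictFDerivAt_norm_sq z).hasFDerivAt.fderiv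
  have hgr : ∀ z : Vec k, gradient (fun θ : Vec k => ‖θ‖ ^ 2) z = (2 : ℝ) • z := fun z => by
    refine ext_inner_right ℝ fun v => ?_
    rw [gradient, InnerProductSpace.toDual_symm_apply, hfd]
    simp [inner_smul_left]
  have hc1 : Continuous fun t => pairAt ρ₀ (fun t θ => (2 : ℝ) • disp ψ t θ) t (χ - ψ) :=
    continuous_pairAt (N := 2 * (1 + ‖ψ‖)) hρ₀ (continuous_two_smul_disp ψ)
      (fun t θ => by
        rw [norm_smul, mul_assoc, Real.norm_of_nonneg zero_le_two]
        gcongr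
        exact norm_disp_le ψ t θ) _
  have i1 := (pushPath hρ₀ χ).integrable_moment
  have i2 := (pushPath hρ₀ ψ).integrable_moment
  rw [meanMoment, meanMoment, ← integral_sub i1 i2]
  have s1 := integral_sub (i1.sub i2) (Continuous.integrable_I01 hc1)
  simp only [Pi.sub_apply] at s1
  rw [← s1, ← Real.norm_eq_abs]
  refine (norm_integral_le_of_norm_le_const (C := 2 * (2 * (1 + Λ)) * ‖χ - ψ‖ ^ 2)
    (ae_of_all _ fun t => ?_)).trans (by rw [probReal_univ, mul_one])
  have := integral_pushPath_taylor_le hρ₀ (F := fun θ : Vec k => ‖θ‖ ^ 2) zero_le_two hΛ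
    zero_le_one wLip_norm_sq (fun z => (hasStrictFDerivAt_norm_sq z).hasFDerivAt.differentiableAt)
    (fun z z' => by
      rw [hfd, hfd, ← smul_sub, ← map_sub]
      refine (norm_nsmul_le).trans ?_
      rw [innerSL_apply_norm]
      simp) (N := 2) (fun z => by
      rw [hgr, norm_smul, Real.norm_of_nonneg zero_le_two]
      linarith [norm_nonneg z]) ψ χ t
  simp only [hgr] at this
  exact this

namespace Setting

variable (h : Setting f g y μ C K R) [IsProbabilityMeasure μ]
include h

lemma integrable_prod {Y : Type*} [TopologicalSpace Y] [SecondCountableTopology Y]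
    [MeasurableSpace Y] [OpensMeasurableSpace Y] {ν : Measure Y} [SFinite ν] {u : Vec d × Y → ℝ}
    (hu : Continuous u) {b : Y → ℝ} (hb : Integrable b ν)
    (hub : ∀ x θ, ‖x‖ ≤ R → ‖u (x, θ)‖ ≤ b θ) : Integrable u (μ.prod ν) := by
  refine (hb.comp_snd μ).mono' hu.aestronglyMeasurable ?_
  filter_upwards [Measure.quasiMeasurePreserving_fst.ae h.supp] with q hq using hub q.1 q.2 hq

lemma integrable_of_continuous {u : Vec d → ℝ} (hu : Continuous u) : Integrable u μ := by
  obtain ⟨B, hB⟩ := (isCompact_closedBall (0 : Vec d) R).exists_bound_of_continuousOn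
    hu.continuousOn
  refine (integrable_const B).mono' hu.aestronglyMeasurable ?_
  filter_upwards [h.supp] with x hx using hB x (by simpa using hx)

omit [IsProbabilityMeasure μ] in
lemma continuous_inputCost (ρ : PathP2 k) :
    Continuous fun x => 1 / 2 * (g (Z f ρ x 1) - y x) ^ 2 := by
  have h1 : Continuous fun x : Vec d => (x, (1 : I01)) := by fun_prop
  have h2 := (h.continuous_Z ρ).comp h1
  simp only [Function.comp_def, Icc.coe_one] at h2
  exact continuous_const.mul (((h.obj.continuous.comp h2).sub h.label_cont).pow 2)

variable {ρ₀ : PathP2 k} (hρ₀ : Admissible ρ₀)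
include hρ₀

omit [IsProbabilityMeasure μ] in
lemma continuous_pairAt_inputGrad (ρ : PathP2 k) (ψ χ : Disp k) :
    Continuous fun q : Vec d × I01 => pairAt ρ₀ (inputGrad f g y ρ ψ q.1) q.2 χ := by
  refine hρ₀.continuous_integral (W := Vec d × I01) (τ := Prod.snd) continuous_snd
    (G := fun q θ => inner ℝ (inputGrad f g y ρ ψ q.1 q.2 θ) ((1 + ‖θ‖) • χ (q.2, θ))) ?_ ?_
  · have h1 : Continuous fun q : (Vec d × I01) × Vec k => (q.1.1, q.1.2, q.2) := by fun_prop
    have h2 : Continuous fun q : (Vec d × I01) × Vec k => (q.1.2, q.2) := by fun_prop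
    have h3 := ((h.continuous_inputGrad ρ ψ).comp h1).inner (𝕜 := ℝ)
      ((continuous_smul_disp χ).comp h2)
    simpa only [Function.comp_def, Function.uncurry_def] using h3
  · rintro ⟨x₀, t₀⟩
    obtain ⟨N, hN0, hN⟩ := h.exists_inputGrad_bound (‖x₀‖ + 1) ρ
    refine ⟨N * ‖χ‖, ?_⟩
    have : ∀ᶠ q : Vec d × I01 in 𝓝 (x₀, t₀), ‖q.1‖ < ‖x₀‖ + 1 :=
      ((continuous_norm.comp continuous_fst).tendsto (x₀, t₀)).eventually
        (gt_mem_nhds (lt_add_one _))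
    filter_upwards [this] with q hq θ
    exact norm_inner_smul_disp_le (hN ψ q.1 hq.le q.2 θ) χ

/-- Two applications of Fubini's theorem, first in (x,t) and then in (x,θ), move the expectation
over inputs inside the pairing. -/
lemma integral_pairAt_inputGrad (ρ : PathP2 k) (ψ χ : Disp k) :
    ∫ x, (∫ t, pairAt ρ₀ (inputGrad f g y ρ ψ x) t χ) ∂μ
      = ∫ t, pairAt ρ₀ (fun t θ => costGrad f g y μ ρ t (disp ψ t θ)) t χ := by
  obtain ⟨N, hN0, hN⟩ := h.exists_inputGrad_bound R ρ
  obtain ⟨Λ, hΛ0, hΛ⟩ := ρ₀.exists_moment_le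
  have i0 := h.integrable_prod (ν := (volume : Measure I01))
    (h.continuous_pairAt_inputGrad hρ₀ ρ ψ χ) (integrable_const (N * (2 * (1 + Λ)) * ‖χ‖))
    fun x t hx => abs_pairAt_le (hN ψ x hx) hΛ t χ
  rw [integral_integral_swap (f := fun x t => pairAt ρ₀ (inputGrad f g y ρ ψ x) t χ) i0]
  congr 1
  ext1 t
  simp only [pairAt]
  have h1 : Continuous fun q : Vec d × Vec k => (q.1, t, q.2) := by fun_prop
  have h2 : Continuous fun q : Vec d × Vec k => (t, q.2) := by fun_prop
  have h3 := ((h.continuous_inputGrad ρ ψ).comp h1).inner (𝕜 := ℝ)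
    ((continuous_smul_disp χ).comp h2)
  simp only [Function.comp_def] at h3
  rw [integral_integral_swap
    (f := fun x θ => inner ℝ (inputGrad f g y ρ ψ x t θ) ((1 + ‖θ‖) • χ (t, θ)))
    (h.integrable_prod (ν := ρ₀ t) h3 ((ρ₀.at_time t).integrable_one_add_sq.const_mul (N * ‖χ‖))
      fun x θ hx => norm_inner_smul_disp_le (hN ψ x hx t θ) χ)]
  congr 1
  ext1 θ
  rw [h.inner_costGrad]
  simp only [inputGrad, ContinuousLinearMap.adjoint_inner_left]

/-- Taylor estimate for the cost. -/
lemma exists_cost_taylor (r : ℝ) :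
    ∃ M, 0 ≤ M ∧ ∀ ψ χ : Disp k, ‖ψ‖ ≤ r → ‖χ‖ ≤ r →
      |cost f g y μ (pushPath hρ₀ χ) - cost f g y μ (pushPath hρ₀ ψ)
        - ∫ t, pairAt ρ₀ (fun t θ => costGrad f g y μ (pushPath hρ₀ ψ) t (disp ψ t θ)) t (χ - ψ)|
      ≤ M * ‖χ - ψ‖ ^ 2 := by
  obtain ⟨M, hM0, hM⟩ := h.exists_inputCost_taylor hρ₀ r
  obtain ⟨Λ, hΛ0, hΛ⟩ := ρ₀.exists_moment_le
  refine ⟨M, hM0, fun ψ χ hψ hχ => ?_⟩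
  obtain ⟨N, hN0, hN⟩ := h.exists_inputGrad_bound R (pushPath hρ₀ ψ)
  rw [← h.integral_pairAt_inputGrad hρ₀, cost, cost]
  have i1 := h.integrable_of_continuous (h.continuous_inputCost (pushPath hρ₀ χ))
  have i2 := h.integrable_of_continuous (h.continuous_inputCost (pushPath hρ₀ ψ))
  have i3 := (h.integrable_prod (ν := (volume : Measure I01))
      (h.continuous_pairAt_inputGrad hρ₀ (pushPath hρ₀ ψ) ψ (χ - ψ))
      (integrable_const (N * (2 * (1 + Λ)) * ‖χ - ψ‖))
      fun x t hx => abs_pairAt_le (hN ψ x hx) hΛ t (χ - ψ)).integral_prod_left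
  rw [← integral_sub i1 i2]
  have s1 := integral_sub (i1.sub i2) i3
  simp only [Pi.sub_apply] at s1
  rw [← s1, ← Real.norm_eq_abs]
  refine (norm_integral_le_of_norm_le_const (C := M * ‖χ - ψ‖ ^ 2) ?_).trans
    (by rw [probReal_univ, mul_one])
  filter_upwards [h.supp] with x hx using hM ψ χ hψ hχ x hx

/-- Energy dissipation along solutions of the equation for displacements. -/
lemma hasDerivWithinAt_energy {ψ : ℝ → Disp k} {S : Set ℝ} {s : ℝ}
    (hψ : HasDerivWithinAt ψ (h.vecField (pushPath hρ₀ (ψ s)) s (ψ s)) S s) :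
    ∃ e ≤ 0, HasDerivWithinAt (fun u => energy f g y μ u (pushPath hρ₀ (ψ u))) e S s := by
  obtain ⟨Λ, hΛ0, hΛ⟩ := ρ₀.exists_moment_le
  set ρ := pushPath hρ₀ (ψ s) with hρ
  set V := h.vecField ρ s (ψ s) with hV
  obtain ⟨M, hM0, hM⟩ := h.exists_cost_taylor hρ₀ (‖ψ s‖ + 1)
  obtain ⟨B, hB0, hB⟩ := h.exists_costGrad_bound (meanMoment ρ) (k := k)
  set W₁ : I01 → Vec k → Vec k := fun t θ => costGrad f g y μ ρ t (disp (ψ s) t θ) with hW₁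
  set W₂ : I01 → Vec k → Vec k := fun t θ => (2 : ℝ) • disp (ψ s) t θ with hW₂
  have c1 : Continuous (Function.uncurry W₁) := by
    have := (h.continuous_costGrad ρ).comp (continuous_fst.prodMk (continuous_disp (ψ s)))
    simpa only [Function.comp_def, Function.uncurry_def] using this
  have c2 : Continuous (Function.uncurry W₂) := continuous_two_smul_disp (ψ s)
  have b1 : ∀ t θ, ‖W₁ t θ‖ ≤ B * (1 + ‖θ‖) := fun t θ => ((hB ρ le_rfl t _).1).trans
    (le_mul_of_one_le_right hB0 (by linarith [norm_nonneg θ]))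
  have b2 : ∀ t θ, ‖W₂ t θ‖ ≤ 2 * (1 + ‖ψ s‖) * (1 + ‖θ‖) := fun t θ => by
    rw [hW₂, norm_smul, mul_assoc, Real.norm_of_nonneg zero_le_two]
    gcongr
    exact norm_disp_le _ t θ
  obtain ⟨A₁, hA₁⟩ := exists_clm_integral_pairAt hρ₀ c1 b1
  obtain ⟨A₂, hA₂⟩ := exists_clm_integral_pairAt hρ₀ c2 b2
  have d1 := hasDerivWithinAt_of_quadratic_bound (J := fun ψ => cost f g y μ (pushPath hρ₀ ψ))
    (A := A₁) (M := M) (lt_add_one ‖ψ s‖) (fun χ hχ => by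
      rw [hA₁]
      exact hM (ψ s) χ (by linarith) hχ) hψ
  have d2 := hasDerivWithinAt_of_quadratic_bound (J := fun ψ => meanMoment (pushPath hρ₀ ψ))
    (A := A₂) (lt_add_one ‖ψ s‖) (fun χ _ => by
      rw [hA₂]
      exact meanMoment_taylor_le hρ₀ hΛ (ψ s) χ) hψ
  have d3 : HasDerivWithinAt (fun u : ℝ => Real.exp (-u)) (-Real.exp (-s)) S s := by
    simpa using ((hasDerivAt_neg s).exp).hasDerivWithinAt (s := S)
  refine ⟨A₁ V + (-Real.exp (-s) * meanMoment ρ + Real.exp (-s) * A₂ V), ?_, d1.add (d3.mul d2)⟩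
  have hm := meanMoment_nonneg ρ
  have he := Real.exp_pos (-s)
  -- At the displaced point (1 + |θ|)V is minus the energy gradient, so the integrand is minus its
  -- squared norm. The remaining term comes from differentiating e^{-s} and is also nonpositive.
  have key : A₁ V + Real.exp (-s) * A₂ V ≤ 0 := by
    rw [hA₁, hA₂, ← integral_const_mul, ← integral_add
      (Continuous.integrable_I01 (continuous_pairAt hρ₀ c1 b1 V))
      ((Continuous.integrable_I01 (continuous_pairAt hρ₀ c2 b2 V)).const_mul _)]
    refine integral_nonpos fun t => ?_
    simp only [Pi.zero_apply]
    rw [pairAt, pairAt, ← integral_const_mul, ← integral_add (integrable_pairAt c1 b1 ρ₀ t V)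
      ((integrable_pairAt c2 b2 ρ₀ t V).const_mul _)]
    refine integral_nonpos fun θ => ?_
    have e : W₁ t θ + Real.exp (-s) • W₂ t θ = h.energyGrad ρ s t (disp (ψ s) t θ) := by
      simp only [hW₁, hW₂, energyGrad, smul_smul, mul_comm]
    have e2 := h.smul_vecField_apply ρ s (ψ s) t θ
    simp only [Pi.zero_apply]
    rw [← real_inner_smul_left, ← inner_add_left, e, hV, e2, inner_neg_right,
      real_inner_self_eq_norm_sq]
    exact neg_nonpos.2 (by positivity)
  have : 0 ≤ Real.exp (-s) * meanMoment ρ := by positivity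
  linarith

/-- The change of variables by `disp ψ t` turns the derivative along the displacement into the right
side of the weak equation. -/
lemma pairAt_gradient_vecField {u : Vec k → ℝ} (hu : Continuous (gradient u)) (σ : PathP2 k)
    (s : ℝ) (ψ : Disp k) (t : I01) :
    pairAt ρ₀ (fun t θ => gradient u (disp ψ t θ)) t (h.vecField σ s ψ)
      = -∫ θ, inner ℝ (gradient u θ) (h.energyGrad σ s t θ) ∂(pushPath hρ₀ ψ t) := by
  have hc : Continuous fun θ : Vec k => (t, θ) := by fun_prop
  have hc2 := (h.continuous_energyGrad σ s).comp hc
  simp only [Function.comp_def] at hc2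
  rw [integral_pushPath hρ₀ ψ t (hu.inner (𝕜 := ℝ) hc2), pairAt, ← integral_neg]
  congr 1
  ext1 θ
  rw [h.smul_vecField_apply, inner_neg_right]

end Setting

end EnergyVariation

end MeanFieldResNet

namespace MeanFieldResNet

/-! ### The solution of the gradient flow -/

section Solution

variable {d k : ℕ} {f : Vec d → Vec k → Vec d} {g y : Vec d → ℝ} {μ : Measure (Vec d)}
  {C K R : ℝ} [IsProbabilityMeasure μ]

namespace Setting

variable (h : Setting f g y μ C K R) {ρ₀ : PathP2 k} (hρ₀ : Admissible ρ₀)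
include h

lemma antitoneOn_energy {ψ : ℝ → Disp k} {S : Set ℝ} (hS : Convex ℝ S)
    (hψ : ∀ s ∈ S, HasDerivWithinAt ψ (h.vecField (pushPath hρ₀ (ψ s)) s (ψ s)) S s) :
    AntitoneOn (fun s => energy f g y μ s (pushPath hρ₀ (ψ s))) S := by
  have key := fun s hs => h.hasDerivWithinAt_energy hρ₀ (hψ s hs)
  choose! e he0 he using key
  exact antitoneOn_of_hasDerivWithinAt_nonpos hS (fun s hs => (he s hs).continuousWithinAt)
    (fun s hs => (he s (interior_subset hs)).mono interior_subset)
    fun s hs => he0 s (interior_subset hs)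

omit [IsProbabilityMeasure μ] h in
-- This is the only coercivity available: the regularizer controls the second moment averaged over
-- the layers.
lemma exp_mul_meanMoment_le_energy (s : ℝ) (ρ : PathP2 k) :
    Real.exp (-s) * meanMoment ρ ≤ energy f g y μ s ρ := by
  have : 0 ≤ ∫ x, 1 / 2 * (g (Z f ρ x 1) - y x) ^ 2 ∂μ := integral_nonneg fun _ => by positivity
  rw [energy]
  exact le_add_of_nonneg_left this

/-- A priori bound for solutions of the equation for displacements. -/
lemma exists_norm_le_of_solution (T : ℝ) :
    ∃ B, ∀ S ∈ Icc 0 T, ∀ ψ : ℝ → Disp k, ψ 0 = 0 →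
      (∀ s ∈ Icc 0 S, HasDerivWithinAt ψ (h.vecField (pushPath hρ₀ (ψ s)) s (ψ s)) (Icc 0 S) s) →
      ‖ψ S‖ ≤ B := by
  set E₀ := energy f g y μ 0 (pushPath hρ₀ 0) with hE₀
  have hE₀' : 0 ≤ E₀ := (mul_nonneg (Real.exp_pos _).le (meanMoment_nonneg _)).trans
    (exp_mul_meanMoment_le_energy 0 _)
  obtain ⟨B, hB0, hB⟩ := h.exists_costGrad_bound (Real.exp T * E₀) (k := k)
  refine ⟨gronwallBound 0 2 (B + 2) T, fun S hS ψ hψ0 hψ => ?_⟩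
  -- Monotonicity gives e^{-s} times the mean moment ≤ E₀, the energy at zero displacement. On [0,T]
  -- the mean moment is then at most e^T E₀, independently of the solution.
  have hmom : ∀ s ∈ Icc 0 S, meanMoment (pushPath hρ₀ (ψ s)) ≤ Real.exp T * E₀ := fun s hs => by
    have h1 := h.antitoneOn_energy hρ₀ (convex_Icc 0 S) hψ (left_mem_Icc.2 hS.1) hs hs.1
    simp only [hψ0] at h1
    have h2 := (exp_mul_meanMoment_le_energy s (pushPath hρ₀ (ψ s))).trans h1
    rw [Real.exp_neg, inv_mul_le_iff₀ (Real.exp_pos s)] at h2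
    refine h2.trans ?_
    rw [← hE₀]
    gcongr
    exact hs.2.trans hS.2
  have hgr := norm_le_gronwallBound_of_norm_deriv_right_le (f := ψ) (δ := 0) (K := 2)
    (ε := B + 2) (a := 0) (b := S) (fun s hs => (hψ s hs).continuousWithinAt)
    (fun s hs => (hψ s (Ico_subset_Icc_self hs)).mono_of_mem_nhdsWithin
      (mem_of_superset (Icc_mem_nhdsGE hs.2) (Icc_subset_Icc_left hs.1))) (by simp [hψ0])
    (fun s hs => h.norm_vecField_le _ hs.1 _ fun t θ =>
      (hB _ (hmom s (Ico_subset_Icc_self hs)) t θ).1) S (right_mem_Icc.2 hS.1)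
  refine hgr.trans (gronwallBound_mono le_rfl (by positivity) zero_le_two ?_)
  linarith [hS.2]

/-- Global existence for the equation for displacements. -/
lemma exists_solution :
    ∃ ψ : ℝ → Disp k, ψ 0 = 0 ∧ ∀ s ∈ Ici (0 : ℝ),
      HasDerivWithinAt ψ (h.vecField (pushPath hρ₀ (ψ s)) s (ψ s)) (Ici 0) s := by
  refine exists_solution_Ici_of_bound (v := fun s ψ => h.vecField (pushPath hρ₀ ψ) s ψ)
    (fun ψ => (h.continuous_vecField_of_close (σ := fun _ => pushPath hρ₀ ψ)
      (fun _ η hη => Eventually.of_forall fun _ => (close_self _).mono hη.le) ψ).continuousOn)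
    (fun T r => ?_) fun T _ => h.exists_norm_le_of_solution hρ₀ T
  obtain ⟨L, hL⟩ := h.exists_lipschitzOn_vecField_pushPath hρ₀ r
  exact ⟨L, fun s hs => hL s hs.1⟩

/-- Uniqueness for the equation for displacements. -/
lemma eqOn_of_solution {ψ χ : ℝ → Disp k} (h0 : ψ 0 = χ 0)
    (hψ : ∀ s ∈ Ici (0 : ℝ),
      HasDerivWithinAt ψ (h.vecField (pushPath hρ₀ (ψ s)) s (ψ s)) (Ici 0) s)
    (hχ : ∀ s ∈ Ici (0 : ℝ),
      HasDerivWithinAt χ (h.vecField (pushPath hρ₀ (χ s)) s (χ s)) (Ici 0) s) :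
    EqOn ψ χ (Ici 0) := fun s hs =>
  ode_unique_of_lipschitzOn_ball (T := s) (v := fun s ψ => h.vecField (pushPath hρ₀ ψ) s ψ)
    (fun r => by
      obtain ⟨L, hL⟩ := h.exists_lipschitzOn_vecField_pushPath hρ₀ r
      exact ⟨L, fun s hs => hL s hs.1⟩) h0
    (fun r hr => (hψ r hr.1).mono Icc_subset_Ici_self)
    (fun r hr => (hχ r hr.1).mono Icc_subset_Ici_self) ⟨hs, le_rfl⟩

/-- Transport by displacements solves the linear continuity equation. -/
lemma hasDerivAt_integral_pushPath {σ : PathP2 k} {ψ : ℝ → Disp k} {s : ℝ} (hs : 0 < s)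
    (hψ : HasDerivWithinAt ψ (h.vecField σ s (ψ s)) (Ici 0) s) {u : Vec k → ℝ}
    (hu : ContDiff ℝ ((⊤ : ℕ∞) : WithTop ℕ∞) u) (hc : HasCompactSupport u) (t : I01) :
    HasDerivAt (fun r => ∫ θ, u θ ∂(pushPath hρ₀ (ψ r) t))
      (-∫ θ, inner ℝ (gradient u θ) (h.energyGrad σ s t θ) ∂(pushPath hρ₀ (ψ s) t)) s := by
  have hgc : Continuous (gradient u) :=
    (InnerProductSpace.toDual ℝ (Vec k)).symm.continuous.comp (hu.continuous_fderiv (by simp))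
  rw [← h.pairAt_gradient_vecField hρ₀ hgc]
  exact hasDerivWithinAt_integral_pushPath hρ₀ hu hc t (hψ.hasDerivAt (Ici_mem_nhds hs)).hasDerivWithinAt
    |>.hasDerivAt univ_mem

lemma isSolution_pushFlow {ψ : ℝ → Disp k} (h0 : ψ 0 = 0)
    (hψ : ∀ s ∈ Ici (0 : ℝ),
      HasDerivWithinAt ψ (h.vecField (pushPath hρ₀ (ψ s)) s (ψ s)) (Ici 0) s) :
    IsSolution f g y μ ρ₀ (pushFlow hρ₀ ψ fun s hs => (hψ s hs).continuousWithinAt) := by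
  refine ⟨?_, fun t u hu hc s hs => ?_⟩
  · change pushPath hρ₀ (ψ ((0 : ℝ≥0) : ℝ)) = ρ₀
    rw [NNReal.coe_zero, h0, pushPath_zero]
  · have h1 := h.hasDerivAt_integral_pushPath hρ₀ hs (hψ s hs.le) hu hc t
    simp only [energyGrad, ← h.gradient_energyDeriv] at h1
    have e : ∀ r : ℝ, 0 < r → (pushFlow hρ₀ ψ fun s hs => (hψ s hs).continuousWithinAt) r.toNNReal
        = pushPath hρ₀ (ψ r) := fun r hr => by
      change pushPath hρ₀ (ψ (r.toNNReal : ℝ)) = _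
      rw [Real.coe_toNNReal _ hr.le]
    rw [e s hs]
    refine h1.congr_of_eventuallyEq ?_
    filter_upwards [lt_mem_nhds hs] with r hr
    rw [e r hr]

lemma differentiableAt_energy {ψ : ℝ → Disp k} {s : ℝ} (hs : 0 < s)
    (hψ : HasDerivWithinAt ψ (h.vecField (pushPath hρ₀ (ψ s)) s (ψ s)) (Ici 0) s) :
    DifferentiableAt ℝ (fun u => energy f g y μ u (pushPath hρ₀ (ψ u))) s ∧
      deriv (fun u => energy f g y μ u (pushPath hρ₀ (ψ u))) s ≤ 0 := by
  obtain ⟨e, he0, he⟩ := h.hasDerivWithinAt_energy hρ₀ hψ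
  have := he.hasDerivAt (Ici_mem_nhds hs)
  exact ⟨this.differentiableAt, by rwa [this.deriv]⟩

end Setting

end Solution

end MeanFieldResNet

namespace MeanFieldResNet

/-! ### Uniqueness for the linear continuity equation -/

section ContinuityEquation

variable {k : ℕ}

lemma withDensity_rnDeriv_eq_of_finite {E : Type*} [MeasurableSpace E] {μ ν : Measure E}
    [IsFiniteMeasure μ] [IsFiniteMeasure ν] (hμ : μ ≪ ν) : ν.withDensity (μ.rnDeriv ν) = μ := by
  have := Measure.haveLebesgueDecomposition_of_sigmaFinite μ ν
  exact Measure.withDensity_rnDeriv_eq μ ν hμ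

lemma integral_mul_rnDeriv_of_finite {E : Type*} [MeasurableSpace E] {μ ν : Measure E}
    [IsFiniteMeasure μ] [IsFiniteMeasure ν] (hμ : μ ≪ ν) (u : E → ℝ) :
    ∫ x, u x * (μ.rnDeriv ν x).toReal ∂ν = ∫ x, u x ∂μ := by
  have := Measure.haveLebesgueDecomposition_of_sigmaFinite μ ν
  rw [← integral_rnDeriv_smul hμ]
  simp only [smul_eq_mul, mul_comm]

/-- Finite measures are determined by integrals of test functions. -/
lemma measure_eq_of_integral_contDiff_eq {μ ν : Measure (Vec k)} [IsFiniteMeasure μ]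
    [IsFiniteMeasure ν] (h : ∀ u : Vec k → ℝ, ContDiff ℝ ((⊤ : ℕ∞) : WithTop ℕ∞) u →
      HasCompactSupport u → ∫ θ, u θ ∂μ = ∫ θ, u θ ∂ν) : μ = ν := by
  have hμ : μ ≪ μ + ν := Measure.le_add_right le_rfl |>.absolutelyContinuous
  have hν : ν ≪ μ + ν := Measure.le_add_left le_rfl |>.absolutelyContinuous
  -- Both measures have integrable densities with respect to μ + ν, and smooth test functions
  -- separate such densities.
  have key := ae_eq_of_integral_contDiff_smul_eq (μ := μ + ν)
    (f := fun θ => (μ.rnDeriv (μ + ν) θ).toReal) (f' := fun θ => (ν.rnDeriv (μ + ν) θ).toReal)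
    Measure.integrable_toReal_rnDeriv.locallyIntegrable
    Measure.integrable_toReal_rnDeriv.locallyIntegrable fun u hu hc => by
      simp only [smul_eq_mul]
      rw [integral_mul_rnDeriv_of_finite hμ, integral_mul_rnDeriv_of_finite hν]
      exact h u hu hc
  calc μ = (μ + ν).withDensity (μ.rnDeriv (μ + ν)) := (withDensity_rnDeriv_eq_of_finite hμ).symm
    _ = (μ + ν).withDensity (ν.rnDeriv (μ + ν)) := by
        refine withDensity_congr_ae ?_
        filter_upwards [key, μ.rnDeriv_lt_top (μ + ν), ν.rnDeriv_lt_top (μ + ν)] with θ h1 h2 h3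
        exact (ENNReal.toReal_eq_toReal_iff' h2.ne h3.ne).1 h1
    _ = ν := withDensity_rnDeriv_eq_of_finite hν

/-- Smooth approximation of Lipschitz vector fields with bounds on two derivatives. -/
lemma exists_mollification {L ε : ℝ} (hL : 0 ≤ L) (hε : 0 < ε) :
    ∃ M, 0 ≤ M ∧ ∀ b : Vec k → Vec k, (∀ x y, ‖b x - b y‖ ≤ L * ‖x - y‖) →
      ∃ b' : Vec k → Vec k, ContDiff ℝ ((⊤ : ℕ∞) : WithTop ℕ∞) b' ∧
        (∀ x, ‖b' x - b x‖ ≤ L * ε) ∧ (∀ x, ‖fderiv ℝ b' x‖ ≤ L) ∧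
        ∀ x y, ‖fderiv ℝ b' x - fderiv ℝ b' y‖ ≤ M * ‖x - y‖ := by
  -- The kernel is supported in the ball of radius ε, so averaging an L-Lipschitz field changes it
  -- by at most L·ε.
  let φ : ContDiffBump (0 : Vec k) := ⟨ε / 2, ε, half_pos hε, half_lt_self hε⟩
  set η : Vec k → ℝ := φ.normed volume with hη
  have hηc : HasCompactSupport η := φ.hasCompactSupport_normed
  have hηd : ContDiff ℝ 1 η := φ.contDiff_normed
  have hfc : Continuous (fderiv ℝ η) := hηd.continuous_fderiv one_ne_zero
  have hfi : Integrable (fun t => ‖fderiv ℝ η t‖) :=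
    (hfc.integrable_of_hasCompactSupport (hηc.fderiv ℝ)).norm
  have hηi : Integrable η := hηd.continuous.integrable_of_hasCompactSupport hηc
  -- One derivative falls on the kernel and the Lipschitz bound of b supplies the other. The
  -- resulting M does not depend on b, as needed when each Euler step mollifies a different field.
  set M := L * ∫ t, ‖fderiv ℝ η t‖ with hM
  have hM0 : 0 ≤ M := mul_nonneg hL (integral_nonneg fun _ => norm_nonneg _)
  refine ⟨M, hM0, fun b hb => ?_⟩
  have hbc : Continuous b := (LipschitzWith.of_dist_le' (K := L) fun x y => by
    rw [dist_eq_norm, dist_eq_norm]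
    exact hb x y).continuous
  let Λ := ContinuousLinearMap.lsmul ℝ ℝ (E := Vec k)
  set b' : Vec k → Vec k := convolution η b Λ volume with hb'
  have hder : ∀ x, HasFDerivAt b' (convolution (fderiv ℝ η) b (Λ.precompL (Vec k)) volume x) x :=
    fun x => hηc.hasFDerivAt_convolution_left Λ hηd hbc.locallyIntegrable x
  have hint : ∀ x, Integrable (fun t => Λ (η t) (b (x - t))) := fun x =>
    ((hηd.continuous.smul (hbc.comp (by fun_prop : Continuous fun t => x - t)))
      ).integrable_of_hasCompactSupport (hηc.smul_right)
  have hlip : ∀ x y, ‖b' x - b' y‖ ≤ L * ‖x - y‖ := fun x y => by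
    rw [hb', convolution, convolution, ← integral_sub (hint x) (hint y)]
    calc _ ≤ ∫ t, η t * (L * ‖x - y‖) := by
          refine norm_integral_le_of_norm_le (hηi.mul_const _) (ae_of_all _ fun t => ?_)
          rw [← map_sub]
          change ‖η t • (b (x - t) - b (y - t))‖ ≤ _
          rw [norm_smul, Real.norm_of_nonneg (φ.nonneg_normed t)]
          gcongr
          · exact φ.nonneg_normed t
          · simpa using hb (x - t) (y - t)
      _ = _ := by rw [integral_mul_const, φ.integral_normed, one_mul]
  refine ⟨b', hηc.contDiff_convolution_left Λ φ.contDiff_normed hbc.locallyIntegrable,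
    fun x => ?_, fun x => (hder x).differentiableAt.hasFDerivAt.le_of_lip' hL
      (Eventually.of_forall fun y => hlip y x), fun x y => ?_⟩
  · rw [← dist_eq_norm]
    refine φ.dist_normed_convolution_le hbc.aestronglyMeasurable fun y hy => ?_
    rw [dist_eq_norm]
    refine (hb y x).trans ?_
    gcongr
    rw [← dist_eq_norm]
    exact (Metric.mem_ball.1 hy).le
  · rw [(hder x).fderiv, (hder y).fderiv, convolution, convolution]
    have hint2 : ∀ x, Integrable (fun t => Λ.precompL (Vec k) (fderiv ℝ η t) (b (x - t))) :=
      fun x => by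
      refine Continuous.integrable_of_hasCompactSupport ?_ ?_
      · exact ((Λ.precompL (Vec k)).continuous.comp hfc).clm_apply
          (hbc.comp (by fun_prop : Continuous fun t => x - t))
      · refine (hηc.fderiv ℝ).mono fun t ht => ?_
        contrapose! ht
        simp only [Function.mem_support, not_not] at ht ⊢
        rw [ht, map_zero, zero_apply]
    rw [← integral_sub (hint2 x) (hint2 y)]
    calc _ ≤ ∫ t, ‖fderiv ℝ η t‖ * (L * ‖x - y‖) := by
          refine norm_integral_le_of_norm_le (hfi.mul_const _) (ae_of_all _ fun t => ?_)
          rw [← map_sub]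
          refine (ContinuousLinearMap.le_opNorm _ _).trans ?_
          gcongr
          · refine (ContinuousLinearMap.le_opNorm _ _).trans
              (mul_le_of_le_one_left (norm_nonneg _) ?_)
            exact (ContinuousLinearMap.norm_precompL_le _ _).trans
              (ContinuousLinearMap.opNorm_lsmul_le)
          · simpa using hb (x - t) (y - t)
      _ = _ := by rw [integral_mul_const, hM]; ring

end ContinuityEquation

end MeanFieldResNet

namespace MeanFieldResNet

/-! ### Euler steps for the continuity equation: propagation of test functions and one-step error.
-/

section EulerScheme

variable {k : ℕ}

/-- Test functions with bounds on two derivatives. -/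
structure TestBounds (A M : ℝ) (u : Vec k → ℝ) : Prop where
  contDiff : ContDiff ℝ ((⊤ : ℕ∞) : WithTop ℕ∞) u
  hasCompactSupport : HasCompactSupport u
  norm_fderiv_le : ∀ z, ‖fderiv ℝ u z‖ ≤ A
  fderiv_sub_le : ∀ z z', ‖fderiv ℝ u z - fderiv ℝ u z'‖ ≤ M * ‖z - z'‖

lemma TestBounds.mono {A A' M M' : ℝ} {u : Vec k → ℝ} (h : TestBounds A M u) (hA : A ≤ A')
    (hM : M ≤ M') : TestBounds A' M' u :=
  ⟨h.1, h.2, fun z => (h.3 z).trans hA, fun z z' => (h.4 z z').trans (by gcongr)⟩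

lemma TestBounds.nonneg {A M : ℝ} {u : Vec k → ℝ} (h : TestBounds A M u) : 0 ≤ A :=
  (norm_nonneg _).trans (h.3 0)

lemma TestBounds.differentiable {A M : ℝ} {u : Vec k → ℝ} (h : TestBounds A M u) :
    Differentiable ℝ u := h.contDiff.differentiable (by simp)

lemma TestBounds.sub_le {A M : ℝ} {u : Vec k → ℝ} (h : TestBounds A M u) (x y : Vec k) :
    |u x - u y| ≤ A * ‖x - y‖ :=
  convex_univ.norm_image_sub_le_of_norm_fderiv_le (𝕜 := ℝ) (fun x _ => h.differentiable x)
    (fun x _ => h.3 x) (mem_univ y) (mem_univ x)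

/-- Composition of a test function with one step of the Euler scheme. -/
lemma TestBounds.comp_euler {A M L N δ : ℝ} {u : Vec k → ℝ} (hu : TestBounds A M u) (hM : 0 ≤ M)
    {b : Vec k → Vec k} (hb : ContDiff ℝ ((⊤ : ℕ∞) : WithTop ℕ∞) b)
    (hbL : ∀ x, ‖fderiv ℝ b x‖ ≤ L)
    (hbN : ∀ x y, ‖fderiv ℝ b x - fderiv ℝ b y‖ ≤ N * ‖x - y‖) (hδ : 0 ≤ δ)
    (hδL : δ * L ≤ 1 / 2) :
    TestBounds (A * Real.exp (L * δ)) ((M + δ * A * N) * Real.exp (2 * L * δ))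
      (fun x => u (x - δ • b x)) := by
  have hA := hu.nonneg
  have hL : 0 ≤ L := (norm_nonneg _).trans (hbL 0)
  have hbd : Differentiable ℝ b := hb.differentiable (by simp)
  have hblip : ∀ x y, ‖b x - b y‖ ≤ L * ‖x - y‖ := fun x y =>
    convex_univ.norm_image_sub_le_of_norm_fderiv_le (𝕜 := ℝ) (fun x _ => hbd x)
      (fun x _ => hbL x) (mem_univ y) (mem_univ x)
  set Φ : Vec k → Vec k := fun x => x - δ • b x with hΦ
  have hΦ' : ∀ x, HasFDerivAt Φ (ContinuousLinearMap.id ℝ (Vec k) - δ • fderiv ℝ b x) x :=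
    fun x => (hasFDerivAt_id x).sub ((hbd x).hasFDerivAt.const_smul δ)
  have hΦlip : ∀ x y, ‖Φ x - Φ y‖ ≤ (1 + δ * L) * ‖x - y‖ := fun x y => by
    have e : Φ x - Φ y = (x - y) - δ • (b x - b y) := by simp only [hΦ, smul_sub]; abel
    rw [e]
    refine (norm_sub_le _ _).trans ?_
    rw [norm_smul, Real.norm_of_nonneg hδ, add_mul, one_mul, mul_assoc]
    gcongr
    exact hblip x y
  have hnD : ∀ x, ‖ContinuousLinearMap.id ℝ (Vec k) - δ • fderiv ℝ b x‖ ≤ 1 + δ * L := fun x => by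
    refine (norm_sub_le _ _).trans ?_
    rw [norm_smul, Real.norm_of_nonneg hδ]
    gcongr
    · exact ContinuousLinearMap.norm_id_le
    · exact hbL x
  have hf : ∀ x, fderiv ℝ (fun x => u (Φ x)) x
      = (fderiv ℝ u (Φ x)).comp (ContinuousLinearMap.id ℝ (Vec k) - δ • fderiv ℝ b x) :=
    fun x => ((hu.differentiable (Φ x)).hasFDerivAt.comp x (hΦ' x)).fderiv
  have hexp : 1 + δ * L ≤ Real.exp (L * δ) := by
    have := Real.add_one_le_exp (L * δ)
    linarith
  have hexp2 : (1 + δ * L) ^ 2 ≤ Real.exp (2 * L * δ) := by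
    have : Real.exp (2 * L * δ) = Real.exp (L * δ) ^ 2 := by rw [← Real.exp_nat_mul]; ring_nf
    rw [this]
    gcongr
  refine ⟨hu.contDiff.comp (contDiff_id.sub (hb.const_smul δ)), ?_, fun x => ?_, fun x y => ?_⟩
  · obtain ⟨r, hr⟩ := hu.hasCompactSupport.isCompact.isBounded.subset_closedBall (0 : Vec k)
    -- Since δL ≤ 1/2, |Φ x| ≥ |x|/2 - δ|b 0|; the radius is what this gives for |Φ x| ≤ r.
    refine HasCompactSupport.intro (isCompact_closedBall (0 : Vec k) (2 * (r + δ * ‖b 0‖)))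
      fun x hx => ?_
    refine image_eq_zero_of_notMem_tsupport fun hmem => hx ?_
    have h1 : ‖Φ x‖ ≤ r := by simpa using hr hmem
    have h2 := hblip x 0
    rw [sub_zero] at h2
    have h3 : ‖b x‖ ≤ ‖b x - b 0‖ + ‖b 0‖ := by simpa using norm_add_le (b x - b 0) (b 0)
    have h4 : ‖x‖ ≤ ‖Φ x‖ + δ * ‖b x‖ := by
      have := norm_add_le (Φ x) (δ • b x)
      rwa [norm_smul, Real.norm_of_nonneg hδ, hΦ, sub_add_cancel] at this
    have h5 : δ * ‖b x‖ ≤ δ * (L * ‖x‖ + ‖b 0‖) := by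
      gcongr
      linarith
    have h6 : δ * L * ‖x‖ ≤ 1 / 2 * ‖x‖ := by gcongr
    rw [mem_closedBall_zero_iff]
    linarith
  · rw [hf]
    refine (ContinuousLinearMap.opNorm_comp_le _ _).trans ?_
    gcongr
    · exact hu.3 _
    · exact (hnD x).trans hexp
  · rw [hf, hf]
    set D := fun x => ContinuousLinearMap.id ℝ (Vec k) - δ • fderiv ℝ b x
    have e : (fderiv ℝ u (Φ x)).comp (D x) - (fderiv ℝ u (Φ y)).comp (D y)
        = (fderiv ℝ u (Φ x) - fderiv ℝ u (Φ y)).comp (D x)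
          + (fderiv ℝ u (Φ y)).comp (δ • (fderiv ℝ b y - fderiv ℝ b x)) := by
      ext v
      simp [D, smul_sub]
      ring
    change ‖(fderiv ℝ u (Φ x)).comp (D x) - (fderiv ℝ u (Φ y)).comp (D y)‖ ≤ _
    rw [e]
    have h1 : ‖(fderiv ℝ u (Φ x) - fderiv ℝ u (Φ y)).comp (D x)‖
        ≤ M * ((1 + δ * L) * ‖x - y‖) * (1 + δ * L) := by
      refine (ContinuousLinearMap.opNorm_comp_le _ _).trans ?_
      gcongr
      · refine (hu.4 _ _).trans ?_
        gcongr
        exact hΦlip x y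
      · exact hnD x
    have h2 : ‖(fderiv ℝ u (Φ y)).comp (δ • (fderiv ℝ b y - fderiv ℝ b x))‖
        ≤ A * (δ * (N * ‖x - y‖)) := by
      refine (ContinuousLinearMap.opNorm_comp_le _ _).trans ?_
      rw [norm_smul, Real.norm_of_nonneg hδ]
      gcongr
      · exact hu.3 _
      · rw [norm_sub_rev]
        exact hbN x y
    have hN : 0 ≤ N * ‖x - y‖ := (norm_nonneg _).trans (hbN x y)
    have h3 : 1 ≤ (1 + δ * L) ^ 2 := by nlinarith [mul_nonneg hδ hL]
    calc _ ≤ M * ((1 + δ * L) * ‖x - y‖) * (1 + δ * L) + A * (δ * (N * ‖x - y‖)) :=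
          (norm_add_le _ _).trans (add_le_add h1 h2)
      _ ≤ M * ‖x - y‖ * (1 + δ * L) ^ 2 + A * (δ * (N * ‖x - y‖)) * (1 + δ * L) ^ 2 := by
          have := le_mul_of_one_le_right (by positivity : 0 ≤ A * (δ * (N * ‖x - y‖))) h3
          linarith
      _ = (M * ‖x - y‖ + A * (δ * (N * ‖x - y‖))) * (1 + δ * L) ^ 2 := by ring
      _ ≤ (M * ‖x - y‖ + A * (δ * (N * ‖x - y‖))) * Real.exp (2 * L * δ) := by
          gcongr
      _ = _ := by ring

/-- Weak solutions of the continuity equation with velocity `-b` on `[0,T]`. -/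
structure IsTransported (b : ℝ → Vec k → Vec k) (T Λ : ℝ) (m : ℝ → P2 k) : Prop where
  moment_le : ∀ s ∈ Icc 0 T, ∫ θ, ‖θ‖ ^ 2 ∂(m s).law ≤ Λ
  close : ∀ η > 0, ∃ δ > 0, ∀ s ∈ Icc 0 T, ∀ r ∈ Icc 0 T, |s - r| < δ →
    CloseMeas η (m s).law (m r).law
  hasDerivAt : ∀ u : Vec k → ℝ, ContDiff ℝ ((⊤ : ℕ∞) : WithTop ℕ∞) u → HasCompactSupport u →
    ∀ s ∈ Ioo 0 T, HasDerivAt (fun r => ∫ θ, u θ ∂(m r).law)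
      (-∫ θ, inner ℝ (gradient u θ) (b s θ) ∂(m s).law) s

lemma inner_gradient_eq (u : Vec k → ℝ) (θ v : Vec k) :
    inner ℝ (gradient u θ) v = fderiv ℝ u θ v := by
  rw [gradient, InnerProductSpace.toDual_symm_apply]

lemma TestBounds.wLip {A M : ℝ} {u : Vec k → ℝ} (hu : TestBounds A M u) : WLip A u :=
  fun x y => (hu.sub_le x y).trans (by
    have hA := hu.nonneg
    gcongr
    exact le_mul_of_one_le_right hA (by linarith [norm_nonneg x, norm_nonneg y]))

/-- A bounded Lipschitz derivative applied to a Lipschitz field of linear growth is weighted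
Lipschitz, so the transport term may be tested under `CloseMeas`. -/
lemma TestBounds.wLip_fderiv_apply {A M L : ℝ} {u : Vec k → ℝ} (hu : TestBounds A M u)
    (hM : 0 ≤ M) {b : Vec k → Vec k} (hb : ∀ x y, ‖b x - b y‖ ≤ L * ‖x - y‖)
    (hg : ∀ x, ‖b x‖ ≤ L * (1 + ‖x‖)) : WLip (M * L + A * L) (fun θ => fderiv ℝ u θ (b θ)) :=
  fun x y => by
  have hA := hu.nonneg
  have hL : 0 ≤ L := by simpa using (norm_nonneg _).trans (hg 0)
  have e : fderiv ℝ u x (b x) - fderiv ℝ u y (b y)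
      = (fderiv ℝ u x - fderiv ℝ u y) (b x) + fderiv ℝ u y (b x - b y) := by
    simp only [sub_apply, map_sub]; ring
  rw [e]
  have h1 : ‖(fderiv ℝ u x - fderiv ℝ u y) (b x)‖ ≤ M * ‖x - y‖ * (L * (1 + ‖x‖)) :=
    (ContinuousLinearMap.le_opNorm _ _).trans
      (mul_le_mul (hu.4 _ _) (hg x) (norm_nonneg _) (by positivity))
  have h2 : ‖fderiv ℝ u y (b x - b y)‖ ≤ A * (L * ‖x - y‖) :=
    (ContinuousLinearMap.le_opNorm _ _).trans (mul_le_mul (hu.3 _) (hb x y) (norm_nonneg _) hA)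
  have h3 : 0 ≤ M * L * ‖x - y‖ * ‖y‖ := by positivity
  have h4 : 0 ≤ A * L * ‖x - y‖ * (‖x‖ + ‖y‖) := by positivity
  exact (norm_add_le _ _).trans (by linarith)

/-- The error of one step of the Euler scheme. -/
lemma IsTransported.euler_error {b : ℝ → Vec k → Vec k} {T Λ L : ℝ} {m : ℝ → P2 k}
    (hm : IsTransported b T Λ m) (hb : ∀ s ∈ Icc 0 T, ∀ x y, ‖b s x - b s y‖ ≤ L * ‖x - y‖)
    (hg : ∀ s ∈ Icc 0 T, ∀ x, ‖b s x‖ ≤ L * (1 + ‖x‖)) {A M : ℝ} {u : Vec k → ℝ}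
    (hu : TestBounds A M u) (hM : 0 ≤ M) {s δ ω η e : ℝ} (hs : 0 ≤ s) (hδ : 0 < δ) (hsT : s + δ ≤ T)
    (hω : ∀ r ∈ Icc s (s + δ), ∀ x, ‖b r x - b s x‖ ≤ ω * (1 + ‖x‖))
    (hη : ∀ r ∈ Icc s (s + δ), CloseMeas η (m r).law (m s).law)
    {b' : Vec k → Vec k} (hb'c : Continuous b') (hb' : ∀ x, ‖b' x - b s x‖ ≤ e) :
    |∫ θ, u θ ∂(m (s + δ)).law - ∫ θ, u (θ - δ • b' θ) ∂(m s).law|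
      ≤ δ * (A * ω * (2 * (1 + Λ)) + (M * L + A * L + 1) * η + A * e
          + M * δ * (L + e) ^ 2 * (2 * (1 + Λ))) := by
  have hA := hu.nonneg
  have hsub : Icc s (s + δ) ⊆ Icc 0 T := Icc_subset_Icc hs hsT
  have hs' : s ∈ Icc s (s + δ) := ⟨le_rfl, by linarith⟩
  have hL : 0 ≤ L := by simpa using (norm_nonneg _).trans (hg s (hsub hs') 0)
  have he : 0 ≤ e := (norm_nonneg _).trans (hb' 0)
  have hω0 : 0 ≤ ω := by simpa using (norm_nonneg _).trans (hω s hs' 0)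
  have hbc : ∀ r ∈ Icc s (s + δ), Continuous (b r) := fun r hr =>
    (LipschitzWith.of_dist_le' (K := L) fun x y => by
      rw [dist_eq_norm, dist_eq_norm]
      exact hb r (hsub hr) x y).continuous
  have hfc : Continuous (fderiv ℝ u) := hu.contDiff.continuous_fderiv (by simp)
  have hmom : ∀ r ∈ Icc s (s + δ), ∫ θ, (1 + ‖θ‖) ^ 2 ∂(m r).law ≤ 2 * (1 + Λ) := fun r hr =>
    (m r).integral_one_add_sq_le.trans (by gcongr; exact hm.moment_le r (hsub hr))
  have hcont : ContinuousOn (fun r => ∫ θ, u θ ∂(m r).law) (Icc s (s + δ)) := by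
    rw [Metric.continuousOn_iff]
    intro r hr ε hε
    obtain ⟨δ', hδ', h⟩ := hm.close (ε / (2 * (A + 1))) (by positivity)
    refine ⟨δ', hδ', fun r' hr' hrr => ?_⟩
    have h1 := (h r' (hsub hr') r (hsub hr) hrr).norm_integral_sub_le
      (by positivity : 0 < A + 1) (F := u) (fun x y => (hu.wLip x y).trans (by
        gcongr
        linarith))
    rw [dist_eq_norm]
    have h2 : (A + 1) * (ε / (2 * (A + 1))) = ε / 2 := by field_simp
    linarith
  -- The mean value theorem evaluates the weak equation at an intermediate time c. The estimates
  -- `hG1`, `hG2` and `hG3` then replace the field at c by the field at s, the measure at c by the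
  -- measure at s, and the linear step by composition with the mollified Euler map.
  obtain ⟨c, hc, hslope⟩ := exists_hasDerivAt_eq_slope (fun r => ∫ θ, u θ ∂(m r).law)
    (fun r => -∫ θ, inner ℝ (gradient u θ) (b r θ) ∂(m r).law) (by linarith : s < s + δ) hcont
    fun r hr => hm.hasDerivAt u hu.contDiff hu.hasCompactSupport r
      ⟨hs.trans_lt hr.1, hr.2.trans_le hsT⟩
  simp only [inner_gradient_eq, add_sub_cancel_left] at hslope
  rw [eq_div_iff hδ.ne'] at hslope
  have hc' := Ioo_subset_Icc_self hc
  have hi : ∀ v : Vec k → Vec k, Continuous v → ∀ D, (∀ x, ‖v x‖ ≤ D * (1 + ‖x‖)) → ∀ ρ : P2 k,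
      Integrable (fun θ => fderiv ℝ u θ (v θ)) ρ.law := fun v hv D hD ρ =>
    ρ.integrable_of_linear_growth (C := A * D) (hfc.clm_apply hv).aestronglyMeasurable fun θ =>
      (ContinuousLinearMap.le_opNorm _ _).trans (by
        rw [mul_assoc]
        exact mul_le_mul (hu.3 θ) (hD θ) (norm_nonneg _) hA)
  have hG1 : |∫ θ, fderiv ℝ u θ (b c θ) ∂(m c).law - ∫ θ, fderiv ℝ u θ (b s θ) ∂(m c).law|
      ≤ A * ω * (2 * (1 + Λ)) := by
    rw [← integral_sub (hi _ (hbc c hc') L (hg c (hsub hc')) _)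
      (hi _ (hbc s hs') L (hg s (hsub hs')) _), ← Real.norm_eq_abs]
    calc _ ≤ ∫ θ, A * ω * (1 + ‖θ‖) ^ 2 ∂(m c).law := by
          refine norm_integral_le_of_norm_le ((m c).integrable_one_add_sq.const_mul _)
            (ae_of_all _ fun θ => ?_)
          rw [← map_sub]
          calc _ ≤ A * (ω * (1 + ‖θ‖)) := (ContinuousLinearMap.le_opNorm _ _).trans
                (mul_le_mul (hu.3 θ) (hω c hc' θ) (norm_nonneg _) hA)
            _ = A * ω * (1 + ‖θ‖) := by ring
            _ ≤ _ := by
                gcongr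
                nlinarith [norm_nonneg θ]
      _ ≤ _ := by
          rw [integral_const_mul]
          gcongr
          exact hmom c hc'
  have hG2 : |∫ θ, fderiv ℝ u θ (b s θ) ∂(m c).law - ∫ θ, fderiv ℝ u θ (b s θ) ∂(m s).law|
      ≤ (M * L + A * L + 1) * η :=
    (hη c hc').norm_integral_sub_le (by positivity) fun x y =>
      (hu.wLip_fderiv_apply hM (hb s (hsub hs')) (hg s (hsub hs')) x y).trans (by
        have : M * L + A * L ≤ M * L + A * L + 1 := by linarith
        gcongr)
  have hi1 := hu.wLip.integrable hA (m s)
  have hi2 := hi _ (hbc s hs') L (hg s (hsub hs')) (m s)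
  have hb'g : ∀ x, ‖b' x‖ ≤ (L + e) * (1 + ‖x‖) := fun x => by
    have h1 : ‖b' x‖ ≤ ‖b' x - b s x‖ + ‖b s x‖ := by
      simpa using norm_add_le (b' x - b s x) (b s x)
    have h2 := hb' x
    have h3 := hg s (hsub hs') x
    have h4 : 0 ≤ e * ‖x‖ := by positivity
    linarith
  have hpt : ∀ x, |u (x - δ • b' x) - u x + δ * fderiv ℝ u x (b s x)|
      ≤ M * (δ ^ 2 * ((L + e) ^ 2 * (1 + ‖x‖) ^ 2)) + δ * (A * e) := fun x => by
    have h1 := norm_sub_sub_fderiv_le hM hu.differentiable (fun z => hu.4 z x) (x - δ • b' x)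
    have e1 : x - δ • b' x - x = -(δ • b' x) := by abel
    rw [e1, norm_neg, norm_smul, Real.norm_of_nonneg hδ.le, mul_pow] at h1
    have h2 : ‖fderiv ℝ u x (b' x - b s x)‖ ≤ A * e :=
      (ContinuousLinearMap.le_opNorm _ _).trans (mul_le_mul (hu.3 x) (hb' x) (norm_nonneg _) hA)
    have e2 : u (x - δ • b' x) - u x + δ * fderiv ℝ u x (b s x)
        = (u (x - δ • b' x) - u x - fderiv ℝ u x (-(δ • b' x)))
          - δ * fderiv ℝ u x (b' x - b s x) := by
      simp only [map_neg, map_smul, map_sub, smul_eq_mul]; ring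
    rw [e2]
    refine (abs_sub _ _).trans (add_le_add (h1.trans ?_) ?_)
    · rw [← mul_pow (L + e)]
      gcongr
      exact hb'g x
    · rw [abs_mul, abs_of_pos hδ]
      gcongr
      exact h2
  have hi3 : Integrable (fun x => u (x - δ • b' x)) (m s).law := by
    obtain ⟨D, hD⟩ := hu.hasCompactSupport.exists_bound_of_continuous hu.contDiff.continuous
    exact (integrable_const D).mono' (hu.contDiff.continuous.comp
      (continuous_id.sub (hb'c.const_smul δ))).aestronglyMeasurable (ae_of_all _ fun x => hD _)
  have hG3 : |∫ θ, u (θ - δ • b' θ) ∂(m s).law - ∫ θ, u θ ∂(m s).law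
      + δ * ∫ θ, fderiv ℝ u θ (b s θ) ∂(m s).law|
      ≤ δ * (A * e + M * δ * (L + e) ^ 2 * (2 * (1 + Λ))) := by
    rw [← integral_const_mul, ← integral_sub hi3 hi1]
    have s1 := integral_add (hi3.sub hi1) (hi2.const_mul δ)
    simp only [Pi.sub_apply] at s1
    rw [← s1, ← Real.norm_eq_abs]
    calc _ ≤ ∫ x, (M * δ ^ 2 * (L + e) ^ 2 * (1 + ‖x‖) ^ 2 + δ * (A * e)) ∂(m s).law := by
          refine norm_integral_le_of_norm_le
            (((m s).integrable_one_add_sq.const_mul _).add (integrable_const _))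
            (ae_of_all _ fun x => (hpt x).trans (le_of_eq (by ring)))
      _ = M * δ ^ 2 * (L + e) ^ 2 * ∫ x, (1 + ‖x‖) ^ 2 ∂(m s).law + δ * (A * e) := by
          rw [integral_add ((m s).integrable_one_add_sq.const_mul _) (integrable_const _),
            integral_const_mul, integral_const, probReal_univ, one_smul]
      _ ≤ M * δ ^ 2 * (L + e) ^ 2 * (2 * (1 + Λ)) + δ * (A * e) := by
          gcongr
          exact hmom s hs'
      _ = _ := by ring
  set I₁ := ∫ θ, u θ ∂(m (s + δ)).law
  set I₀ := ∫ θ, u θ ∂(m s).law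
  set J := ∫ θ, u (θ - δ • b' θ) ∂(m s).law
  set Gc := ∫ θ, fderiv ℝ u θ (b c θ) ∂(m c).law
  set Gm := ∫ θ, fderiv ℝ u θ (b s θ) ∂(m c).law
  set Gs := ∫ θ, fderiv ℝ u θ (b s θ) ∂(m s).law
  have e3 : I₁ - J = -δ * (Gc - Gm) - δ * (Gm - Gs) - (J - I₀ + δ * Gs) := by linarith
  have a1 := abs_le.1 hG1
  have a2 := abs_le.1 hG2
  have a3 := abs_le.1 hG3
  rw [e3, abs_le]
  constructor <;> nlinarith

end EulerScheme

end MeanFieldResNet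

namespace MeanFieldResNet

/-! ### Duality argument for the linear continuity equation. -/

section LinearUniqueness

variable {k : ℕ}

/-- Two transported families with the same initial value stay close on test functions. -/
lemma IsTransported.abs_integral_sub_le {b : ℝ → Vec k → Vec k} {T Λ L : ℝ} {m m' : ℝ → P2 k}
    (hT : 0 < T) (hΛ : 0 ≤ Λ) (hm : IsTransported b T Λ m) (hm' : IsTransported b T Λ m')
    (h0 : m 0 = m' 0)
    (hb : ∀ s ∈ Icc 0 T, ∀ x y, ‖b s x - b s y‖ ≤ L * ‖x - y‖)
    (hg : ∀ s ∈ Icc 0 T, ∀ x, ‖b s x‖ ≤ L * (1 + ‖x‖))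
    (hω : ∀ ω > 0, ∃ δ > 0, ∀ s ∈ Icc 0 T, ∀ r ∈ Icc 0 T, |s - r| < δ →
      ∀ x, ‖b s x - b r x‖ ≤ ω * (1 + ‖x‖))
    {A M : ℝ} {u : Vec k → ℝ} (hu : TestBounds A M u) (hM : 0 ≤ M) {κ : ℝ} (hκ : 0 < κ) :
    |∫ θ, u θ ∂(m T).law - ∫ θ, u θ ∂(m' T).law| ≤ 8 * T * κ := by
  have hA := hu.nonneg
  have hL : 0 ≤ L := by simpa using (norm_nonneg _).trans (hg 0 ⟨le_rfl, hT.le⟩ 0)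
  set A' := A * Real.exp (L * T) with hA'
  have hA'0 : 0 ≤ A' := by positivity
  -- The parameters ε, ω, η and δ make the four terms of the one-step error at most κ each; two
  -- families give the factor 8. The order matters: M' depends on the mollification scale ε and may
  -- be huge, but η and δ are chosen after it.
  set ε := κ / (A' * L + 1)
  have hε : 0 < ε := by positivity
  have hεκ : A' * (L * ε) ≤ κ := by
    have : (A' * L + 1) * ε = κ := by simp only [ε]; field_simp
    linarith
  obtain ⟨N, hN0, hN⟩ := exists_mollification (k := k) hL hε
  -- These are the bounds for the first derivative and for the Lipschitz constant of the derivative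
  -- of a test function pulled back over a time r. They satisfy the recursion of `comp_euler`.
  set a : ℝ → ℝ := fun r => A * Real.exp (L * r) with ha
  set c : ℝ → ℝ := fun r => (M + r * (A' * N)) * Real.exp (2 * L * r) with hc
  have ha0 : ∀ r, 0 ≤ a r := fun r => by positivity
  have haA : ∀ r ≤ T, a r ≤ A' := fun r hr => by simp only [ha, hA']; gcongr
  have hc0 : ∀ r, 0 ≤ r → 0 ≤ c r := fun r hr => by positivity
  set M' := c T with hM'
  have hM'0 : 0 ≤ M' := hc0 T hT.le
  have hcM : ∀ r, 0 ≤ r → r ≤ T → c r ≤ M' := fun r hr hrT => by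
    simp only [hM', hc]; gcongr
  have hab : ∀ r δ, a r * Real.exp (L * δ) = a (r + δ) := fun r δ => by
    simp only [ha]; rw [mul_add, Real.exp_add]; ring
  have hcb : ∀ r δ, 0 ≤ r → r ≤ T → 0 ≤ δ →
      (c r + δ * a r * N) * Real.exp (2 * L * δ) ≤ c (r + δ) := fun r δ hr hrT hδ => by
    have h1 : (1 : ℝ) ≤ Real.exp (2 * L * r) := Real.one_le_exp (by positivity)
    have h2 : δ * a r * N ≤ δ * A' * N * Real.exp (2 * L * r) := by
      calc δ * a r * N ≤ δ * A' * N := by gcongr; exact haA r hrT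
        _ ≤ _ := le_mul_of_one_le_right (by positivity) h1
    calc _ ≤ (c r + δ * A' * N * Real.exp (2 * L * r)) * Real.exp (2 * L * δ) := by gcongr
      _ = c (r + δ) := by
          simp only [hc]; rw [mul_add (2 * L), Real.exp_add]; ring
  set ω := κ / (A' * (2 * (1 + Λ)) + 1)
  have hω0 : 0 < ω := by positivity
  have hωκ : A' * ω * (2 * (1 + Λ)) ≤ κ := by
    have : (A' * (2 * (1 + Λ)) + 1) * ω = κ := by simp only [ω]; field_simp
    linarith
  set η := κ / (M' * L + A' * L + 1)
  have hη0 : 0 < η := by positivity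
  have hηκ : (M' * L + A' * L + 1) * η ≤ κ := by
    simp only [η]
    rw [mul_div_cancel₀]
    positivity
  obtain ⟨δ₁, hδ₁, h1⟩ := hω ω hω0
  obtain ⟨δ₂, hδ₂, h2⟩ := hm.close η hη0
  obtain ⟨δ₃, hδ₃, h3⟩ := hm'.close η hη0
  set q := M' * (L + L * ε) ^ 2 * (2 * (1 + Λ))
  have hq : 0 ≤ q := by positivity
  set δ₀ := min (min δ₁ (min δ₂ δ₃)) (min (κ / (q + 1)) (1 / (2 * (L + 1))))
  have hδ₀ : 0 < δ₀ := by positivity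
  obtain ⟨n, hn⟩ := exists_nat_gt (T / δ₀)
  have hn0 : (0 : ℝ) < n := (by positivity : 0 ≤ T / δ₀).trans_lt hn
  set δ := T / n with hδe
  have hδ : 0 < δ := by positivity
  have hnδ : n * δ = T := by rw [hδe]; field_simp
  have hδδ : δ < δ₀ := by
    rw [hδe, div_lt_iff₀ hn0]
    rwa [div_lt_iff₀ hδ₀, mul_comm] at hn
  have hd1 : δ < δ₁ := hδδ.trans_le ((min_le_left _ _).trans (min_le_left _ _))
  have hd2 : δ < δ₂ := hδδ.trans_le ((min_le_left _ _).trans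
    ((min_le_right _ _).trans (min_le_left _ _)))
  have hd3 : δ < δ₃ := hδδ.trans_le ((min_le_left _ _).trans
    ((min_le_right _ _).trans (min_le_right _ _)))
  have hd4 : q * δ ≤ κ := by
    have : δ ≤ κ / (q + 1) := hδδ.le.trans ((min_le_right _ _).trans (min_le_left _ _))
    rw [le_div_iff₀ (by positivity)] at this
    linarith
  have hd5 : δ * L ≤ 1 / 2 := by
    have : δ ≤ 1 / (2 * (L + 1)) := hδδ.le.trans ((min_le_right _ _).trans (min_le_right _ _))
    rw [le_div_iff₀ (by positivity)] at this
    linarith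
  -- A test function at time (j+1)δ is exchanged for its composition with an Euler step at time jδ,
  -- the same one for both families. At time 0 the families coincide, so the errors of at most n
  -- steps remain, in total n·δ·8κ = 8Tκ.
  have key : ∀ j : ℕ, j ≤ n → ∀ v : Vec k → ℝ, TestBounds (a (T - j * δ)) (c (T - j * δ)) v →
      |∫ θ, v θ ∂(m (j * δ)).law - ∫ θ, v θ ∂(m' (j * δ)).law| ≤ j * (δ * (8 * κ)) := by
    intro j
    induction j with
    | zero => intro _ v _; simp [h0]
    | succ j ih =>
      intro hj v hv
      set s := (j : ℝ) * δ with hs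
      have hs0 : 0 ≤ s := by positivity
      have hsδ : ((j + 1 : ℕ) : ℝ) * δ = s + δ := by push_cast; ring
      rw [hsδ] at hv ⊢
      have hsT : s + δ ≤ T := by
        rw [← hsδ, ← hnδ]
        gcongr
      have hsub : Icc s (s + δ) ⊆ Icc 0 T := Icc_subset_Icc hs0 hsT
      have hsI : s ∈ Icc 0 T := ⟨hs0, by linarith⟩
      have hr0 : 0 ≤ T - (s + δ) := by linarith
      have hrT : T - (s + δ) ≤ T := by linarith
      obtain ⟨b', hb's, hb'e, hb'L, hb'N⟩ := hN (b s) (hb s hsI)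
      have hcomp : TestBounds (a (T - s)) (c (T - s)) fun x => v (x - δ • b' x) := by
        refine (hv.comp_euler (hc0 _ hr0) hb's hb'L hb'N hδ.le hd5).mono ?_ ?_
        · rw [hab]
          exact le_of_eq (by ring_nf)
        · refine (hcb _ δ hr0 hrT hδ.le).trans (le_of_eq ?_)
          ring_nf
      have hIH := ih (by omega) _ hcomp
      have hv' := hv.mono (haA _ hrT) (hcM _ hr0 hrT)
      have hdist : ∀ r ∈ Icc s (s + δ), |r - s| ≤ δ := fun r hr => by
        rw [abs_le]
        constructor <;> linarith [hr.1, hr.2]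
      have e1 := hm.euler_error hb hg hv' hM'0 hs0 hδ hsT
        (fun r hr => h1 r (hsub hr) s hsI ((hdist r hr).trans_lt hd1))
        (fun r hr => h2 r (hsub hr) s hsI ((hdist r hr).trans_lt hd2)) hb's.continuous hb'e
      have e2 := hm'.euler_error hb hg hv' hM'0 hs0 hδ hsT
        (fun r hr => h1 r (hsub hr) s hsI ((hdist r hr).trans_lt hd1))
        (fun r hr => h3 r (hsub hr) s hsI ((hdist r hr).trans_lt hd3)) hb's.continuous hb'e
      have hκ4 : δ * (A' * ω * (2 * (1 + Λ)) + (M' * L + A' * L + 1) * η + A' * (L * ε)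
          + M' * δ * (L + L * ε) ^ 2 * (2 * (1 + Λ))) ≤ δ * (4 * κ) := by
        gcongr
        have : M' * δ * (L + L * ε) ^ 2 * (2 * (1 + Λ)) = q * δ := by simp only [q]; ring
        linarith
      have a1 := abs_le.1 (e1.trans hκ4)
      have a2 := abs_le.1 (e2.trans hκ4)
      have a3 := abs_le.1 hIH
      push_cast
      rw [abs_le]
      constructor <;> linarith
  have hfin := key n le_rfl u (by
    rw [hnδ, sub_self]
    simpa [ha, hc] using hu)
  rw [hnδ] at hfin
  refine hfin.trans (le_of_eq ?_)
  rw [← mul_assoc, hnδ]; ring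

/-- Uniqueness for the linear continuity equation. -/
theorem IsTransported.law_eq {b : ℝ → Vec k → Vec k} {T Λ L : ℝ} {m m' : ℝ → P2 k}
    (hT : 0 < T) (hΛ : 0 ≤ Λ) (hm : IsTransported b T Λ m) (hm' : IsTransported b T Λ m')
    (h0 : m 0 = m' 0)
    (hb : ∀ s ∈ Icc 0 T, ∀ x y, ‖b s x - b s y‖ ≤ L * ‖x - y‖)
    (hg : ∀ s ∈ Icc 0 T, ∀ x, ‖b s x‖ ≤ L * (1 + ‖x‖))
    (hω : ∀ ω > 0, ∃ δ > 0, ∀ s ∈ Icc 0 T, ∀ r ∈ Icc 0 T, |s - r| < δ →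
      ∀ x, ‖b s x - b r x‖ ≤ ω * (1 + ‖x‖)) : m T = m' T := by
  refine P2.ext (measure_eq_of_integral_contDiff_eq fun u hu hc => ?_)
  obtain ⟨c, hc0, -, h2, h3⟩ := exists_bounds_of_hasCompactSupport hu hc
  have key := fun κ (hκ : 0 < κ) => hm.abs_integral_sub_le hT hΛ hm' h0 hb hg hω
    ⟨hu, hc, h2, h3⟩ hc0 hκ
  refine eq_of_abs_sub_nonpos (le_of_forall_pos_le_add fun ε hε => ?_)
  refine (key (ε / (8 * T)) (by positivity)).trans (le_of_eq ?_)
  field_simp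
  simp

end LinearUniqueness

end MeanFieldResNet

namespace MeanFieldResNet

/-! ### Uniqueness of weak solutions of the gradient flow -/

section Uniqueness

variable {d k : ℕ} {f : Vec d → Vec k → Vec d} {g y : Vec d → ℝ} {μ : Measure (Vec d)}
  {C K R : ℝ}

lemma abs_exp_neg_sub_le {s r : ℝ} (hs : 0 ≤ s) (hr : 0 ≤ r) :
    |Real.exp (-s) - Real.exp (-r)| ≤ |s - r| := by
  have h := (convex_Iic (0 : ℝ)).norm_image_sub_le_of_norm_deriv_le (f := Real.exp) (C := 1)
    (fun x _ => Real.differentiableAt_exp) (fun x hx => by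
      rw [Real.deriv_exp, Real.norm_of_nonneg (Real.exp_pos x).le]
      exact Real.exp_le_one_iff.2 hx) (neg_nonpos.2 hr) (neg_nonpos.2 hs)
  rw [one_mul, Real.norm_eq_abs, Real.norm_eq_abs, neg_sub_neg, abs_sub_comm r s] at h
  exact h

lemma dist_toNNReal {s r : ℝ} (hs : 0 ≤ s) (hr : 0 ≤ r) : dist s.toNNReal r.toNNReal = |s - r| := by
  rw [NNReal.dist_eq, Real.coe_toNNReal s hs, Real.coe_toNNReal r hr]

lemma FlowP2.isTransported (σ : FlowP2 k) {b : ℝ → Vec k → Vec k} {t : I01} {T Λ : ℝ}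
    (hΛ : ∀ s ≤ T.toNNReal, ∀ t, ∫ θ, ‖θ‖ ^ 2 ∂(σ s t) ≤ Λ)
    (hσ : ∀ u : Vec k → ℝ, ContDiff ℝ ((⊤ : ℕ∞) : WithTop ℕ∞) u → HasCompactSupport u →
      ∀ s : ℝ, 0 < s → HasDerivAt (fun r : ℝ => ∫ θ, u θ ∂(σ r.toNNReal t))
        (-∫ θ, inner ℝ (gradient u θ) (b s θ) ∂(σ s.toNNReal t)) s) :
    IsTransported b T Λ fun s => (σ s.toNNReal).at_time t where
  moment_le s hs := hΛ _ (Real.toNNReal_le_toNNReal hs.2) t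
  close η hη := by
    obtain ⟨δ, hδ, h⟩ := σ.exists_uniform_close T.toNNReal hη
    refine ⟨δ, hδ, fun s hs r hr hsr => h _ (Real.toNNReal_le_toNNReal hs.2) _
      (Real.toNNReal_le_toNNReal hr.2) ?_ t⟩
    rwa [dist_toNNReal hs.1 hr.1]
  hasDerivAt u hu hc s hs := hσ u hu hc s hs.1

namespace Setting

variable (h : Setting f g y μ C K R) [IsProbabilityMeasure μ]
include h

/-- Uniform continuity in pseudo-time of the gradient field along a flow of measures. -/
lemma exists_energyGrad_uniform (ρ : FlowP2 k) (T : ℝ) {ω : ℝ} (hω : 0 < ω) :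
    ∃ δ > 0, ∀ s ∈ Icc 0 T, ∀ r ∈ Icc 0 T, |s - r| < δ → ∀ t θ,
      ‖h.energyGrad (ρ s.toNNReal) s t θ - h.energyGrad (ρ r.toNNReal) r t θ‖
        ≤ ω * (1 + ‖θ‖) := by
  obtain ⟨Λ, hΛ0, hΛ⟩ := ρ.exists_moment_le T.toNNReal
  obtain ⟨L, hL0, hL⟩ := h.exists_energyGrad_close hΛ0 (k := k)
  set η := ω / (2 * (L + 1))
  have hη : 0 < η := by positivity
  have hLη : L * (η + η) ≤ ω := by
    have : 2 * (L + 1) * η = ω := by simp only [η]; field_simp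
    linarith
  obtain ⟨δ, hδ, hc⟩ := ρ.exists_uniform_close T.toNNReal hη
  refine ⟨min δ η, by positivity, fun s hs r hr hsr t θ => ?_⟩
  have hs' : s.toNNReal ≤ T.toNNReal := Real.toNNReal_le_toNNReal hs.2
  have hr' : r.toNNReal ≤ T.toNNReal := Real.toNNReal_le_toNNReal hr.2
  refine (hL _ _ (hΛ _ hs') (hΛ _ hr') η (hc _ hs' _ hr' ?_) s r t θ).trans ?_
  · rw [dist_toNNReal hs.1 hr.1]
    exact hsr.trans_le (min_le_left _ _)
  · refine mul_le_mul_of_nonneg_right (le_trans ?_ hLη) (by positivity)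
    gcongr
    exact (abs_exp_neg_sub_le hs.1 hr.1).trans (hsr.le.trans (min_le_right _ _))

variable {ρ₀ : PathP2 k} (hρ₀ : Admissible ρ₀)
include hρ₀

/-- Every weak solution is transported by displacements. -/
lemma eq_pushPath_of_isSolution {ρ : FlowP2 k} (hρ : IsSolution f g y μ ρ₀ ρ) {ψ : ℝ → Disp k}
    (h0 : ψ 0 = 0) (hψ : ∀ s ∈ Ici (0 : ℝ),
      HasDerivWithinAt ψ (h.vecField (ρ s.toNNReal) s (ψ s)) (Ici 0) s) {T : ℝ} (hT : 0 ≤ T) :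
    ρ T.toNNReal = pushPath hρ₀ (ψ T) := by
  rcases hT.eq_or_lt with rfl | hT
  · rw [h0, pushPath_zero, Real.toNNReal_zero, hρ.1]
  set σ : FlowP2 k := pushFlow hρ₀ ψ fun s hs => (hψ s hs).continuousWithinAt
  have hσ : ∀ r : ℝ, 0 ≤ r → σ r.toNNReal = pushPath hρ₀ (ψ r) := fun r hr => by
    change pushPath hρ₀ (ψ (r.toNNReal : ℝ)) = _
    rw [Real.coe_toNNReal _ hr]
  obtain ⟨Λ₁, hΛ₁, h1⟩ := ρ.exists_moment_le T.toNNReal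
  obtain ⟨Λ₂, -, h2⟩ := σ.exists_moment_le T.toNNReal
  have hΛ₁' : ∀ s ≤ T.toNNReal, ∀ t, ∫ θ, ‖θ‖ ^ 2 ∂(ρ s t) ≤ max Λ₁ Λ₂ := fun s hs t =>
    (h1 s hs t).trans (le_max_left _ _)
  obtain ⟨B, hB0, hB⟩ := h.exists_energyGrad_bound (max Λ₁ Λ₂) (k := k)
  have hB' := fun s (hs : s ∈ Icc 0 T) => hB (ρ s.toNNReal)
    (meanMoment_le (hΛ₁' _ (Real.toNNReal_le_toNNReal hs.2))) s hs.1
  rw [← hσ T hT.le]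
  refine PathP2.ext (funext fun t => ?_)
  -- Both flows solve the same linear equation at layer t, with velocity frozen along ρ; for the
  -- transported flow this is the equation satisfied by ψ.
  refine IsTransported.law_eq (b := fun s => h.energyGrad (ρ s.toNNReal) s t) (L := B) hT
    (hΛ₁.trans (le_max_left _ _))
    (ρ.isTransported hΛ₁' fun u hu hc s hs => ?_)
    (σ.isTransported (fun s hs t => (h2 s hs t).trans (le_max_right _ _)) fun u hu hc s hs => ?_)
    ?_ (fun s hs x => (hB' s hs t x).2) (fun s hs x => (hB' s hs t x).1) fun ω hω => ?_
  · have := hρ.2 t u hu hc s hs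
    simp only [h.gradient_energyDeriv] at this
    exact this
  · rw [hσ s hs.le]
    refine (h.hasDerivAt_integral_pushPath hρ₀ hs (hψ s hs.le) hu hc t).congr_of_eventuallyEq ?_
    filter_upwards [lt_mem_nhds hs] with r hr
    rw [hσ r hr.le]
  · rw [hσ 0 le_rfl, h0, pushPath_zero, Real.toNNReal_zero, hρ.1]
  · obtain ⟨δ, hδ, hc⟩ := h.exists_energyGrad_uniform ρ T hω
    exact ⟨δ, hδ, fun s hs r hr hsr x => hc s hs r hr hsr t x⟩

/-- Weak solutions coincide with the transport along the solution for displacements. -/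
lemma eq_pushFlow_of_isSolution {ρ : FlowP2 k} (hρ : IsSolution f g y μ ρ₀ ρ) {ψ : ℝ → Disp k}
    (h0 : ψ 0 = 0) (hψ : ∀ s ∈ Ici (0 : ℝ),
      HasDerivWithinAt ψ (h.vecField (pushPath hρ₀ (ψ s)) s (ψ s)) (Ici 0) s) :
    ρ = pushFlow hρ₀ ψ fun s hs => (hψ s hs).continuousWithinAt := by
  obtain ⟨χ, hχ0, hχ⟩ := h.exists_linear_solution ρ
  have hρχ := fun s (hs : s ∈ Ici (0 : ℝ)) => h.eq_pushPath_of_isSolution hρ₀ hρ hχ0 hχ hs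
  -- Since ρ is the image under χ, the frozen field is the field of that image, and χ solves the
  -- nonlinear equation.
  have hEq := h.eqOn_of_solution hρ₀ (hχ0.trans h0.symm)
    (fun s hs => by rw [← hρχ s hs]; exact hχ s hs) hψ
  refine FlowP2.ext (funext fun s => ?_)
  have hs : (s : ℝ) ∈ Ici (0 : ℝ) := s.2
  have := hρχ s hs
  rw [Real.toNNReal_coe, hEq hs] at this
  exact this

end Setting

end Uniqueness

end MeanFieldResNet

theorem mainTheorem6 {d k : ℕ}
    (f : MeanFieldResNet.Vec d → MeanFieldResNet.Vec k → MeanFieldResNet.Vec d)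
    (g y : MeanFieldResNet.Vec d → ℝ)
    (μ : Measure (MeanFieldResNet.Vec d)) [IsProbabilityMeasure μ]
    (hreg : MeanFieldResNet.Regular f g y μ)
    (ρini : MeanFieldResNet.PathP2 k) (hini : MeanFieldResNet.Admissible ρini) :
    (∃! ρ : MeanFieldResNet.FlowP2 k, MeanFieldResNet.IsSolution f g y μ ρini ρ) ∧
    ∀ ρ : MeanFieldResNet.FlowP2 k, MeanFieldResNet.IsSolution f g y μ ρini ρ →
      (∀ s : ℝ≥0, MeanFieldResNet.Admissible (ρ s)) ∧
      (∀ s : ℝ, 0 < s →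
        DifferentiableAt ℝ
          (fun u : ℝ => MeanFieldResNet.energy f g y μ u (ρ u.toNNReal)) s ∧
        deriv (fun u : ℝ => MeanFieldResNet.energy f g y μ u (ρ u.toNNReal)) s ≤ 0) ∧
      Antitone (fun s : ℝ≥0 => MeanFieldResNet.energy f g y μ s (ρ s)) := by
  obtain ⟨C, K, R, h⟩ := hreg.exists_setting
  obtain ⟨ψ, h0, hψ⟩ := h.exists_solution hini
  have huniq := fun ρ (hρ : MeanFieldResNet.IsSolution f g y μ ρini ρ) =>
    h.eq_pushFlow_of_isSolution hini hρ h0 hψ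
  refine ⟨⟨_, h.isSolution_pushFlow hini h0 hψ, huniq⟩, fun ρ hρ => ?_⟩
  have hρψ : ∀ s : ℝ≥0, ρ s = MeanFieldResNet.pushPath hini (ψ s) := fun s => by
    rw [huniq ρ hρ]
    rfl
  refine ⟨fun s => ?_, fun s hs => ?_, fun s r hsr => ?_⟩
  · rw [hρψ]
    exact MeanFieldResNet.admissible_pushPath hini _
  · have he : (fun u : ℝ => MeanFieldResNet.energy f g y μ u (ρ u.toNNReal)) =ᶠ[𝓝 s]
        fun u => MeanFieldResNet.energy f g y μ u (MeanFieldResNet.pushPath hini (ψ u)) := by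
      filter_upwards [lt_mem_nhds hs] with u hu
      rw [hρψ, Real.coe_toNNReal u hu.le]
    obtain ⟨hd, hd'⟩ := h.differentiableAt_energy hini hs (hψ s hs.le)
    exact ⟨hd.congr_of_eventuallyEq he, he.deriv_eq.trans_le hd'⟩
  · have hs : (s : ℝ) ∈ Ici (0 : ℝ) := s.2
    have hr : (r : ℝ) ∈ Ici (0 : ℝ) := r.2
    have := h.antitoneOn_energy hini (convex_Ici 0) hψ hs hr hsr
    simpa only [hρψ] using this
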